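/- **Setting.** Let $d_{\mathcal S},d_{\mathcal A}\ge 1$, $d=d_{\mathcal S}+d_{\mathcal A}$, $\mathcal S=[0,1]^{d_{\mathcal S}}$, $\mathcal A=[0,1]^{d_{\mathcal A}}$, and let $p$ be a transition kernel from $\mathcal S\times\mathcal A$ to $\mathcal S$ and $r:\mathcal S\times\mathcal A\to[0,1]$ a measurable reward. For $\ell\ge 0$ the dyadic cubes of side $2^{-\ell}$ (half-open, except at the upper boundary of the unit cube) that partition $\mathcal S\times\mathcal A$ (resp. $\mathcal S$) are the cells (resp. $\mathcal S$-cells) of level $\ell$; $\mathcal Q^{(\ell)}$ is the set of $\mathcal S$-cells of level $\ell$, $\pi_{\mathcal S},\pi_{\mathcal A}$ are the projections, and every (state, action, or state-action) cell $\zeta$ has a fixed representative point $q(\zeta)\in\zeta$. Let $\rho_{\mathcal S},\rho_{\mathcal A},\rho$ be metrics on $\mathcal S,\mathcal A,\mathcal S\times\mathcal A$ inducing the usual topologies, with $\rho((s,a),(s',a'))\le\rho_{\mathcal S}(s,s')+\rho_{\mathcal A}(a,a')$, normalised so that a cell of level $\ell$ has $\rho$-diameter $\mathrm{diam}(\zeta)=2^{-\ell}$.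 With $\|\mu-\nu\|_{TV}=2\sup_B|\mu(B)-\nu(B)|$, assume for all $z,z'\in\mathcal S\times\mathcal A$ $$|r(z)-r(z')|\le L_r\rho(z,z'),\quad \|p(z,\cdot)-p(z',\cdot)\|_{TV}\le \min\{L_p\,\rho(z,z'),\,2\alpha\},\qquad \alpha\in(0,1).$$ For a measurable policy $\phi:\mathcal S\to\mathcal A$ let $\mu^{(\infty)}_{\phi,p}$ be the stationary probability measure of the chain with kernel $p(s,\phi(s),\cdot)$ and $J(\phi)=\liminf_{n}\frac1n\mathbb E_\phi\sum_{t<n}r(s_t,a_t)$ its average reward. Put $J^\star=\sup_\phi J(\phi)$, let $h$ be the bounded measurable solution (unique up to a constant) of $J^\star+h(s)=\max_a\{r(s,a)+\int h(s')\,p(s,a,ds')\}$, and let $\mathrm{gap}(s,a)=J^\star+h(s)-r(s,a)-\int h(s')\,p(s,a,ds')$. **The algorithm ZoRL.** Let $T\ge 2$ be an integer, $\delta\in(0,1)$, $L_r,L_p,C_v\ge 0$, $C_H,\kappa_1>0$, $\nu$ a probability measure on $\mathcal S$, $C_\eta=4-\alpha+3L_p+C_v$, and let $c_1>0$ satisfy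 $$\log\frac{2T\mathcal N_1}{\delta}=4.5\,c_1\log\frac T\delta,\qquad \mathcal N_1=2\Big(\frac{T}{c_1\log(T/\delta)}\Big)^{d/(d_{\mathcal S}+2)} .$$ *Active cells.* Put $N_{\max}(\zeta)=c_12^{d_{\mathcal S}+2}\log(T/\delta)\,\mathrm{diam}(\zeta)^{-(d_{\mathcal S}+2)}$, and $N_{\min}(\zeta)=1$ if $\zeta=\mathcal S\times\mathcal A$, $N_{\min}(\zeta)=c_1\log(T/\delta)\,\mathrm{diam}(\zeta)^{-(d_{\mathcal S}+2)}$ otherwise. Let $N_t(\zeta)$ be the number of times $i<t$ at which $(s_i,a_i)\in\zeta_i$, where $\zeta_i$ is the cell active at time $i$ with $\zeta\subseteq\zeta_i$ (no visit is counted if there is none). The set $\mathcal P_t$ of active cells is $\mathcal P_0=\{\mathcal S\times\mathcal A\}$ and, for $t\ge1$, the set of $\zeta$ with $N_{\min}(\zeta)\le N_t(\zeta)<N_{\max}(\zeta)$; it partitions $\mathcal S\times\mathcal A$, and $q_t^{-1}(s,a)$ denotes the active cell that contains $(s,a)$. Let $\mathcal Q_t=\mathcal Q^{(\ell_{\max,t})}$,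 with $\ell_{\max,t}$ the largest level of a cell in $\mathcal P_t$, $S_t=\{q(\xi):\xi\in\mathcal Q_t\}$ and $A_t(s)=\{q(\pi_{\mathcal A}(\zeta)):\zeta\in\mathcal P_t,\ s\in\pi_{\mathcal S}(\zeta)\}$. *Estimates.* For $\zeta\in\mathcal P_t$ of level $\ell$ and $\xi\in\mathcal Q^{(\ell)}$ let $N_t(\zeta,\xi)$ be the number of those of the visits counted in $N_t(\zeta)$ after which $s_{i+1}\in\xi$. With $\lambda$ the Lebesgue measure put, for $\xi\in\mathcal Q_t$, $$\hat\wp_t(\zeta,\xi)=\sum_{\xi'\in\mathcal Q^{(\ell)}}\frac{\lambda(\xi\cap\xi')}{\lambda(\xi')}\,\frac{N_t(\zeta,\xi')}{1\vee N_t(\zeta)},\qquad \eta_t(\zeta)=\min\Big\{2,(4-\alpha)\Big(\frac{c_1\log(T/\delta)}{N_t(\zeta)}\Big)^{\frac1{d_{\mathcal S}+2}}+(3L_p+C_v)\,\mathrm{diam}(\zeta)\Big\}$$ ($\eta_t(\zeta)=2$ if $N_t(\zeta)=0$). *Policies.* Let $\mathcal C_t^+$ be the set of kernels $\theta(s,a,\cdot)$,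 $s\in S_t$, $a\in A_t(s)$, of probability vectors on $S_t$ (identified with $\mathcal Q_t$) with $\|\theta(s,a,\cdot)-\hat\wp_t(q_t^{-1}(s,a),\cdot)\|_1\le\eta_t(q_t^{-1}(s,a))$ and all entries at least $\frac{1-\alpha}{|S_t|T}$. Let $\tilde r_t(s,a)=r(q(q_t^{-1}(s,a)))+L_r\,\mathrm{diam}(q_t^{-1}(s,a))$, $c=\frac{1+L_r}{(1-\alpha)(1-1/T)}$, $\gamma=1-\frac{1-\alpha}{|S_t|T}$, and, for $v\in\mathbb R^{S_t}$, $\mathrm{sp}(v)=\max v-\min v$, $$\mathcal Tv(s)=\max_{a\in A_t(s),\,\theta\in\mathcal C_t^+}\Big\{\tilde r_t(s,a)+\sum_{s'}\theta(s,a,s')v(s')\Big\},\qquad \Gamma_cv(s)=\min\{\mathcal Tv(s),\min_{s'}\mathcal Tv(s')+c\}.$$ The procedure ScOpt at time $t$ computes $v_0=0$, $v_{n+1}=\Gamma_cv_n-\min\Gamma_cv_n$ up to the first $n$ with $\mathrm{sp}(v_{n+1}-v_n)+\frac{2\gamma^n}{1-\gamma}\mathrm{sp}(v_1)\le\frac1T$.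 It returns a policy $\tilde\phi$ with $\tilde\phi(s)\in A_t(s)$ such that, for each $s\in S_t$ and some $\theta\in\mathcal C^+_t$, $\tilde r_t(s,\tilde\phi(s))+\sum_{s'}\theta(s,\tilde\phi(s),s')v_n(s')=\Gamma_cv_n(s)$; at a state where the value $\Gamma_cv_n(s)$ is attained neither by an action nor by a randomisation over actions, $\tilde\phi(s)$ and $\theta$ instead minimise the left-hand side. *Episodes.* The first episode starts at time $0$. If the $k$-th episode starts at $\tau_k<T$, then ScOpt is run at time $\tau_k$, its output is extended to $\phi_k:\mathcal S\to\mathcal A$ constant on each $\xi\in\mathcal Q_{\tau_k}$, and $a_t=\phi_k(s_t)$ is played for $\tau_k\le t<\tau_{k+1}$, $t<T$, where $\tau_{k+1}=\tau_k+\lceil H_k\rceil$, $H_k=C_H\log(T/\delta)\big(\kappa_1\int\mathrm{diam}(q^{-1}_{\tau_k}(s,\phi_k(s)))\,\nu(ds)\big)^{-2(d_{\mathcal S}+1)}$. **Event and constants.** Let $\mathcal G_1$ be the event that, for all $0\le t\le T-1$, $\zeta\in\mathcal P_t$ and $z'\in\zeta$, $$\sum_{\xi\in\mathcal Q_t}\big|p(z',\xi)-\hat\wp_t(\zeta,\xi)\big|\le\Big(1-\frac{1-\alpha}{C_\eta}\Big)\eta_t(\zeta).$$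 Put $\mathrm{diam}_t(\phi)=\int_{\mathcal S}\mathrm{diam}(q_t^{-1}(s,\phi(s)))\,\mu^{(\infty)}_{\phi,p}(ds)$ and $$C_1=3L_r+\frac{(1+\max\{1,L_r\})\,(3+3L_p+C_v)}{1-\alpha},$$ which is $3L_r+\frac{2(3+3L_p+C_v)}{1-\alpha}$ if $L_r\le1$. **Lemma.** On every sample path of ZoRL that lies in $\mathcal G_1$, for every episode $k$ with $\tau_k<T$ there is a state $s\in\mathcal S$ such that the active cell $\zeta=q^{-1}_{\tau_k}(s,\phi_k(s))$ at time $\tau_k$ containing $(s,\phi_k(s))$ satisfies $$\mathrm{diam}(\zeta)\ \ge\ \frac1{3C_1}\max\big\{\mathrm{gap}(s,\phi_k(s)),\ C_1\,\mathrm{diam}_{\tau_k}(\phi_k)\big\}\quad\text{and}\quad \mu^{(\infty)}_{\phi_k,p}(\pi_{\mathcal S}(\zeta))\ \ge\ \Big(\frac{\mathrm{diam}_{\tau_k}(\phi_k)}{3}\Big)^{d_{\mathcal S}+1}.$$ -/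

import Mathlib

open MeasureTheory ProbabilityTheory Filter Set

namespace ZoRL

noncomputable section

/-! ### State and action spaces, dyadic cells -/

/-- The unit cube `[0,1]^n`, with its usual topology and Borel sigma-algebra. -/
abbrev Cube (n : ℕ) : Type := Fin n → Set.Icc (0 : ℝ) 1

/-- The dyadic cube of level `ℓ` in `[0,1]^n` with lower corner `2^{-ℓ} v`. Cubes are half-open,
except that the faces lying on the upper boundary of `[0,1]^n` are included, so that the cubes of
level `ℓ` partition `[0,1]^n`. -/
def box {n : ℕ} (ℓ : ℕ) (v : Fin n → Fin (2 ^ ℓ)) : Set (Cube n) :=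
  {x | ∀ i, ((v i : ℕ) : ℝ) / 2 ^ ℓ ≤ (x i : ℝ) ∧
    ((x i : ℝ) < (((v i : ℕ) : ℝ) + 1) / 2 ^ ℓ ∨ (v i : ℕ) + 1 = 2 ^ ℓ)}

/-- A cell of the state-action space `[0,1]^dS × [0,1]^dA`. -/
structure Cell (dS dA : ℕ) where
  level : ℕ
  stIdx : Fin dS → Fin (2 ^ level)
  acIdx : Fin dA → Fin (2 ^ level)

/-- The set of state-action pairs in a cell. -/
def Cell.toSet {dS dA : ℕ} (ζ : Cell dS dA) : Set (Cube dS × Cube dA) :=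
  {z | z.1 ∈ box ζ.level ζ.stIdx ∧ z.2 ∈ box ζ.level ζ.acIdx}

/-- The projection of a cell on the state space. -/
def Cell.piS {dS dA : ℕ} (ζ : Cell dS dA) : Set (Cube dS) :=
  {s | ∃ a, (s, a) ∈ ζ.toSet}

instance (dS dA : ℕ) : Inhabited (Cell dS dA) :=
  ⟨⟨0, fun _ => ⟨0, by norm_num⟩, fun _ => ⟨0, by norm_num⟩⟩⟩

/-- A choice of representative points of the state cells, of the action cells and of the cells. -/
structure Representatives (dS dA : ℕ) where
  qS : (ℓ : ℕ) → (Fin dS → Fin (2 ^ ℓ)) → Cube dS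
  qS_mem : ∀ ℓ v, qS ℓ v ∈ box ℓ v
  qA : (ℓ : ℕ) → (Fin dA → Fin (2 ^ ℓ)) → Cube dA
  qA_mem : ∀ ℓ v, qA ℓ v ∈ box ℓ v
  q : Cell dS dA → Cube dS × Cube dA
  q_mem : ∀ ζ, q ζ ∈ ζ.toSet

/-! ### Metrics -/

/-- `ρ` is a metric on `X` that induces the topology of the compact space `X`
(a metric on a compact space which is jointly continuous induces its topology). -/
structure IsCompatibleMetric {X : Type*} [TopologicalSpace X] (ρ : X → X → ℝ) : Prop where
  eq_zero_iff : ∀ x y, ρ x y = 0 ↔ x = y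
  symm : ∀ x y, ρ x y = ρ y x
  triangle : ∀ x y z, ρ x z ≤ ρ x y + ρ y z
  continuous : Continuous fun w : X × X => ρ w.1 w.2

/-- The diameter of a set with respect to `ρ`. -/
def diam {X : Type*} (ρ : X → X → ℝ) (C : Set X) : ℝ :=
  sSup {d | ∃ x ∈ C, ∃ y ∈ C, d = ρ x y}

/-- Metrics on the state space, on the action space, and a sub-additive metric on the state-action
space, for which the diameter of every cell is half that of its parent, normalised so that the
whole state-action space has diameter `1`. -/
structure Metrics (dS dA : ℕ) where
  ρS : Cube dS → Cube dS → ℝ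
  ρA : Cube dA → Cube dA → ℝ
  ρ : Cube dS × Cube dA → Cube dS × Cube dA → ℝ
  isMetricS : IsCompatibleMetric ρS
  isMetricA : IsCompatibleMetric ρA
  isMetric : IsCompatibleMetric ρ
  subadd : ∀ z w, ρ z w ≤ ρS z.1 w.1 + ρA z.2 w.2
  diam_cell : ∀ ζ : Cell dS dA, diam ρ ζ.toSet = (1 / 2 : ℝ) ^ ζ.level

/-! ### The Markov decision process -/

/-- Total variation norm of the difference of two probability measures, normalised so that it is
at most `2`. -/
def tvDist {X : Type*} [MeasurableSpace X] (μ ν : Measure X) : ℝ :=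
  2 * ⨆ B : {B : Set X // MeasurableSet B}, |μ.real B.1 - ν.real B.1|

structure MDP (dS dA : ℕ) where
  p : Kernel (Cube dS × Cube dA) (Cube dS)
  markov : IsMarkovKernel p
  r : Cube dS × Cube dA → ℝ
  measurable_r : Measurable r
  r_mem : ∀ z, r z ∈ Set.Icc (0 : ℝ) 1

namespace MDP

variable {dS dA : ℕ} (M : MDP dS dA)

/-- The law of the next state, if the state has law `μ` and the policy `φ` is used. -/
def step (φ : Cube dS → Cube dA) (μ : Measure (Cube dS)) : Measure (Cube dS) :=
  μ.bind fun s => M.p (s, φ s)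

/-- The law of the state at time `t`, if the initial state is `s₀` and `φ` is used throughout. -/
def stateLaw (φ : Cube dS → Cube dA) (s₀ : Cube dS) (t : ℕ) : Measure (Cube dS) :=
  (M.step φ)^[t] (Measure.dirac s₀)

/-- The average reward of `φ` from the initial state `s₀`. -/
def avgReward (s₀ : Cube dS) (φ : Cube dS → Cube dA) : ℝ :=
  liminf (fun n : ℕ =>
    (1 / (n : ℝ)) * ∑ t ∈ Finset.range n, ∫ s, M.r (s, φ s) ∂(M.stateLaw φ s₀ t)) atTop

/-- The optimal average reward over all stationary deterministic policies. -/
def optAvgReward (s₀ : Cube dS) : ℝ :=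
  ⨆ φ : {φ : Cube dS → Cube dA // Measurable φ}, M.avgReward s₀ φ.1

/-- `(J, h)`, with `h` bounded and measurable, solves the average reward optimality equation
`J + h(s) = max_a {r(s,a) + ∫ h(s') p(s,a,ds')}`. -/
structure SolvesAROE (J : ℝ) (h : Cube dS → ℝ) : Prop where
  measurable : Measurable h
  bounded : ∃ C, ∀ s, |h s| ≤ C
  eqn : ∀ s, IsGreatest (Set.range fun a => M.r (s, a) + ∫ s', h s' ∂(M.p (s, a))) (J + h s)

/-- The relative value function: the solution of the optimality equation with constant the
optimal average reward. It is determined up to an additive constant, which plays no role below. -/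
def relValue (s₀ : Cube dS) : Cube dS → ℝ :=
  Classical.epsilon fun h => M.SolvesAROE (M.optAvgReward s₀) h

/-- The suboptimality gap of a state-action pair. -/
def gap (s₀ : Cube dS) (s : Cube dS) (a : Cube dA) : ℝ :=
  M.optAvgReward s₀ + M.relValue s₀ s - M.r (s, a) - ∫ s', M.relValue s₀ s' ∂(M.p (s, a))

/-- The stationary (invariant) probability measure of the Markov chain induced by `φ`. -/
def statMeasure (φ : Cube dS → Cube dA) : Measure (Cube dS) :=
  Classical.epsilon fun μ => IsProbabilityMeasure μ ∧ M.step φ μ = μ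

end MDP

/-! ### Span-constrained optimisation of finite extended MDPs (`ScOpt`) -/

/-- A family of MDPs with common finite state space `S`, action sets `acts s`, reward function
`rew`, and with transition kernels ranging over the set `kernels`. -/
structure ExtMDP (S : Type) (A : Type) where
  acts : S → Set A
  rew : S → A → ℝ
  kernels : Set (S → A → S → ℝ)

def span {S : Type} (v : S → ℝ) : ℝ := (⨆ s, v s) - ⨅ s, v s

namespace ExtMDP

variable {S A : Type} [Fintype S] (E : ExtMDP S A)

/-- The value of playing `a` at `s` under the kernel `θ`, with continuation value `v`. -/
def value (v : S → ℝ) (θ : S → A → S → ℝ) (s : S) (a : A) : ℝ :=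
  E.rew s a + ∑ s', θ s a s' * v s'

/-- The optimistic Bellman operator. -/
def bellman (v : S → ℝ) (s : S) : ℝ :=
  sSup {x | ∃ a ∈ E.acts s, ∃ θ ∈ E.kernels, x = E.value v θ s a}

/-- The optimistic Bellman operator, truncated at span `c`. -/
def truncBellman (c : ℝ) (v : S → ℝ) (s : S) : ℝ :=
  min (E.bellman v s) ((⨅ s', E.bellman v s') + c)

/-- The iterates of `ScOpt`. -/
def iter (c : ℝ) : ℕ → S → ℝ
  | 0 => fun _ => 0
  | n + 1 => fun s => E.truncBellman c (iter c n) s - ⨅ s', E.truncBellman c (iter c n) s'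

/-- The stopping criterion of `ScOpt` with contraction factor `γ` and accuracy `ε`. -/
def Stops (c γ ε : ℝ) (n : ℕ) : Prop :=
  span (fun s => E.iter c (n + 1) s - E.iter c n s)
    + 2 * γ ^ n / (1 - γ) * span (E.iter c 1) ≤ ε

/-- The truncated operator is feasible at `(v, s)`: its value is attained by a randomised action
`w` and a kernel of the family. -/
def Feasible (c : ℝ) (v : S → ℝ) (s : S) : Prop :=
  ∃ (F : Finset A) (w : A → ℝ), (∀ a ∈ F, a ∈ E.acts s ∧ 0 ≤ w a) ∧ ∑ a ∈ F, w a = 1 ∧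
    ∃ θ ∈ E.kernels, E.truncBellman c v s = ∑ a ∈ F, w a * E.value v θ s a

/-- `φ` is a deterministic policy that attains the truncated operator at all states where the
operator is feasible, and minimises the value at the other states. -/
def IsGreedy (c : ℝ) (v : S → ℝ) (φ : S → A) : Prop :=
  ∀ s, φ s ∈ E.acts s ∧
    (E.Feasible c v s → ∃ θ ∈ E.kernels, E.truncBellman c v s = E.value v θ s (φ s)) ∧
    (¬ E.Feasible c v s → ∃ θ ∈ E.kernels, ∀ a ∈ E.acts s, ∀ θ' ∈ E.kernels,
      E.value v θ s (φ s) ≤ E.value v θ' s a)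

/-- `φ` is an output of `ScOpt`: the policy that is greedy for the first iterate at which the
stopping criterion holds. -/
def IsScOptOutput (c γ ε : ℝ) (φ : S → A) : Prop :=
  ∃ n, E.Stops c γ ε n ∧ (∀ m < n, ¬ E.Stops c γ ε m) ∧ E.IsGreedy c (E.iter c n) φ

end ExtMDP

/-! ### The algorithm `ZoRL` -/

/-- The horizon, the confidence parameter and the constants used by the algorithm. -/
structure Params (dS : ℕ) where
  T : ℕ
  δ : ℝ
  α : ℝ
  Lr : ℝ
  Lp : ℝ
  Cv : ℝ
  c₁ : ℝ
  CH : ℝ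
  κ₁ : ℝ
  ν : Measure (Cube dS)

/-- All that is needed to run the algorithm and to speak about it. -/
structure Setting (dS dA : ℕ) extends Params dS where
  M : MDP dS dA
  met : Metrics dS dA
  rep : Representatives dS dA

/-- A sample path: the states and the actions at the times `0, 1, 2, …`, the starting times of the
episodes, and the policies played in the episodes. Episodes are numbered from `0`. -/
structure SamplePath (dS dA : ℕ) where
  state : ℕ → Cube dS
  act : ℕ → Cube dA
  τ : ℕ → ℕ
  φ : ℕ → Cube dS → Cube dA

namespace Setting

variable {dS dA : ℕ} (E : Setting dS dA)

/-- `log (T / δ)`. -/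
def logTδ : ℝ := Real.log ((E.T : ℝ) / E.δ)

def cellDiam (ζ : Cell dS dA) : ℝ := diam E.met.ρ ζ.toSet

def Nmax (ζ : Cell dS dA) : ℝ :=
  E.c₁ * 2 ^ (dS + 2) * E.logTδ / E.cellDiam ζ ^ (dS + 2)

def Nmin (ζ : Cell dS dA) : ℝ :=
  if ζ.level = 0 then 1 else E.c₁ * E.logTδ / E.cellDiam ζ ^ (dS + 2)

/-- The activation rule at time `t`, where `N` is the table of visit counts at time `t`.
Initially the whole state-action space is the only active cell. -/
def ActiveWith (t : ℕ) (N : Cell dS dA → ℕ) (ζ : Cell dS dA) : Prop :=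
  (t = 0 ∧ ζ.level = 0) ∨ (E.Nmin ζ ≤ N ζ ∧ (N ζ : ℝ) < E.Nmax ζ)

open Classical in
/-- `N_t(ζ)`: the number of times before `t` at which `ζ` or one of its ancestors was visited while
being active. -/
def visits (ω : SamplePath dS dA) : ℕ → Cell dS dA → ℕ
  | 0 => fun _ => 0
  | t + 1 => fun ζ => visits ω t ζ +
      if ∃ ζ', E.ActiveWith t (visits ω t) ζ' ∧ ζ.toSet ⊆ ζ'.toSet ∧
        (ω.state t, ω.act t) ∈ ζ'.toSet then 1 else 0

/-- The cell `ζ` is active at time `t`. -/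
def Active (ω : SamplePath dS dA) (t : ℕ) (ζ : Cell dS dA) : Prop :=
  E.ActiveWith t (E.visits ω t) ζ

/-- The active cell at time `t` that contains the state-action pair `z`. -/
def activeCell (ω : SamplePath dS dA) (t : ℕ) (z : Cube dS × Cube dA) : Cell dS dA :=
  Classical.epsilon fun ζ => E.Active ω t ζ ∧ z ∈ ζ.toSet

open Classical in
/-- `N_t(ζ, B)`: the number of transitions before `t` from `ζ`, or from one of its ancestors while
being active, to `B`. -/
def transitions (ω : SamplePath dS dA) (t : ℕ) (ζ : Cell dS dA) (B : Set (Cube dS)) : ℕ :=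
  ∑ i ∈ Finset.range t,
    if (∃ ζ', E.Active ω i ζ' ∧ ζ.toSet ⊆ ζ'.toSet ∧ (ω.state i, ω.act i) ∈ ζ'.toSet) ∧
      ω.state (i + 1) ∈ B then 1 else 0

/-- The level of the smallest active cells at time `t`. -/
def maxLevel (ω : SamplePath dS dA) (t : ℕ) : ℕ :=
  sSup {ℓ | ∃ ζ, E.Active ω t ζ ∧ ζ.level = ℓ}

/-- The discrete states at time `t`, indexed by the state cells of level `maxLevel`: the index `ξ`
stands for the representative point of `box _ ξ`. -/
abbrev DState (ω : SamplePath dS dA) (t : ℕ) : Type := Fin dS → Fin (2 ^ E.maxLevel ω t)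

/-- The representative point of a discrete state. -/
def pt (ω : SamplePath dS dA) (t : ℕ) (ξ : E.DState ω t) : Cube dS :=
  E.rep.qS (E.maxLevel ω t) ξ

/-- The discrete estimate of the probability of a transition from the active cell `ζ` to the state
cell with index `v` of the same level as `ζ`. -/
def pHatD (ω : SamplePath dS dA) (t : ℕ) (ζ : Cell dS dA)
    (v : Fin dS → Fin (2 ^ ζ.level)) : ℝ :=
  (E.transitions ω t ζ (box ζ.level v) : ℝ) / max 1 (E.visits ω t ζ : ℝ)

/-- The continuous extension of `pHatD`. -/
def pHat (ω : SamplePath dS dA) (t : ℕ) (ζ : Cell dS dA) (B : Set (Cube dS)) : ℝ :=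
  ∑ v : Fin dS → Fin (2 ^ ζ.level),
    volume.real (B ∩ box ζ.level v) / volume.real (box (n := dS) ζ.level v) * E.pHatD ω t ζ v

/-- The discretisation of `pHat` on the discrete states at time `t`. -/
def wpHat (ω : SamplePath dS dA) (t : ℕ) (ζ : Cell dS dA) (ξ : E.DState ω t) : ℝ :=
  E.pHat ω t ζ (box (E.maxLevel ω t) ξ)

/-- The discretisation of the true kernel on the discrete states at time `t`. -/
def wp (ω : SamplePath dS dA) (t : ℕ) (z : Cube dS × Cube dA) (ξ : E.DState ω t) : ℝ :=
  (E.M.p z).real (box (E.maxLevel ω t) ξ)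

/-- The confidence radius; it is `2` if the cell has not been visited. -/
def eta (ω : SamplePath dS dA) (t : ℕ) (ζ : Cell dS dA) : ℝ :=
  if E.visits ω t ζ = 0 then 2 else
    min 2 ((4 - E.α) * (E.c₁ * E.logTδ / (E.visits ω t ζ : ℝ)) ^ (1 / ((dS : ℝ) + 2))
      + (3 * E.Lp + E.Cv) * E.cellDiam ζ)

def Ceta : ℝ := 4 - E.α + 3 * E.Lp + E.Cv

/-- The event that all estimates of the kernel are accurate. -/
def G₁ : Set (SamplePath dS dA) :=
  {ω | ∀ t < E.T, ∀ ζ, E.Active ω t ζ → ∀ z' ∈ ζ.toSet,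
    ∑ ξ, |E.wp ω t z' ξ - E.wpHat ω t ζ ξ| ≤ (1 - (1 - E.α) / E.Ceta) * E.eta ω t ζ}

/-- The actions available in a discrete state: the representative points of the projections on the
action space of the active cells whose projection on the state space contains the state. -/
def dActs (ω : SamplePath dS dA) (t : ℕ) (ξ : E.DState ω t) : Set (Cube dA) :=
  {a | ∃ ζ, E.Active ω t ζ ∧ E.pt ω t ξ ∈ ζ.piS ∧ a = E.rep.qA ζ.level ζ.acIdx}

/-- The reward at the representative point of the active cell, plus a bonus. -/
def dRew (ω : SamplePath dS dA) (t : ℕ) (ξ : E.DState ω t) (a : Cube dA) : ℝ :=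
  E.M.r (E.rep.q (E.activeCell ω t (E.pt ω t ξ, a)))
    + E.Lr * E.cellDiam (E.activeCell ω t (E.pt ω t ξ, a))

/-- The confidence set of discrete kernels. -/
def confSet (ω : SamplePath dS dA) (t : ℕ) :
    Set (E.DState ω t → Cube dA → E.DState ω t → ℝ) :=
  {θ | ∀ ξ, ∀ a ∈ E.dActs ω t ξ,
    (∀ ξ', 0 ≤ θ ξ a ξ') ∧ ∑ ξ', θ ξ a ξ' = 1 ∧
    ∀ ζ, E.Active ω t ζ → (E.pt ω t ξ, a) ∈ ζ.toSet →
      ∑ ξ', |θ ξ a ξ' - E.wpHat ω t ζ ξ'| ≤ E.eta ω t ζ}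

/-- The extended MDP at time `t`: kernels are in the confidence set, with all transition
probabilities at least `(1 - α) / (|S_t| T)`. -/
def extMDP (ω : SamplePath dS dA) (t : ℕ) : ExtMDP (E.DState ω t) (Cube dA) where
  acts := E.dActs ω t
  rew := E.dRew ω t
  kernels := {θ | θ ∈ E.confSet ω t ∧ ∀ ξ, ∀ a ∈ E.dActs ω t ξ, ∀ ξ',
    (1 - E.α) / ((Fintype.card (E.DState ω t) : ℝ) * E.T) ≤ θ ξ a ξ'}

/-- The span bound. -/
def spanBound : ℝ := (1 + E.Lr) / ((1 - E.α) * (1 - 1 / (E.T : ℝ)))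

/-- The contraction factor. -/
def contr (ω : SamplePath dS dA) (t : ℕ) : ℝ :=
  1 - (1 - E.α) / ((Fintype.card (E.DState ω t) : ℝ) * E.T)

/-- `φ` is the extension to the whole state space of an output of `ScOpt` at time `t`. -/
def IsZoRLPolicy (ω : SamplePath dS dA) (t : ℕ) (φ : Cube dS → Cube dA) : Prop :=
  ∃ φd : E.DState ω t → Cube dA,
    (E.extMDP ω t).IsScOptOutput E.spanBound (E.contr ω t) (1 / (E.T : ℝ)) φd ∧
    ∀ ξ, ∀ s ∈ box (E.maxLevel ω t) ξ, φ s = φd ξ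

/-- The diameter of the policy `φ` at time `t`. -/
def policyDiam (ω : SamplePath dS dA) (t : ℕ) (φ : Cube dS → Cube dA) : ℝ :=
  ∫ s, E.cellDiam (E.activeCell ω t (s, φ s)) ∂(E.M.statMeasure φ)

/-- The lower estimate of the diameter of the policy `φ` at time `t` used by the algorithm. -/
def lowerDiam (ω : SamplePath dS dA) (t : ℕ) (φ : Cube dS → Cube dA) : ℝ :=
  E.κ₁ * ∫ s, E.cellDiam (E.activeCell ω t (s, φ s)) ∂E.ν

/-- The duration of an episode that starts at time `t` with the policy `φ`. -/
def duration (ω : SamplePath dS dA) (t : ℕ) (φ : Cube dS → Cube dA) : ℝ :=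
  E.CH * E.logTδ / E.lowerDiam ω t φ ^ (2 * (dS + 1))

/-- The sample path `ω` is produced by the algorithm up to the horizon. -/
structure IsRun (ω : SamplePath dS dA) : Prop where
  start : ω.τ 0 = 0
  policy : ∀ k, ω.τ k < E.T → E.IsZoRLPolicy ω (ω.τ k) (ω.φ k)
  next : ∀ k, ω.τ k < E.T → ω.τ (k + 1) = ω.τ k + ⌈E.duration ω (ω.τ k) (ω.φ k)⌉₊
  play : ∀ k t, ω.τ k ≤ t → t < ω.τ (k + 1) → t < E.T → ω.act t = ω.φ k (ω.state t)

/-- The standing assumptions: ranges of the parameters, Lipschitz continuity, ergodicity, and the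
choice of the constant `c₁`. -/
structure Standing : Prop where
  hT : 2 ≤ E.T
  hδ : E.δ ∈ Set.Ioo (0 : ℝ) 1
  hα : E.α ∈ Set.Ioo (0 : ℝ) 1
  hLr : 0 ≤ E.Lr
  hLp : 0 ≤ E.Lp
  hCv : 0 ≤ E.Cv
  hCH : 0 < E.CH
  hκ₁ : 0 < E.κ₁
  hν : IsProbabilityMeasure E.ν
  lip_r : ∀ z z', |E.M.r z - E.M.r z'| ≤ E.Lr * E.met.ρ z z'
  lip_p : ∀ z z', tvDist (E.M.p z) (E.M.p z') ≤ E.Lp * E.met.ρ z z'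
  ergodic : ∀ z z', tvDist (E.M.p z) (E.M.p z') ≤ 2 * E.α
  hc₁ : 0 < E.c₁
  c₁_eq : Real.log (2 * E.T *
      (2 * ((E.T : ℝ) / (E.c₁ * E.logTδ)) ^ (((dS : ℝ) + dA) / ((dS : ℝ) + 2))) / E.δ)
    = 4.5 * E.c₁ * E.logTδ

/-- The constant `C₁`. -/
def C₁ : ℝ :=
  3 * E.Lr + (1 + max 1 E.Lr) * (3 + 3 * E.Lp + E.Cv) / (1 - E.α)

end Setting

end

end ZoRL

/-! Let `μ` be the stationary measure of the episode's policy `φ`, and let `D` be the mean under `μ`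
of the diameter of the active cell containing `(s, φ s)`. Integrating the gap against `μ` cancels
the relative value function, so the mean gap is `J* - ∫ r(s, φ s) dμ`. The theorem therefore splits
into a regret bound, `J* - ∫ r dμ ≤ C₁ D` (`optAvgReward_sub_le`), and a pigeonhole argument
(`exists_of_integral_le`). For the latter, write `f` for the cell diameter and `g` for the gap. If
no good point exists, then `f < g / (3 C₁) + D / 3 + 1_U` pointwise, where `U` is a union of light
dyadic cubes with `μ U ≤ D / 3`. Integration gives `D < D`.

For the regret bound, let `v` be the last iterate of `ScOpt`, and let `lo`, `hi` be the extreme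
values of the increment of the truncated operator at `v`. The stopping rule gives `hi - lo ≤ 1 / T`.

From below (`le_integral_reward`), the greedy action has, under some admissible kernel, at least the
truncated value. Such a kernel is close to the true one on the event `G₁`, and integration against
`μ` bounds `lo` by `∫ r dμ` plus a multiple of `D` that grows with the span of `v`.

From above (`optAvgReward_le`), look at the discrete state where `h - v` is largest. Truncation is
inactive there, because the span of `h` is at most `1 / (1 - α)`, less than the span bound by more
than `1 / T`. The true kernel may violate the lower bound on entries, but `G₁` is stated with a
factor `1 - (1 - α) / C_η`, and the spare radius allows mixing in the uniform law and also a point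
mass at a maximiser of `v`. The point mass gives a bonus `κ ((1 - α) span v - 1)`.

The bonus is needed because `C₁` has no room for the additive errors `1 / T` when the span of `v` is
near its bound. For small span the coefficient of `D` has room to spare and `D ≥ 36 / T` absorbs the
errors; for large span the bonus pays for them (`regret_le_of_optimism`). The relation `36 / T ≤
minDiam ≤ D` comes from the equation defining `c₁` (`le_minDiam_of_le`), in the only nontrivial case
`C₁ D ≤ 1`.

The stationary measure, the relative value function and the active cell are all choices by
`Classical.epsilon`, so existence has to be proved: by contraction in total variation for the first
two, and by an analysis of the visit counts for the third. -/

namespace ZoRL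

/-! ### Geometry of dyadic cells -/

section Geometry

variable {n dS dA : ℕ}

/-- The index of the dyadic interval of level `ℓ` that contains `x`. -/
noncomputable def intervalIdx (ℓ : ℕ) (x : Set.Icc (0 : ℝ) 1) : Fin (2 ^ ℓ) :=
  ⟨min ⌊(x : ℝ) * 2 ^ ℓ⌋₊ (2 ^ ℓ - 1),
    lt_of_le_of_lt (min_le_right _ _) (Nat.sub_lt (by positivity) one_pos)⟩

/-- The index of the dyadic cube of level `ℓ` that contains `x`. -/
noncomputable def boxIdx (ℓ : ℕ) (x : Cube n) : Fin n → Fin (2 ^ ℓ) := fun i => intervalIdx ℓ (x i)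

/-- Capping the floor at `2 ^ ℓ - 1` puts the endpoint `1` into the last interval, which is the
disjunct `v + 1 = 2 ^ ℓ`. -/
theorem intervalIdx_eq_iff (ℓ : ℕ) (x : Set.Icc (0 : ℝ) 1) (v : Fin (2 ^ ℓ)) :
    intervalIdx ℓ x = v ↔ ((v : ℕ) : ℝ) / 2 ^ ℓ ≤ (x : ℝ) ∧
      ((x : ℝ) < (((v : ℕ) : ℝ) + 1) / 2 ^ ℓ ∨ (v : ℕ) + 1 = 2 ^ ℓ) := by
  obtain ⟨v, hv⟩ := v
  have h2 : (0 : ℝ) < 2 ^ ℓ := by positivity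
  have hx0 : 0 ≤ (x : ℝ) * 2 ^ ℓ := mul_nonneg x.2.1 h2.le
  rw [Fin.ext_iff, div_le_iff₀ h2, lt_div_iff₀ h2, ← Nat.le_floor_iff hx0]
  have h3 : (x : ℝ) * 2 ^ ℓ < (v : ℝ) + 1 ↔ ⌊(x : ℝ) * 2 ^ ℓ⌋₊ < v + 1 := by
    rw [Nat.floor_lt hx0]; push_cast; rfl
  simp only [intervalIdx, h3]
  omega

theorem mem_box_iff (ℓ : ℕ) (v : Fin n → Fin (2 ^ ℓ)) (x : Cube n) :
    x ∈ box ℓ v ↔ boxIdx ℓ x = v := by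
  simp only [box, Set.mem_ofPred_eq, ← intervalIdx_eq_iff, funext_iff, boxIdx]

theorem mem_box_boxIdx (ℓ : ℕ) (x : Cube n) : x ∈ box ℓ (boxIdx ℓ x) :=
  (mem_box_iff _ _ _).2 rfl

/-- Coarsening drops the last `ℓ - ℓ'` binary digits of the floor and sends the cap `2 ^ ℓ - 1` to
the cap `2 ^ ℓ' - 1`; division is monotone, so it commutes with the minimum. All nesting of cells
rests on this. -/
theorem intervalIdx_val_of_le {ℓ ℓ' : ℕ} (h : ℓ' ≤ ℓ) (x : Set.Icc (0 : ℝ) 1) :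
    (intervalIdx ℓ' x : ℕ) = (intervalIdx ℓ x : ℕ) / 2 ^ (ℓ - ℓ') := by
  obtain ⟨k, rfl⟩ := Nat.exists_eq_add_of_le h
  have h1 : ⌊(x : ℝ) * 2 ^ ℓ'⌋₊ = ⌊(x : ℝ) * 2 ^ (ℓ' + k)⌋₊ / 2 ^ k := by
    rw [← Nat.floor_div_natCast]
    congr 1
    push_cast
    field_simp
    ring
  have h2 : (2 ^ (ℓ' + k) - 1) / 2 ^ k = 2 ^ ℓ' - 1 := by
    have hk : 0 < 2 ^ k := by positivity
    have hl : 0 < 2 ^ ℓ' := by positivity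
    apply Nat.div_eq_of_lt_le
    · rw [pow_add, Nat.sub_mul, one_mul]; omega
    · rw [pow_add, Nat.sub_add_cancel hl]; exact Nat.sub_lt (by positivity) one_pos
  simp only [intervalIdx, Nat.add_sub_cancel_left, h1]
  rw [← h2]
  exact ((show Monotone fun a : ℕ => a / 2 ^ k from fun a b hab => Nat.div_le_div_right hab).map_min).symm

theorem boxIdx_eq_of_le {ℓ ℓ' : ℕ} (h : ℓ' ≤ ℓ) {x y : Cube n} (hxy : boxIdx ℓ x = boxIdx ℓ y) :
    boxIdx ℓ' x = boxIdx ℓ' y := by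
  funext i
  have := congrArg Fin.val (congrFun hxy i)
  simp only [boxIdx] at this ⊢
  rw [Fin.ext_iff, intervalIdx_val_of_le h, intervalIdx_val_of_le h, this]

theorem measurableSet_box (ℓ : ℕ) (v : Fin n → Fin (2 ^ ℓ)) : MeasurableSet (box ℓ v) := by
  have : box ℓ v = ⋂ i, {x : Cube n | ((v i : ℕ) : ℝ) / 2 ^ ℓ ≤ (x i : ℝ)} ∩
      ({x : Cube n | (x i : ℝ) < (((v i : ℕ) : ℝ) + 1) / 2 ^ ℓ} ∪
        {_x : Cube n | (v i : ℕ) + 1 = 2 ^ ℓ}) := by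
    ext x; simp [box]
  rw [this]
  refine MeasurableSet.iInter fun i => ?_
  have hm : Measurable fun x : Cube n => (x i : ℝ) := by fun_prop
  exact (measurableSet_le measurable_const hm).inter
    ((measurableSet_lt hm measurable_const).union (MeasurableSet.const _))

theorem measurable_boxIdx (ℓ : ℕ) : Measurable (boxIdx ℓ : Cube n → Fin n → Fin (2 ^ ℓ)) := by
  refine measurable_to_countable' fun v => ?_
  have : boxIdx ℓ ⁻¹' {v} = box (n := n) ℓ v := by
    ext x; simp [mem_box_iff]
  rw [this]; exact measurableSet_box ℓ v

theorem measurable_comp_boxIdx {X : Type*} [MeasurableSpace X] (ℓ : ℕ)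
    (g : (Fin n → Fin (2 ^ ℓ)) → X) : Measurable fun x : Cube n => g (boxIdx ℓ x) :=
  (measurable_of_countable g).comp (measurable_boxIdx ℓ)

theorem pairwise_disjoint_box (ℓ : ℕ) :
    Pairwise (Function.onFun Disjoint (box (n := n) ℓ)) := by
  intro v w hvw
  refine Set.disjoint_left.2 fun x hx hx' => hvw ?_
  rw [mem_box_iff] at hx hx'
  exact hx.symm.trans hx'

/-- The cell of level `ℓ` that contains `z`. -/
noncomputable def cellAt (ℓ : ℕ) (z : Cube dS × Cube dA) : Cell dS dA :=
  ⟨ℓ, boxIdx ℓ z.1, boxIdx ℓ z.2⟩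

theorem mem_toSet_iff (ζ : Cell dS dA) (z : Cube dS × Cube dA) :
    z ∈ ζ.toSet ↔ ζ = cellAt ζ.level z := by
  obtain ⟨ℓ, v, w⟩ := ζ
  simp only [Cell.toSet, Set.mem_ofPred_eq, mem_box_iff, cellAt, Cell.mk.injEq, heq_eq_eq,
    true_and]
  exact and_congr eq_comm eq_comm

theorem mem_cellAt (ℓ : ℕ) (z : Cube dS × Cube dA) : z ∈ (cellAt ℓ z).toSet :=
  (mem_toSet_iff _ _).2 rfl

theorem mem_cellAt_iff (ℓ : ℕ) (z w : Cube dS × Cube dA) :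
    w ∈ (cellAt ℓ z).toSet ↔ cellAt ℓ z = cellAt ℓ w := mem_toSet_iff _ _

theorem cellAt_eq_iff (ℓ : ℕ) (z w : Cube dS × Cube dA) :
    cellAt ℓ z = cellAt ℓ w ↔ boxIdx ℓ z.1 = boxIdx ℓ w.1 ∧ boxIdx ℓ z.2 = boxIdx ℓ w.2 := by
  simp [cellAt]

theorem cellAt_eq_of_le {ℓ ℓ' : ℕ} (h : ℓ' ≤ ℓ) {z w : Cube dS × Cube dA}
    (hzw : cellAt ℓ z = cellAt ℓ w) : cellAt ℓ' z = cellAt ℓ' w := by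
  rw [cellAt_eq_iff] at *
  exact ⟨boxIdx_eq_of_le h hzw.1, boxIdx_eq_of_le h hzw.2⟩

theorem cellAt_subset_cellAt {ℓ ℓ' : ℕ} (h : ℓ' ≤ ℓ) (z : Cube dS × Cube dA) :
    (cellAt ℓ z).toSet ⊆ (cellAt ℓ' z).toSet := fun w hw => by
  rw [mem_cellAt_iff] at *
  exact cellAt_eq_of_le h hw

theorem mem_piS_iff (ζ : Cell dS dA) (hne : ζ.toSet.Nonempty) (s : Cube dS) :
    s ∈ ζ.piS ↔ s ∈ box ζ.level ζ.stIdx := by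
  obtain ⟨z, hz⟩ := hne
  exact ⟨fun ⟨a, ha⟩ => ha.1, fun h => ⟨z.2, h, hz.2⟩⟩

end Geometry

/-! ### Diameters -/

section Diameter

variable {X : Type*} [TopologicalSpace X] {ρ : X → X → ℝ}

theorem IsCompatibleMetric.nonneg (h : IsCompatibleMetric ρ) (x y : X) : 0 ≤ ρ x y := by
  have h1 := h.triangle x y x
  rw [(h.eq_zero_iff x x).2 rfl, h.symm y x] at h1
  linarith

theorem IsCompatibleMetric.bddAbove [CompactSpace X] (h : IsCompatibleMetric ρ) (C : Set X) :
    BddAbove {d | ∃ x ∈ C, ∃ y ∈ C, d = ρ x y} := by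
  have hc : IsCompact (Set.range fun w : X × X => ρ w.1 w.2) := isCompact_range h.continuous
  refine hc.bddAbove.mono ?_
  rintro _ ⟨x, -, y, -, rfl⟩
  exact ⟨(x, y), rfl⟩

theorem IsCompatibleMetric.le_diam [CompactSpace X] (h : IsCompatibleMetric ρ) {C : Set X} {x y : X}
    (hx : x ∈ C) (hy : y ∈ C) : ρ x y ≤ diam ρ C :=
  le_csSup (h.bddAbove C) ⟨x, hx, y, hy, rfl⟩

theorem IsCompatibleMetric.diam_mono [CompactSpace X] (h : IsCompatibleMetric ρ) {C C' : Set X}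
    (hC : C.Nonempty) (hCC : C ⊆ C') : diam ρ C ≤ diam ρ C' := by
  obtain ⟨x, hx⟩ := hC
  refine csSup_le_csSup (h.bddAbove C') ⟨_, x, hx, x, hx, rfl⟩ ?_
  rintro _ ⟨x, hx, y, hy, rfl⟩
  exact ⟨x, hCC hx, y, hCC hy, rfl⟩

/-- A real function that is Lipschitz for a compatible metric is continuous. -/
theorem IsCompatibleMetric.continuous_of_lipschitz (h : IsCompatibleMetric ρ) {f : X → ℝ} {C : ℝ}
    (hf : ∀ x y, |f x - f y| ≤ C * ρ x y) : Continuous f := by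
  rw [continuous_iff_continuousAt]
  intro x
  have h1 : Tendsto (fun y => C * ρ y x) (nhds x) (nhds 0) := by
    have h2 : Continuous fun y => C * ρ y x :=
      continuous_const.mul (h.continuous.comp (Continuous.prodMk continuous_id continuous_const))
    have h3 := h2.tendsto x
    simpa [(h.eq_zero_iff x x).2 rfl] using h3
  rw [ContinuousAt, tendsto_iff_dist_tendsto_zero]
  exact squeeze_zero (fun y => dist_nonneg) (fun y => by rw [Real.dist_eq]; exact hf y x) h1

end Diameter

/-! ### Total variation, Markov kernels and invariant measures -/

section Kernels

variable {X : Type*} [MeasurableSpace X]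

theorem integrable_of_mem_Icc {μ : Measure X} [IsFiniteMeasure μ] {f : X → ℝ} (hf : Measurable f)
    {a b : ℝ} (hab : ∀ x, f x ∈ Set.Icc a b) : Integrable f μ := by
  refine Integrable.of_bound hf.aestronglyMeasurable (max |a| |b|) (Eventually.of_forall fun x => ?_)
  rw [Real.norm_eq_abs]
  exact abs_le_max_abs_abs (hab x).1 (hab x).2

/-- The integrals of a function of oscillation at most `b - a` differ by at most `(b - a) δ`, if
the measures of sets differ by at most `δ`. -/
theorem abs_integral_sub_integral_le {μ ν : Measure X} [IsProbabilityMeasure μ]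
    [IsProbabilityMeasure ν] {δ : ℝ} (hδ : ∀ B, MeasurableSet B → |μ.real B - ν.real B| ≤ δ)
    {f : X → ℝ} (hf : Measurable f) {a b : ℝ} (hab : ∀ x, f x ∈ Set.Icc a b) :
    |∫ x, f x ∂μ - ∫ x, f x ∂ν| ≤ (b - a) * δ := by
  have hX : Nonempty X := nonempty_of_isProbabilityMeasure μ
  have hba : 0 ≤ b - a := by
    obtain ⟨x⟩ := hX
    have := hab x
    linarith [this.1, this.2]
  -- Layer-cake formula for `f - a`: the hypothesis on sets is then applied level by level.
  have key : ∀ (κ : Measure X) [IsProbabilityMeasure κ],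
      ∫ x, f x ∂κ = a + ∫ t in Set.Ioc 0 (b - a), κ.real {x | t ≤ f x - a} := by
    intro κ _
    have hi : Integrable f κ := integrable_of_mem_Icc hf hab
    have h1 : ∫ x, (f x - a) ∂κ = ∫ t in Set.Ioc 0 (b - a), κ.real {x | t ≤ f x - a} :=
      Integrable.integral_eq_integral_Ioc_meas_le (hi.sub (integrable_const a))
        (Eventually.of_forall fun x => sub_nonneg.2 (hab x).1)
        (Eventually.of_forall fun x => sub_le_sub_right (hab x).2 a)
    rw [← h1, integral_sub hi (integrable_const a)]
    simp
  have hint : ∀ (κ : Measure X) [IsProbabilityMeasure κ],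
      IntegrableOn (fun t => κ.real {x | t ≤ f x - a}) (Set.Ioc 0 (b - a)) := by
    intro κ _
    refine Measure.integrableOn_of_bounded (M := 1) measure_Ioc_lt_top.ne ?_ ?_
    · refine (Antitone.measurable fun s t hst => ?_).aestronglyMeasurable
      exact measureReal_mono fun x hx => le_trans hst hx
    · refine Eventually.of_forall fun t => ?_
      rw [Real.norm_eq_abs, abs_of_nonneg measureReal_nonneg]
      exact measureReal_le_one
  rw [key μ, key ν, add_sub_add_left_eq_sub, ← integral_sub (hint μ) (hint ν)]
  have := norm_setIntegral_le_of_norm_le_const (μ := volume) (s := Set.Ioc 0 (b - a)) (C := δ)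
    (f := fun t => μ.real {x | t ≤ f x - a} - ν.real {x | t ≤ f x - a}) measure_Ioc_lt_top
    (fun t _ => hδ _ (measurableSet_le measurable_const (hf.sub_const a)))
  rw [Real.norm_eq_abs] at this
  refine this.trans (le_of_eq ?_)
  rw [Real.volume_real_Ioc_of_le hba, sub_zero, mul_comm]

theorem abs_real_sub_real_le_tvDist (μ ν : Measure X) [IsProbabilityMeasure μ]
    [IsProbabilityMeasure ν] {B : Set X} (hB : MeasurableSet B) :
    |μ.real B - ν.real B| ≤ tvDist μ ν / 2 := by
  have hb : BddAbove (Set.range fun B : {B : Set X // MeasurableSet B} =>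
      |μ.real B.1 - ν.real B.1|) := by
    refine ⟨1, ?_⟩
    rintro _ ⟨C, rfl⟩
    rw [abs_le]
    constructor <;>
      linarith [measureReal_nonneg (μ := μ) (s := C.1), measureReal_nonneg (μ := ν) (s := C.1),
        measureReal_le_one (μ := μ) (s := C.1), measureReal_le_one (μ := ν) (s := C.1)]
  have := le_ciSup hb ⟨B, hB⟩
  rw [tvDist]
  linarith

/-- The setwise limit of a sequence of probability measures that converges uniformly on
measurable sets. -/
theorem exists_limit_measure (μ : ℕ → Measure X) [∀ n, IsProbabilityMeasure (μ n)] (e : ℕ → ℝ)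
    (he : Tendsto e atTop (nhds 0))
    (hμ : ∀ B, MeasurableSet B → ∀ n k, |(μ n).real B - (μ (n + k)).real B| ≤ e n) :
    ∃ ν : Measure X, IsProbabilityMeasure ν ∧
      ∀ B, MeasurableSet B → ∀ n, |(μ n).real B - ν.real B| ≤ e n := by
  have hlim : ∀ B, MeasurableSet B → ∃ m, Tendsto (fun n => (μ n).real B) atTop (nhds m) := by
    intro B hB
    refine cauchySeq_tendsto_of_complete (cauchySeq_of_le_tendsto_0 (fun n => e n + e n) ?_
      (by simpa using he.add he))
    intro n m N hn hm
    obtain ⟨i, rfl⟩ := Nat.exists_eq_add_of_le hn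
    obtain ⟨j, rfl⟩ := Nat.exists_eq_add_of_le hm
    rw [Real.dist_eq]
    have h1 := hμ B hB N i
    have h2 := hμ B hB N j
    rw [abs_le] at *
    constructor <;> linarith [h1.1, h1.2, h2.1, h2.2]
  choose! m hm using hlim
  have hm0 : ∀ B, MeasurableSet B → 0 ≤ m B := fun B hB =>
    ge_of_tendsto' (hm B hB) fun n => measureReal_nonneg
  have herr : ∀ B, MeasurableSet B → ∀ n, |(μ n).real B - m B| ≤ e n := by
    intro B hB n
    have h1 : Tendsto (fun k => |(μ n).real B - (μ (n + k)).real B|) atTop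
        (nhds |(μ n).real B - m B|) := by
      have := (hm B hB).comp (tendsto_add_atTop_nat n)
      refine (tendsto_const_nhds.sub ?_).abs
      simpa [Function.comp_def, add_comm] using this
    exact le_of_tendsto' h1 fun k => hμ B hB n k
  -- The error `e n` is the same for all sets, so the finite partial sums converge uniformly in the
  -- index set, and the limit in `n` can be exchanged with the countable sum.
  have hsum : ∀ f : ℕ → Set X, (∀ i, MeasurableSet (f i)) → Pairwise (Function.onFun Disjoint f) →
      HasSum (fun i => m (f i)) (m (⋃ i, f i)) := by
    intro f hf hd
    have hfin : ∀ (n : ℕ) (F : Finset ℕ),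
        ∑ i ∈ F, (μ n).real (f i) = (μ n).real (⋃ i ∈ F, f i) := fun n F =>
      (measureReal_biUnion_finset (fun i _ j _ hij => hd hij) (fun i _ => hf i)).symm
    have hfin' : ∀ F : Finset ℕ, ∑ i ∈ F, m (f i) = m (⋃ i ∈ F, f i) := by
      intro F
      refine tendsto_nhds_unique (tendsto_finsetSum F fun i _ => hm (f i) (hf i)) ?_
      simp_rw [hfin]
      exact hm _ (Finset.measurableSet_biUnion F fun i _ => hf i)
    have hU : TendstoUniformly (fun (n : ℕ) (F : Finset ℕ) => ∑ i ∈ F, (μ n).real (f i))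
        (fun F => ∑ i ∈ F, m (f i)) atTop := by
      rw [Metric.tendstoUniformly_iff]
      intro ε hε
      filter_upwards [he.eventually_lt_const hε] with n hn F
      rw [Real.dist_eq, hfin, hfin', abs_sub_comm]
      exact (herr _ (Finset.measurableSet_biUnion F fun i _ => hf i) n).trans_lt hn
    refine TendstoUniformly.tendsto_of_eventually_tendsto hU
      (Eventually.of_forall fun n => ?_) (hm _ (MeasurableSet.iUnion hf))
    have h2 := (ENNReal.hasSum_toReal (f := fun i => μ n (f i))
      (by rw [← measure_iUnion hd hf]; exact measure_ne_top _ _))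
    rw [← ENNReal.tsum_toReal_eq (fun i => measure_ne_top _ _), ← measure_iUnion hd hf] at h2
    exact h2
  have hm_empty : m ∅ = 0 := by
    refine tendsto_nhds_unique (hm ∅ MeasurableSet.empty) ?_
    simp
  have hm_univ : m Set.univ = 1 := by
    refine tendsto_nhds_unique (hm _ MeasurableSet.univ) ?_
    simp
  let ν : Measure X := Measure.ofMeasurable (fun B _ => ENNReal.ofReal (m B)) (by simp [hm_empty])
    (fun f hf hd => by
      rw [← (hsum f hf hd).tsum_eq, ENNReal.ofReal_tsum_of_nonneg (fun i => hm0 _ (hf i))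
        (hsum f hf hd).summable])
  have hν : ∀ B, MeasurableSet B → ν B = ENNReal.ofReal (m B) := fun B hB =>
    Measure.ofMeasurable_apply B hB
  refine ⟨ν, ⟨by rw [hν _ MeasurableSet.univ, hm_univ, ENNReal.ofReal_one]⟩, fun B hB n => ?_⟩
  rw [measureReal_def ν, hν B hB, ENNReal.toReal_ofReal (hm0 B hB)]
  exact herr B hB n

variable (κ : Kernel X X) [IsMarkovKernel κ]

theorem integral_bind_kernel (μ : Measure X) [IsProbabilityMeasure μ] {f : X → ℝ}
    (hf : Measurable f) {a b : ℝ} (hab : ∀ x, f x ∈ Set.Icc a b) :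
    ∫ x, f x ∂(μ.bind κ) = ∫ x, ∫ y, f y ∂(κ x) ∂μ := by
  have hp : IsProbabilityMeasure (μ.bind κ) := inferInstance
  have h : Integrable f (μ.bind κ) := integrable_of_mem_Icc hf hab
  rw [Measure.comp_eq_comp_const_apply] at h ⊢
  rw [Kernel.integral_comp h]
  simp

theorem real_bind_kernel (μ : Measure X) [IsProbabilityMeasure μ] {B : Set X}
    (hB : MeasurableSet B) : (μ.bind κ).real B = ∫ x, (κ x).real B ∂μ := by
  have h := integral_bind_kernel κ μ (f := B.indicator 1) (a := 0) (b := 1)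
    (measurable_one.indicator hB) (fun x => by by_cases hx : x ∈ B <;> simp [hx])
  simpa [integral_indicator_one hB] using h

variable {κ}

/-- A Markov kernel whose rows differ by at most `a < 1` in total variation has an invariant
probability measure. -/
theorem exists_invariant_measure [Nonempty X] {a : ℝ} (ha0 : 0 ≤ a) (ha1 : a < 1)
    (hκ : ∀ x x' B, MeasurableSet B → |(κ x).real B - (κ x').real B| ≤ a) :
    ∃ ν : Measure X, IsProbabilityMeasure ν ∧ ν.bind κ = ν := by
  have hmeas : ∀ B, MeasurableSet B → Measurable fun x => (κ x).real B := fun B hB =>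
    (Kernel.measurable_coe κ hB).ennreal_toReal
  -- The function `x ↦ κ x B` oscillates by at most `a`, so a setwise distance `δ` shrinks to `a *
  -- δ`.
  have hcontr : ∀ (μ ν : Measure X) [IsProbabilityMeasure μ] [IsProbabilityMeasure ν] (δ : ℝ),
      (∀ B, MeasurableSet B → |μ.real B - ν.real B| ≤ δ) →
      ∀ B, MeasurableSet B → |(μ.bind κ).real B - (ν.bind κ).real B| ≤ a * δ := by
    intro μ ν _ _ δ hδ B hB
    rw [real_bind_kernel κ μ hB, real_bind_kernel κ ν hB]
    have hlow : BddBelow (Set.range fun x => (κ x).real B) :=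
      ⟨0, by rintro _ ⟨x, rfl⟩; exact measureReal_nonneg⟩
    have := abs_integral_sub_integral_le hδ (hmeas B hB) (a := ⨅ x, (κ x).real B)
      (b := (⨅ x, (κ x).real B) + a) (fun x => ⟨ciInf_le hlow x, by
        rw [← sub_le_iff_le_add]
        refine le_ciInf fun x' => ?_
        linarith [(abs_le.1 (hκ x x' B hB)).2]⟩)
    simpa using this
  obtain ⟨x₀⟩ := ‹Nonempty X›
  let μ : ℕ → Measure X := fun n => (fun μ : Measure X => μ.bind κ)^[n] (Measure.dirac x₀)
  have hμs : ∀ n, μ (n + 1) = (μ n).bind κ := fun n => Function.iterate_succ_apply' _ _ _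
  have hμp : ∀ n, IsProbabilityMeasure (μ n) := by
    intro n
    induction n with
    | zero => exact inferInstanceAs (IsProbabilityMeasure (Measure.dirac x₀))
    | succ n ih => rw [hμs]; infer_instance
  have hcau : ∀ n k, ∀ B, MeasurableSet B → |(μ n).real B - (μ (n + k)).real B| ≤ a ^ n := by
    intro n
    induction n with
    | zero =>
      intro k B hB
      rw [pow_zero, abs_le]
      constructor <;>
        linarith [measureReal_nonneg (μ := μ 0) (s := B), measureReal_le_one (μ := μ 0) (s := B),
          measureReal_nonneg (μ := μ (0 + k)) (s := B),
          measureReal_le_one (μ := μ (0 + k)) (s := B)]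
    | succ n ih =>
      intro k B hB
      rw [show n + 1 + k = n + k + 1 by ring, hμs, hμs, pow_succ']
      exact hcontr _ _ _ (ih k) B hB
  have he := tendsto_pow_atTop_nhds_zero_of_lt_one ha0 ha1
  obtain ⟨ν, hνp, hν⟩ := exists_limit_measure μ (fun n => a ^ n) he
    (fun B hB n k => hcau n k B hB)
  refine ⟨ν, hνp, ?_⟩
  refine Measure.ext fun B hB => ?_
  have h1 : (ν.bind κ).real B = ν.real B := by
    have hlim : ∀ (C : Measure X) (f : ℕ → ℝ), Tendsto f atTop (nhds 0) →
        (∀ n, |(μ (n + 1)).real B - C.real B| ≤ f n) →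
        Tendsto (fun n => (μ (n + 1)).real B) atTop (nhds (C.real B)) := by
      intro C f hf hC
      rw [tendsto_iff_dist_tendsto_zero]
      exact squeeze_zero (fun n => dist_nonneg) (fun n => by rw [Real.dist_eq]; exact hC n) hf
    refine tendsto_nhds_unique (hlim _ (fun n => a * a ^ n) (by simpa using he.const_mul a) ?_)
      (hlim _ (fun n => a ^ (n + 1)) ((tendsto_add_atTop_iff_nat 1).2 he)
        (fun n => hν B hB (n + 1)))
    intro n
    rw [hμs]
    exact hcontr _ _ _ (fun B hB => hν B hB n) B hB
  exact (measureReal_eq_measureReal_iff).1 h1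

end Kernels

/-! ### The average reward optimality equation -/

theorem abs_integral_sub_integral_le_of_osc {X : Type*} [MeasurableSpace X] {μ ν : Measure X}
    [IsProbabilityMeasure μ] [IsProbabilityMeasure ν] {δ : ℝ}
    (hδ : ∀ B, MeasurableSet B → |μ.real B - ν.real B| ≤ δ)
    {f : X → ℝ} (hf : Measurable f) {c : ℝ} (hc : ∀ x y, f x - f y ≤ c) :
    |∫ x, f x ∂μ - ∫ x, f x ∂ν| ≤ c * δ := by
  obtain ⟨x₀⟩ : Nonempty X := nonempty_of_isProbabilityMeasure μ
  have : Nonempty X := ⟨x₀⟩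
  have hlow : BddBelow (Set.range f) := ⟨f x₀ - c, by rintro _ ⟨x, rfl⟩; linarith [hc x₀ x]⟩
  have := abs_integral_sub_integral_le hδ hf (a := ⨅ x, f x) (b := (⨅ x, f x) + c)
    (fun x => ⟨ciInf_le hlow x, by
      rw [← sub_le_iff_le_add]
      exact le_ciInf fun y => by linarith [hc x y]⟩)
  simpa using this

namespace MDP

variable {dS dA : ℕ} (M : MDP dS dA)

instance : IsMarkovKernel M.p := M.markov

/-- The kernel of the Markov chain induced by the policy `φ`. -/
noncomputable def policyKernel (φ : Cube dS → Cube dA) (hφ : Measurable φ) :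
    Kernel (Cube dS) (Cube dS) :=
  M.p.comap (fun s => (s, φ s)) (measurable_id.prodMk hφ)

instance (φ : Cube dS → Cube dA) (hφ : Measurable φ) : IsMarkovKernel (M.policyKernel φ hφ) := by
  unfold policyKernel; infer_instance

theorem step_eq_bind (φ : Cube dS → Cube dA) (hφ : Measurable φ) (μ : Measure (Cube dS)) :
    M.step φ μ = μ.bind (M.policyKernel φ hφ) := rfl

variable {M}

theorem abs_real_sub_real_le {a : ℝ} {z z' : Cube dS × Cube dA}
    (h : tvDist (M.p z) (M.p z') ≤ 2 * a) (B : Set (Cube dS)) (hB : MeasurableSet B) :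
    |(M.p z).real B - (M.p z').real B| ≤ a := by
  have := abs_real_sub_real_le_tvDist (M.p z) (M.p z') hB
  linarith

theorem integral_step {φ : Cube dS → Cube dA} (hφ : Measurable φ) (μ : Measure (Cube dS))
    [IsProbabilityMeasure μ] {f : Cube dS → ℝ} (hf : Measurable f) {a b : ℝ}
    (hab : ∀ x, f x ∈ Set.Icc a b) :
    ∫ x, f x ∂(M.step φ μ) = ∫ s, ∫ y, f y ∂(M.p (s, φ s)) ∂μ :=
  integral_bind_kernel (M.policyKernel φ hφ) μ hf hab

theorem isProbabilityMeasure_step {φ : Cube dS → Cube dA} (hφ : Measurable φ)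
    (μ : Measure (Cube dS)) [IsProbabilityMeasure μ] : IsProbabilityMeasure (M.step φ μ) := by
  rw [step_eq_bind M φ hφ]; infer_instance

theorem stateLaw_succ (φ : Cube dS → Cube dA) (s₀ : Cube dS) (t : ℕ) :
    M.stateLaw φ s₀ (t + 1) = M.step φ (M.stateLaw φ s₀ t) :=
  Function.iterate_succ_apply' _ _ _

theorem isProbabilityMeasure_stateLaw {φ : Cube dS → Cube dA} (hφ : Measurable φ)
    (s₀ : Cube dS) (t : ℕ) : IsProbabilityMeasure (M.stateLaw φ s₀ t) := by
  induction t with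
  | zero => exact inferInstanceAs (IsProbabilityMeasure (Measure.dirac s₀))
  | succ t ih => rw [stateLaw_succ]; exact isProbabilityMeasure_step hφ _

/-- Existence suffices for the `epsilon` choice to be invariant; uniqueness plays no role in the
argument. -/
theorem statMeasure_spec {α : ℝ} (hα : α ∈ Set.Ioo (0 : ℝ) 1)
    (herg : ∀ z z', tvDist (M.p z) (M.p z') ≤ 2 * α) {φ : Cube dS → Cube dA}
    (hφ : Measurable φ) :
    IsProbabilityMeasure (M.statMeasure φ) ∧ M.step φ (M.statMeasure φ) = M.statMeasure φ :=
  Classical.epsilon_spec (p := fun μ => IsProbabilityMeasure μ ∧ M.step φ μ = μ)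
    (exists_invariant_measure (κ := M.policyKernel φ hφ) hα.1.le hα.2
      fun x x' B hB => abs_real_sub_real_le (herg (x, φ x) (x', φ x')) B hB)

theorem measurable_integral_p {f : Cube dS → ℝ} (hf : Measurable f) :
    Measurable fun z => ∫ y, f y ∂(M.p z) :=
  (hf.stronglyMeasurable.integral_kernel (κ := M.p)).measurable

theorem integral_p_mem {f : Cube dS → ℝ} (hf : Measurable f) {a b : ℝ}
    (hab : ∀ x, f x ∈ Set.Icc a b) (z : Cube dS × Cube dA) :
    ∫ y, f y ∂(M.p z) ∈ Set.Icc a b := by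
  have hi : Integrable f (M.p z) := integrable_of_mem_Icc hf hab
  constructor
  · simpa using integral_mono (integrable_const a) hi fun x => (hab x).1
  · simpa using integral_mono hi (integrable_const b) fun x => (hab x).2

variable (M) in
/-- The value of playing in the state-action pair `z` with continuation value `v`. -/
noncomputable def qValue (v : Cube dS → ℝ) (z : Cube dS × Cube dA) : ℝ :=
  M.r z + ∫ s', v s' ∂(M.p z)

theorem abs_qValue_sub_le {met : Metrics dS dA} {Lr Lp : ℝ}
    (lip_r : ∀ z z', |M.r z - M.r z'| ≤ Lr * met.ρ z z')
    (lip_p : ∀ z z', tvDist (M.p z) (M.p z') ≤ Lp * met.ρ z z')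
    {v : Cube dS → ℝ} (hv : Measurable v) {a b : ℝ} (hab : ∀ x, v x ∈ Set.Icc a b)
    (z z' : Cube dS × Cube dA) :
    |M.qValue v z - M.qValue v z'| ≤ (Lr + (b - a) * (Lp / 2)) * met.ρ z z' := by
  have h1 := lip_r z z'
  have h2 := abs_integral_sub_integral_le (μ := M.p z) (ν := M.p z')
    (δ := Lp * met.ρ z z' / 2) (abs_real_sub_real_le (by linarith [lip_p z z'])) hv hab
  calc |M.qValue v z - M.qValue v z'|
      = |(M.r z - M.r z') + (∫ s', v s' ∂(M.p z) - ∫ s', v s' ∂(M.p z'))| := by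
        simp only [qValue]; congr 1; ring
    _ ≤ _ := (abs_add_le _ _).trans (add_le_add h1 h2)
    _ = _ := by ring

variable (M) in
/-- The Bellman operator of the average reward problem. -/
noncomputable def bellmanSup (v : Cube dS → ℝ) (s : Cube dS) : ℝ :=
  sSup ((fun a => M.qValue v (s, a)) '' Set.univ)

/-! ### Span contraction of the Bellman operator and relative value iteration -/

section Bellman

variable (hq : ∀ v : C(Cube dS, ℝ), Continuous (M.qValue v))
include hq

theorem exists_isMaxOn_qValue (v : C(Cube dS, ℝ)) (s : Cube dS) :
    ∃ a, M.bellmanSup v s = M.qValue v (s, a) ∧ ∀ a', M.qValue v (s, a') ≤ M.qValue v (s, a) := by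
  have hc : Continuous fun a => M.qValue v (s, a) := (hq v).comp (by fun_prop)
  obtain ⟨a, -, ha, ha'⟩ := isCompact_univ.exists_sSup_image_eq_and_ge
    (Set.univ_nonempty (α := Cube dA)) hc.continuousOn
  exact ⟨a, ha, fun a' => ha' a' (Set.mem_univ _)⟩

theorem continuous_bellmanSup (v : C(Cube dS, ℝ)) : Continuous (M.bellmanSup v) :=
  isCompact_univ.continuous_sSup (f := fun s a => M.qValue v (s, a)) (hq v)

/-- The difference of two values of the Bellman operator lies between integrals of the difference
of the arguments. -/
theorem exists_bellmanSup_sub_le (v w : C(Cube dS, ℝ)) (s : Cube dS) :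
    ∃ a, M.bellmanSup v s - M.bellmanSup w s ≤ ∫ x, (v x - w x) ∂(M.p (s, a)) := by
  obtain ⟨a, ha, -⟩ := exists_isMaxOn_qValue hq v s
  obtain ⟨b, hb, hb'⟩ := exists_isMaxOn_qValue hq w s
  have hint : ∀ v : C(Cube dS, ℝ), Integrable v (M.p (s, a)) := fun v =>
    v.continuous.integrable_of_hasCompactSupport (HasCompactSupport.of_compactSpace _)
  refine ⟨a, ?_⟩
  rw [integral_sub (hint v) (hint w), ha, hb]
  have := hb' a
  simp only [qValue] at *
  linarith

theorem abs_bellmanSup_sub_le (v w : C(Cube dS, ℝ)) (s : Cube dS) :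
    |M.bellmanSup v s - M.bellmanSup w s| ≤ dist v w := by
  have key : ∀ v w : C(Cube dS, ℝ), M.bellmanSup v s - M.bellmanSup w s ≤ dist v w := by
    intro v w
    obtain ⟨a, ha⟩ := exists_bellmanSup_sub_le hq v w s
    refine ha.trans ?_
    have hb : ∀ x, v x - w x ∈ Set.Icc (-dist v w) (dist v w) := fun x => by
      have := ContinuousMap.dist_apply_le_dist (f := v) (g := w) x
      rw [Real.dist_eq, abs_le] at this
      exact this
    exact (integral_p_mem (v.continuous.measurable.sub w.continuous.measurable) hb (s, a)).2
  rw [abs_le]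
  have h1 := key v w
  have h2 := key w v
  rw [dist_comm] at h2
  constructor <;> linarith

/-- Both differences are controlled by integrals of `v - w` against single rows of the kernel, and
two rows differ by at most `α` on every set. The contraction concerns the oscillation only; in the
supremum norm the operator is merely shown nonexpansive. -/
theorem bellmanSup_osc_le {α : ℝ} (herg : ∀ z z', tvDist (M.p z) (M.p z') ≤ 2 * α)
    (v w : C(Cube dS, ℝ)) {c : ℝ} (hc : ∀ x y, (v x - w x) - (v y - w y) ≤ c) (x y : Cube dS) :
    (M.bellmanSup v x - M.bellmanSup w x) - (M.bellmanSup v y - M.bellmanSup w y) ≤ c * α := by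
  obtain ⟨a, ha⟩ := exists_bellmanSup_sub_le hq v w x
  obtain ⟨b, hb⟩ := exists_bellmanSup_sub_le hq w v y
  have h1 := abs_integral_sub_integral_le_of_osc (μ := M.p (x, a)) (ν := M.p (y, b))
    (abs_real_sub_real_le (herg _ _))
    (f := fun x => v x - w x) (v.continuous.measurable.sub w.continuous.measurable) hc
  have h2 : ∫ x, (w x - v x) ∂(M.p (y, b)) = - ∫ x, (v x - w x) ∂(M.p (y, b)) := by
    rw [← integral_neg]; simp
  rw [h2] at hb
  linarith [(abs_le.1 h1).2]

/-- Subtracting the value at `s₀` after each step turns oscillation bounds into uniform bounds, so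
the iterates are Cauchy. The constant subtracted at the fixed point is `J`. -/
theorem exists_solvesAROE {α : ℝ} (hα : α ∈ Set.Ioo (0 : ℝ) 1)
    (herg : ∀ z z', tvDist (M.p z) (M.p z') ≤ 2 * α) : ∃ J h, M.SolvesAROE J h := by
  have s₀ : Cube dS := fun _ => 0
  let F : C(Cube dS, ℝ) → C(Cube dS, ℝ) := fun v =>
    ⟨fun s => M.bellmanSup v s - M.bellmanSup v s₀,
      (continuous_bellmanSup hq v).sub continuous_const⟩
  have hF : ∀ v s, F v s = M.bellmanSup v s - M.bellmanSup v s₀ := fun v s => rfl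
  let u : ℕ → C(Cube dS, ℝ) := fun n => F^[n] 0
  have hu : ∀ n, u (n + 1) = F (u n) := fun n => Function.iterate_succ_apply' _ _ _
  have hu0 : ∀ n, u n s₀ = 0 := by
    intro n
    cases n with
    | zero => rfl
    | succ n => rw [hu, hF, sub_self]
  obtain ⟨C, hC⟩ : ∃ C, ∀ x y, (u 1 x - u 0 x) - (u 1 y - u 0 y) ≤ C := by
    refine ⟨2 * dist (u 1) (u 0), fun x y => ?_⟩
    have h1 := ContinuousMap.dist_apply_le_dist (f := u 1) (g := u 0) x
    have h2 := ContinuousMap.dist_apply_le_dist (f := u 1) (g := u 0) y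
    rw [Real.dist_eq, abs_le] at h1 h2
    linarith [h1.2, h2.1]
  have hosc : ∀ n x y, (u (n + 1) x - u n x) - (u (n + 1) y - u n y) ≤ C * α ^ n := by
    intro n
    induction n with
    | zero => simpa using hC
    | succ n ih =>
      intro x y
      have := bellmanSup_osc_le hq herg _ _ ih x y
      rw [pow_succ, ← mul_assoc]
      have h2 : ∀ m s, u (m + 1) s = M.bellmanSup (u m) s - M.bellmanSup (u m) s₀ :=
        fun m s => by rw [hu, hF]
      rw [h2 (n + 1), h2 (n + 1), h2 n x, h2 n y]
      linarith
  have hcau : CauchySeq u := by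
    refine cauchySeq_of_le_geometric α C hα.2 fun n => ?_
    have hC0 : 0 ≤ C * α ^ n := by simpa using hosc n s₀ s₀
    rw [dist_comm, ContinuousMap.dist_le hC0]
    intro x
    rw [Real.dist_eq, abs_le]
    have h1 := hosc n x s₀
    have h2 := hosc n s₀ x
    rw [hu0, hu0] at h1 h2
    constructor <;> linarith
  obtain ⟨h, hh⟩ := cauchySeq_tendsto_of_complete hcau
  have hlim : ∀ s, Tendsto (fun n => M.bellmanSup (u n) s) atTop (nhds (M.bellmanSup h s)) := by
    intro s
    rw [tendsto_iff_dist_tendsto_zero]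
    exact squeeze_zero (fun n => dist_nonneg)
      (fun n => by rw [Real.dist_eq]; exact abs_bellmanSup_sub_le hq (u n) h s)
      (tendsto_iff_dist_tendsto_zero.1 hh)
  have hfix : ∀ s, h s = M.bellmanSup h s - M.bellmanSup h s₀ := by
    intro s
    have h1 : Tendsto (fun n => u (n + 1) s) atTop (nhds (h s)) :=
      ((continuous_eval_const s).tendsto h).comp
        ((tendsto_add_atTop_iff_nat 1).2 hh)
    refine tendsto_nhds_unique h1 ?_
    simp_rw [hu, hF]
    exact (hlim s).sub (hlim s₀)
  refine ⟨M.bellmanSup h s₀, h, h.continuous.measurable, ⟨‖h‖, fun s => h.norm_coe_le_norm s⟩,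
    fun s => ?_⟩
  obtain ⟨a, ha, ha'⟩ := exists_isMaxOn_qValue hq h s
  have hs : M.bellmanSup h s₀ + h s = M.qValue h (s, a) := by rw [hfix s, ← ha]; ring
  rw [hs]
  exact ⟨⟨a, rfl⟩, by rintro _ ⟨a', rfl⟩; exact ha' a'⟩

end Bellman

/-! ### Average rewards and telescoping of the relative value -/

section Average

variable {φ : Cube dS → Cube dA} (hφ : Measurable φ) (s₀ : Cube dS)
include hφ

theorem integral_reward_mem (μ : Measure (Cube dS)) [IsProbabilityMeasure μ] :
    ∫ s, M.r (s, φ s) ∂μ ∈ Set.Icc (0 : ℝ) 1 := by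
  have hm : Measurable fun s => M.r (s, φ s) := M.measurable_r.comp (measurable_id.prodMk hφ)
  have hi : Integrable (fun s => M.r (s, φ s)) μ := integrable_of_mem_Icc hm fun s => M.r_mem _
  refine ⟨integral_nonneg fun s => (M.r_mem _).1, ?_⟩
  simpa using integral_mono hi (integrable_const 1) fun s => (M.r_mem (s, φ s)).2

theorem average_mem (n : ℕ) :
    (1 / (n : ℝ)) * ∑ t ∈ Finset.range n, ∫ s, M.r (s, φ s) ∂(M.stateLaw φ s₀ t)
      ∈ Set.Icc (0 : ℝ) 1 := by
  have h : ∀ t, ∫ s, M.r (s, φ s) ∂(M.stateLaw φ s₀ t) ∈ Set.Icc (0 : ℝ) 1 := fun t => by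
    have := isProbabilityMeasure_stateLaw (M := M) hφ s₀ t
    exact integral_reward_mem hφ _
  refine ⟨mul_nonneg (by positivity) (Finset.sum_nonneg fun t _ => (h t).1), ?_⟩
  have h1 : ∑ t ∈ Finset.range n, ∫ s, M.r (s, φ s) ∂(M.stateLaw φ s₀ t) ≤ n := by
    simpa using Finset.sum_le_sum (s := Finset.range n) fun t _ => (h t).2
  rw [one_div_mul_eq_div]
  exact div_le_one_of_le₀ h1 (by positivity)

theorem liminf_average_le {w : ℕ → ℝ} {J : ℝ} (hw : Tendsto w atTop (nhds J))
    (h : ∀ n : ℕ, 0 < n → (1 / (n : ℝ)) *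
      ∑ t ∈ Finset.range n, ∫ s, M.r (s, φ s) ∂(M.stateLaw φ s₀ t) ≤ w n) :
    M.avgReward s₀ φ ≤ J := by
  rw [← hw.liminf_eq]
  refine liminf_le_liminf ?_ ?_ ?_
  · filter_upwards [eventually_gt_atTop 0] with n hn using h n hn
  · exact isBoundedUnder_of ⟨0, fun n => (average_mem hφ s₀ n).1⟩
  · exact hw.isCoboundedUnder_ge

theorem le_liminf_average {w : ℕ → ℝ} {J : ℝ} (hw : Tendsto w atTop (nhds J))
    (h : ∀ n : ℕ, 0 < n → w n ≤ (1 / (n : ℝ)) *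
      ∑ t ∈ Finset.range n, ∫ s, M.r (s, φ s) ∂(M.stateLaw φ s₀ t)) :
    J ≤ M.avgReward s₀ φ := by
  rw [← hw.liminf_eq]
  refine liminf_le_liminf ?_ ?_ ?_
  · filter_upwards [eventually_gt_atTop 0] with n hn using h n hn
  · exact hw.isBoundedUnder_ge
  · exact IsBoundedUnder.isCoboundedUnder_ge
      (isBoundedUnder_of ⟨1, fun n => (average_mem hφ s₀ n).2⟩)

theorem avgReward_le_one : M.avgReward s₀ φ ≤ 1 :=
  liminf_average_le hφ s₀ (w := fun _ => 1) tendsto_const_nhds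
    fun n _ => (average_mem hφ s₀ n).2

/-- The inner integral is the mean of `h` one step later, so only the first and the last term
survive. -/
theorem sum_telescope {h : Cube dS → ℝ} (hm : Measurable h) {C : ℝ} (hC : ∀ s, |h s| ≤ C) (n : ℕ) :
    |∑ t ∈ Finset.range n, ∫ s, (h s - ∫ s', h s' ∂(M.p (s, φ s))) ∂(M.stateLaw φ s₀ t)|
      ≤ 2 * C := by
  have hab : ∀ s, h s ∈ Set.Icc (-C) C := fun s => abs_le.1 (hC s)
  have hp := isProbabilityMeasure_stateLaw (M := M) hφ s₀
  have h1 : ∀ t, ∫ s, (h s - ∫ s', h s' ∂(M.p (s, φ s))) ∂(M.stateLaw φ s₀ t) =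
      ∫ s, h s ∂(M.stateLaw φ s₀ t) - ∫ s, h s ∂(M.stateLaw φ s₀ (t + 1)) := by
    intro t
    rw [stateLaw_succ, integral_step hφ _ hm hab, integral_sub]
    · exact integrable_of_mem_Icc hm hab
    · exact integrable_of_mem_Icc ((measurable_integral_p hm).comp (measurable_id.prodMk hφ))
        fun s => integral_p_mem hm hab _
  have h2 : ∀ t, |∫ s, h s ∂(M.stateLaw φ s₀ t)| ≤ C := fun t => by
    have := norm_integral_le_of_norm_le_const (μ := M.stateLaw φ s₀ t)
      (f := h) (C := C)
      (Eventually.of_forall fun s => hC s)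
    simpa using this
  simp_rw [h1]
  rw [Finset.sum_range_sub']
  have h3 := abs_le.1 (h2 0)
  have h4 := abs_le.1 (h2 n)
  rw [abs_le]
  constructor <;> linarith [h3.1, h3.2, h4.1, h4.2]

theorem integral_gap_eq {J : ℝ} {h : Cube dS → ℝ} (hm : Measurable h) {C : ℝ}
    (hC : ∀ s, |h s| ≤ C) (μ : Measure (Cube dS)) [IsProbabilityMeasure μ] :
    ∫ s, (J + h s - M.r (s, φ s) - ∫ s', h s' ∂(M.p (s, φ s))) ∂μ =
      J - ∫ s, M.r (s, φ s) ∂μ + ∫ s, (h s - ∫ s', h s' ∂(M.p (s, φ s))) ∂μ := by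
  have hab : ∀ s, h s ∈ Set.Icc (-C) C := fun s => abs_le.1 (hC s)
  have hr : Integrable (fun s => M.r (s, φ s)) μ :=
    integrable_of_mem_Icc (M.measurable_r.comp (measurable_id.prodMk hφ)) fun s => M.r_mem _
  have hh : Integrable (fun s => h s - ∫ s', h s' ∂(M.p (s, φ s))) μ :=
    (integrable_of_mem_Icc hm hab).sub (integrable_of_mem_Icc
      ((measurable_integral_p hm).comp (measurable_id.prodMk hφ)) fun s => integral_p_mem hm hab _)
  have : ∀ s, J + h s - M.r (s, φ s) - ∫ s', h s' ∂(M.p (s, φ s)) =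
      (J - M.r (s, φ s)) + (h s - ∫ s', h s' ∂(M.p (s, φ s))) := fun s => by ring
  simp_rw [this]
  rw [integral_add (f := fun s => J - M.r (s, φ s)) ((integrable_const J).sub hr) hh,
    integral_sub (integrable_const J) hr]
  simp

theorem average_le_of_gap_nonneg {J : ℝ} {h : Cube dS → ℝ} (hm : Measurable h) {C : ℝ}
    (hC : ∀ s, |h s| ≤ C)
    (hgap : ∀ s, 0 ≤ J + h s - M.r (s, φ s) - ∫ s', h s' ∂(M.p (s, φ s))) :
    M.avgReward s₀ φ ≤ J := by
  have hw : Tendsto (fun n : ℕ => J + 2 * C / (n : ℝ)) atTop (nhds J) := by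
    simpa using tendsto_const_nhds.add (tendsto_const_div_atTop_nhds_zero_nat (2 * C))
  refine liminf_average_le hφ s₀ hw fun n hn => ?_
  have hn' : (0 : ℝ) < n := by exact_mod_cast hn
  have h1 : ∀ t, ∫ s, M.r (s, φ s) ∂(M.stateLaw φ s₀ t) ≤
      J + ∫ s, (h s - ∫ s', h s' ∂(M.p (s, φ s))) ∂(M.stateLaw φ s₀ t) := fun t => by
    have := isProbabilityMeasure_stateLaw (M := M) hφ s₀ t
    have h2 := integral_gap_eq (M := M) hφ (J := J) hm hC (M.stateLaw φ s₀ t)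
    have h3 : 0 ≤ ∫ s, (J + h s - M.r (s, φ s) - ∫ s', h s' ∂(M.p (s, φ s)))
      ∂(M.stateLaw φ s₀ t) := integral_nonneg hgap
    linarith
  have h4 := Finset.sum_le_sum (s := Finset.range n) fun t _ => h1 t
  rw [Finset.sum_add_distrib, Finset.sum_const, Finset.card_range, nsmul_eq_mul] at h4
  have h5 := (abs_le.1 (sum_telescope hφ s₀ (M := M) hm hC n)).2
  rw [one_div_mul_eq_div, div_le_iff₀ hn', add_mul, div_mul_cancel₀ _ hn'.ne']
  linarith

theorem le_average_of_gap_le {J ε : ℝ} {h : Cube dS → ℝ} (hm : Measurable h) {C : ℝ}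
    (hC : ∀ s, |h s| ≤ C)
    (hgap : ∀ s, J + h s - M.r (s, φ s) - ∫ s', h s' ∂(M.p (s, φ s)) ∈ Set.Icc 0 ε) :
    J - ε ≤ M.avgReward s₀ φ := by
  have hw : Tendsto (fun n : ℕ => J - ε - 2 * C / (n : ℝ)) atTop (nhds (J - ε)) := by
    simpa using tendsto_const_nhds.sub (tendsto_const_div_atTop_nhds_zero_nat (2 * C))
  refine le_liminf_average hφ s₀ hw fun n hn => ?_
  have hn' : (0 : ℝ) < n := by exact_mod_cast hn
  have hab : ∀ s, h s ∈ Set.Icc (-C) C := fun s => abs_le.1 (hC s)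
  have hmeas : Measurable fun s => J + h s - M.r (s, φ s) - ∫ s', h s' ∂(M.p (s, φ s)) :=
    ((hm.const_add J).sub (M.measurable_r.comp (measurable_id.prodMk hφ))).sub
      ((measurable_integral_p hm).comp (measurable_id.prodMk hφ))
  have h1 : ∀ t, J - ε + ∫ s, (h s - ∫ s', h s' ∂(M.p (s, φ s))) ∂(M.stateLaw φ s₀ t) ≤
      ∫ s, M.r (s, φ s) ∂(M.stateLaw φ s₀ t) := fun t => by
    have := isProbabilityMeasure_stateLaw (M := M) hφ s₀ t
    have h2 := integral_gap_eq (M := M) hφ (J := J) hm hC (M.stateLaw φ s₀ t)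
    have h3 : ∫ s, (J + h s - M.r (s, φ s) - ∫ s', h s' ∂(M.p (s, φ s)))
        ∂(M.stateLaw φ s₀ t) ≤ ε := by
      simpa using integral_mono (μ := M.stateLaw φ s₀ t)
        (integrable_of_mem_Icc hmeas hgap) (integrable_const ε)
        fun s => (hgap s).2
    linarith
  have h4 := Finset.sum_le_sum (s := Finset.range n) fun t _ => h1 t
  rw [Finset.sum_add_distrib, Finset.sum_const, Finset.card_range, nsmul_eq_mul] at h4
  have h5 := (abs_le.1 (sum_telescope hφ s₀ (M := M) hm hC n)).1
  rw [one_div_mul_eq_div, le_div_iff₀ hn', sub_mul, div_mul_cancel₀ _ hn'.ne']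
  linarith

end Average

/-! ### Identification of the optimal average reward and span of the relative value -/

section OptimalityEquation

variable {met : Metrics dS dA} {Lr Lp : ℝ}
  (lip_r : ∀ z z', |M.r z - M.r z'| ≤ Lr * met.ρ z z')
  (lip_p : ∀ z z', tvDist (M.p z) (M.p z') ≤ Lp * met.ρ z z')

theorem SolvesAROE.gap_nonneg {J : ℝ} {h : Cube dS → ℝ} (H : M.SolvesAROE J h) (s : Cube dS)
    (a : Cube dA) : 0 ≤ J + h s - M.r (s, a) - ∫ s', h s' ∂(M.p (s, a)) := by
  have := (H.eqn s).2 ⟨a, rfl⟩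
  simp only at this
  linarith

theorem bddAbove_avgReward (s₀ : Cube dS) : BddAbove (Set.range
    fun φ : {φ : Cube dS → Cube dA // Measurable φ} => M.avgReward s₀ φ.1) :=
  ⟨1, by rintro _ ⟨φ, rfl⟩; exact avgReward_le_one φ.2 s₀⟩

theorem optAvgReward_le_one (s₀ : Cube dS) : M.optAvgReward s₀ ≤ 1 := by
  have : Nonempty {φ : Cube dS → Cube dA // Measurable φ} := ⟨⟨fun _ _ => 0, measurable_const⟩⟩
  exact ciSup_le fun φ => avgReward_le_one φ.2 s₀

include lip_r lip_p in
-- Nonnegative gaps give one inequality. For the other, measurable selection is avoided: on each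
-- dyadic cube, play an action that is optimal at one point of the cube. This policy is measurable
-- and its gap is at most twice a Lipschitz error of order `2 ^ (-ℓ)`.
theorem SolvesAROE.eq_optAvgReward {J : ℝ} {h : Cube dS → ℝ} (H : M.SolvesAROE J h)
    (s₀ : Cube dS) : J = M.optAvgReward s₀ := by
  obtain ⟨C, hC⟩ := H.bounded
  have hab : ∀ s, h s ∈ Set.Icc (-C) C := fun s => abs_le.1 (hC s)
  have : Nonempty {φ : Cube dS → Cube dA // Measurable φ} := ⟨⟨fun _ _ => 0, measurable_const⟩⟩
  refine le_antisymm ?_ (ciSup_le fun φ =>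
    average_le_of_gap_nonneg φ.2 s₀ H.measurable hC fun s => H.gap_nonneg s _)
  set B : ℝ := |Lr + (C - -C) * (Lp / 2)| with hB
  have hlip : ∀ z z', |M.qValue h z - M.qValue h z'| ≤ B * met.ρ z z' := fun z z' =>
    (abs_qValue_sub_le lip_r lip_p H.measurable hab z z').trans
      (mul_le_mul_of_nonneg_right (le_abs_self _) (met.isMetric.nonneg _ _))
  have hmax : ∀ s, ∃ a, J + h s = M.qValue h (s, a) := fun s => by
    obtain ⟨a, ha⟩ := (H.eqn s).1
    exact ⟨a, ha.symm⟩
  choose a ha using hmax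
  have key : ∀ ℓ : ℕ, J - 2 * B * (1 / 2 : ℝ) ^ ℓ ≤ M.optAvgReward s₀ := by
    intro ℓ
    let pick : (Fin dS → Fin (2 ^ ℓ)) → Cube dS :=
      fun v => Classical.epsilon fun s => boxIdx ℓ s = v
    let φ : Cube dS → Cube dA := fun s => a (pick (boxIdx ℓ s))
    have hφ : Measurable φ := measurable_comp_boxIdx ℓ fun v => a (pick v)
    have hpick : ∀ s, boxIdx ℓ (pick (boxIdx ℓ s)) = boxIdx ℓ s := fun s =>
      Classical.epsilon_spec (p := fun s' => boxIdx ℓ s' = boxIdx ℓ s) ⟨s, rfl⟩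
    refine le_trans (le_average_of_gap_le hφ s₀ H.measurable hC (ε := 2 * B * (1 / 2 : ℝ) ^ ℓ)
      fun s => ⟨H.gap_nonneg s _, ?_⟩) (le_ciSup (bddAbove_avgReward s₀) ⟨φ, hφ⟩)
    set s' := pick (boxIdx ℓ s) with hs'
    have hρ : ∀ b, met.ρ (s, b) (s', b) ≤ (1 / 2 : ℝ) ^ ℓ := fun b => by
      rw [show ((1 : ℝ) / 2) ^ ℓ = diam met.ρ (cellAt ℓ (s, b)).toSet from
        (met.diam_cell (cellAt ℓ (s, b))).symm]
      refine met.isMetric.le_diam (mem_cellAt ℓ _) ?_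
      rw [mem_cellAt_iff, cellAt_eq_iff]
      exact ⟨(hpick s).symm, rfl⟩
    have hB0 : 0 ≤ B := abs_nonneg _
    -- Two Lipschitz errors, one for each of the actions `a s` and `a s'`, together with the
    -- optimality of `a s'` at `s'`.
    have h1 := (abs_le.1 (hlip (s, a s) (s', a s))).2
    have h2 := (abs_le.1 (hlip (s, a s') (s', a s'))).1
    have h3 := mul_le_mul_of_nonneg_left (hρ (a s)) hB0
    have h4 := mul_le_mul_of_nonneg_left (hρ (a s')) hB0
    have h5 := ha s
    have h6 := ha s'
    have h7 := H.gap_nonneg s' (a s)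
    have h8 : φ s = a s' := rfl
    rw [h8]
    simp only [qValue] at *
    linarith
  refine le_of_tendsto' (f := fun ℓ : ℕ => J - 2 * B * (1 / 2 : ℝ) ^ ℓ) (x := atTop) ?_ key
  have := (tendsto_pow_atTop_nhds_zero_of_lt_one (r := (1 / 2 : ℝ)) (by norm_num)
    (by norm_num)).const_mul (2 * B)
  simpa using tendsto_const_nhds.sub this

include lip_r lip_p in
theorem solvesAROE_relValue {α : ℝ} (hα : α ∈ Set.Ioo (0 : ℝ) 1)
    (herg : ∀ z z', tvDist (M.p z) (M.p z') ≤ 2 * α) (s₀ : Cube dS) :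
    M.SolvesAROE (M.optAvgReward s₀) (M.relValue s₀) := by
  refine Classical.epsilon_spec (p := fun h => M.SolvesAROE (M.optAvgReward s₀) h) ?_
  have hq : ∀ v : C(Cube dS, ℝ), Continuous (M.qValue v) := fun v =>
    met.isMetric.continuous_of_lipschitz (abs_qValue_sub_le lip_r lip_p v.continuous.measurable
      fun x => abs_le.1 (v.norm_coe_le_norm x))
  obtain ⟨J, h, H⟩ := exists_solvesAROE hq hα herg
  exact ⟨h, H.eq_optAvgReward lip_r lip_p s₀ ▸ H⟩

/-- The span of a solution of the optimality equation. -/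
theorem SolvesAROE.sub_le {J : ℝ} {h : Cube dS → ℝ} (H : M.SolvesAROE J h) {α : ℝ}
    (hα : α ∈ Set.Ioo (0 : ℝ) 1) (herg : ∀ z z', tvDist (M.p z) (M.p z') ≤ 2 * α)
    (x y : Cube dS) : h x - h y ≤ 1 / (1 - α) := by
  obtain ⟨C, hC⟩ := H.bounded
  -- The map `c ↦ 1 + c * α` has the fixed point `1 / (1 - α)`; started from the crude bound, the
  -- excess decays like `α ^ n`.
  have step : ∀ c, (∀ x y, h x - h y ≤ c) → ∀ x y, h x - h y ≤ 1 + c * α := by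
    intro c hc x y
    obtain ⟨a, ha⟩ := (H.eqn x).1
    have h1 := H.gap_nonneg y a
    have h2 := (abs_le.1 (abs_integral_sub_integral_le_of_osc
      (μ := M.p (x, a)) (ν := M.p (y, a)) (abs_real_sub_real_le (herg _ _)) H.measurable hc)).2
    have h3 := (M.r_mem (x, a)).2
    have h4 := (M.r_mem (y, a)).1
    simp only at ha
    linarith
  have hA : 0 < 1 - α := by linarith [hα.2]
  have hn : ∀ n : ℕ, ∀ x y, h x - h y ≤ 1 / (1 - α) + α ^ n * (2 * C) := by
    intro n
    induction n with
    | zero =>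
      intro x y
      have : 0 < 1 / (1 - α) := by positivity
      linarith [(abs_le.1 (hC x)).2, (abs_le.1 (hC y)).1]
    | succ n ih =>
      intro x y
      refine (step _ ih x y).trans (le_of_eq ?_)
      field_simp
      ring
  refine ge_of_tendsto' (f := fun n : ℕ => 1 / (1 - α) + α ^ n * (2 * C)) (x := atTop) ?_
    (fun n => hn n x y)
  simpa using tendsto_const_nhds.add
    ((tendsto_pow_atTop_nhds_zero_of_lt_one hα.1.le hα.2).mul_const (2 * C))

end OptimalityEquation

end MDP

namespace Setting

variable {dS dA : ℕ} {E : Setting dS dA}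

/-! ### Visit counts and the partition into active cells -/

variable (E) in
/-- The factor `c₁ log (T / δ)` in the activation thresholds. -/
noncomputable def budget : ℝ := E.c₁ * E.logTδ

variable (E) in
/-- The number of visits at which the cells of level `ℓ` are activated. -/
noncomputable def threshold (ℓ : ℕ) : ℝ := E.budget * 2 ^ (ℓ * (dS + 2))

theorem cellDiam_eq (ζ : Cell dS dA) : E.cellDiam ζ = (1 / 2 : ℝ) ^ ζ.level := E.met.diam_cell ζ

theorem cellDiam_pos (ζ : Cell dS dA) : 0 < E.cellDiam ζ := by rw [cellDiam_eq]; positivity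

theorem cellDiam_le_one (ζ : Cell dS dA) : E.cellDiam ζ ≤ 1 := by
  rw [cellDiam_eq]; exact pow_le_one₀ (by norm_num) (by norm_num)

/-- The factor `2 ^ (dS + 2)` is one halving of the diameter, so a cell is deactivated at exactly
the count that activates its children. This is why the active cells form a partition. -/
theorem Nmax_eq (ζ : Cell dS dA) : E.Nmax ζ = E.threshold (ζ.level + 1) := by
  rw [Nmax, threshold, budget, cellDiam_eq, ← pow_mul, one_div, inv_pow, div_inv_eq_mul, add_mul,
    pow_add, one_mul]
  ring

theorem Nmin_eq (ζ : Cell dS dA) (h : ζ.level ≠ 0) : E.Nmin ζ = E.threshold ζ.level := by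
  rw [Nmin, if_neg h, threshold, budget, cellDiam_eq, ← pow_mul, one_div, inv_pow, div_inv_eq_mul]

theorem logTδ_pos (hE : E.Standing) : 0 < E.logTδ := by
  refine Real.log_pos ?_
  rw [one_lt_div hE.hδ.1]
  have : (2 : ℝ) ≤ E.T := by exact_mod_cast hE.hT
  linarith [hE.hδ.2]

theorem budget_pos (hE : E.Standing) : 0 < E.budget := mul_pos hE.hc₁ (logTδ_pos hE)

theorem threshold_mono (hE : E.Standing) : Monotone E.threshold := fun _ _ hij =>
  mul_le_mul_of_nonneg_left
    (pow_le_pow_right₀ one_le_two (Nat.mul_le_mul_right _ hij)) (budget_pos hE).le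

theorem threshold_pos (hE : E.Standing) (ℓ : ℕ) : 0 < E.threshold ℓ :=
  mul_pos (budget_pos hE) (by positivity)

theorem exists_lt_threshold (hE : E.Standing) (n : ℝ) : ∃ ℓ, n < E.threshold ℓ := by
  obtain ⟨ℓ, hℓ⟩ := pow_unbounded_of_one_lt (n / E.budget) (one_lt_two (α := ℝ))
  refine ⟨ℓ, ?_⟩
  rw [div_lt_iff₀' (budget_pos hE)] at hℓ
  refine hℓ.trans_le (mul_le_mul_of_nonneg_left ?_ (budget_pos hE).le)
  exact pow_le_pow_right₀ one_le_two (Nat.le_mul_of_pos_right _ (by positivity))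

/-- Levels are compared through diameters, which are powers of `1 / 2`. -/
theorem subset_cell {ℓ : ℕ} {z : Cube dS × Cube dA} {ζ : Cell dS dA} (E : Setting dS dA)
    (h : (cellAt ℓ z).toSet ⊆ ζ.toSet) : ζ.level ≤ ℓ ∧ ζ = cellAt ζ.level z := by
  refine ⟨?_, (mem_toSet_iff _ _).1 (h (mem_cellAt ℓ z))⟩
  have h1 := E.met.isMetric.diam_mono ⟨z, mem_cellAt ℓ z⟩ h
  rw [E.met.diam_cell, E.met.diam_cell] at h1
  exact (pow_le_pow_iff_right_of_lt_one₀ (by norm_num) (by norm_num)).1 h1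

variable {ω : SamplePath dS dA}

variable (E ω) in
/-- The event that a visit of the cell `ζ` is counted at time `t`. -/
def CountsVisit (t : ℕ) (ζ : Cell dS dA) : Prop :=
  ∃ ζ', E.Active ω t ζ' ∧ ζ.toSet ⊆ ζ'.toSet ∧ (ω.state t, ω.act t) ∈ ζ'.toSet

open Classical in
theorem visits_succ (t : ℕ) (ζ : Cell dS dA) :
    E.visits ω (t + 1) ζ = E.visits ω t ζ + if E.CountsVisit ω t ζ then 1 else 0 := rfl

theorem visits_zero (ζ : Cell dS dA) : E.visits ω 0 ζ = 0 := rfl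

theorem visits_le_succ (t : ℕ) (ζ : Cell dS dA) : E.visits ω t ζ ≤ E.visits ω (t + 1) ζ := by
  rw [visits_succ]; exact Nat.le_add_right _ _

theorem visits_le (t : ℕ) (ζ : Cell dS dA) : E.visits ω t ζ ≤ t := by
  induction t with
  | zero => exact le_rfl
  | succ t ih => rw [visits_succ]; split_ifs <;> omega

theorem active_lt_Nmax (hE : E.Standing) {t : ℕ} {ζ : Cell dS dA} (h : E.Active ω t ζ) :
    (E.visits ω t ζ : ℝ) < E.threshold (ζ.level + 1) := by
  rcases h with ⟨rfl, -⟩ | h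
  · rw [visits_zero]; simpa using threshold_pos hE _
  · rw [← Nmax_eq]; exact h.2

theorem threshold_le_of_active {t : ℕ} {ζ : Cell dS dA} (h : E.Active ω t ζ)
    (hl : ζ.level ≠ 0) : E.threshold ζ.level ≤ E.visits ω t ζ := by
  rcases h with ⟨-, h⟩ | h
  · exact absurd h hl
  · rw [← Nmin_eq _ hl]; exact h.1

/-- The counts of a cell and of its parent agree until the parent is deactivated; at that time the
cell is activated. -/
theorem visits_child (t ℓ : ℕ) (z : Cube dS × Cube dA) :
    ((E.visits ω t (cellAt ℓ z) : ℝ) < E.threshold (ℓ + 1) →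
      E.visits ω t (cellAt (ℓ + 1) z) = E.visits ω t (cellAt ℓ z)) ∧
    (E.threshold (ℓ + 1) ≤ E.visits ω t (cellAt ℓ z) →
      E.threshold (ℓ + 1) ≤ E.visits ω t (cellAt (ℓ + 1) z)) := by
  induction t with
  | zero =>
    refine ⟨fun _ => rfl, fun h => ?_⟩
    rw [visits_zero] at *
    exact h
  | succ t ih =>
    by_cases hlt : (E.visits ω t (cellAt ℓ z) : ℝ) < E.threshold (ℓ + 1)
    · have heq := ih.1 hlt
      have hiff : E.CountsVisit ω t (cellAt (ℓ + 1) z) ↔ E.CountsVisit ω t (cellAt ℓ z) := by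
        constructor
        · rintro ⟨ζ', ha, hsub, hm⟩
          obtain ⟨hl, hc⟩ := subset_cell E hsub
          refine ⟨ζ', ha, ?_, hm⟩
          rcases Nat.lt_or_eq_of_le hl with hl | hl
          · rw [hc]; exact cellAt_subset_cellAt (Nat.le_of_lt_succ hl) z
          -- The child itself cannot be active yet: its count equals that of the parent and is below
          -- its own activation threshold.
          · exfalso
            have h1 := threshold_le_of_active ha (by omega)
            rw [hc, show (cellAt ζ'.level z).level = ζ'.level from rfl, hl, heq] at h1
            exact absurd hlt (not_lt.2 h1)
        · rintro ⟨ζ', ha, hsub, hm⟩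
          exact ⟨ζ', ha, (cellAt_subset_cellAt (Nat.le_succ ℓ) z).trans hsub, hm⟩
      have heq' : E.visits ω (t + 1) (cellAt (ℓ + 1) z) = E.visits ω (t + 1) (cellAt ℓ z) := by
        classical
        rw [visits_succ, visits_succ, heq, if_congr hiff rfl rfl]
      exact ⟨fun _ => heq', fun h => by rw [heq']; exact h⟩
    · rw [not_lt] at hlt
      have h1 : (E.visits ω t (cellAt ℓ z) : ℝ) ≤ E.visits ω (t + 1) (cellAt ℓ z) := by
        exact_mod_cast visits_le_succ t _
      have h2 : (E.visits ω t (cellAt (ℓ + 1) z) : ℝ) ≤ E.visits ω (t + 1) (cellAt (ℓ + 1) z) := by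
        exact_mod_cast visits_le_succ t _
      exact ⟨fun h => absurd h (not_lt.2 (hlt.trans h1)), fun _ => (ih.2 hlt).trans h2⟩

theorem visits_descendant (hE : E.Standing) {t ℓ : ℕ} {z : Cube dS × Cube dA}
    (h : (E.visits ω t (cellAt ℓ z) : ℝ) < E.threshold (ℓ + 1)) (j : ℕ) :
    E.visits ω t (cellAt (ℓ + j) z) = E.visits ω t (cellAt ℓ z) := by
  induction j with
  | zero => rfl
  | succ j ih =>
    rw [← ih]
    refine (visits_child t (ℓ + j) z).1 ?_
    rw [ih]
    exact h.trans_le (threshold_mono hE (by omega))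

/-- Two active cells with a common point are equal. -/
theorem active_unique (hE : E.Standing) {t : ℕ} {ζ ζ' : Cell dS dA} {z : Cube dS × Cube dA}
    (h : E.Active ω t ζ) (h' : E.Active ω t ζ') (hz : z ∈ ζ.toSet) (hz' : z ∈ ζ'.toSet) :
    ζ = ζ' := by
  wlog hl : ζ.level ≤ ζ'.level generalizing ζ ζ'
  · exact (this h' h hz' hz (le_of_not_ge hl)).symm
  have hc := (mem_toSet_iff _ _).1 hz
  have hc' := (mem_toSet_iff _ _).1 hz'
  rcases Nat.lt_or_eq_of_le hl with hl | hl
  -- While the larger cell is active, the smaller one has the same count, hence has not reached its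
  -- activation threshold.
  · exfalso
    have h1 := active_lt_Nmax hE h
    have h2 := threshold_le_of_active h' (by omega)
    obtain ⟨j, hj⟩ := Nat.exists_eq_add_of_le hl.le
    rw [hc, show (cellAt ζ.level z).level = ζ.level from rfl] at h1
    rw [hc', show (cellAt ζ'.level z).level = ζ'.level from rfl] at h2
    have h3 := visits_descendant hE h1 j
    rw [← hj] at h3
    rw [h3] at h2
    exact absurd (h2.trans_lt h1) (not_lt.2 (threshold_mono hE hl))
  · rw [hc, hc', hl]

theorem cellAt_zero_eq (z w : Cube dS × Cube dA) : cellAt 0 z = cellAt 0 w := by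
  rw [cellAt_eq_iff]
  have : Subsingleton (Fin (2 ^ 0)) := inferInstanceAs (Subsingleton (Fin 1))
  exact ⟨Subsingleton.elim _ _, Subsingleton.elim _ _⟩

theorem one_le_visits_root (t : ℕ) (z : Cube dS × Cube dA) :
    1 ≤ E.visits ω (t + 1) (cellAt 0 z) := by
  induction t with
  | zero =>
    have : E.CountsVisit ω 0 (cellAt 0 z) := by
      refine ⟨cellAt 0 z, Or.inl ⟨rfl, rfl⟩, subset_rfl, ?_⟩
      rw [mem_cellAt_iff]; exact cellAt_zero_eq _ _
    rw [visits_succ, if_pos this]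
    omega
  | succ t ih => exact ih.trans (visits_le_succ _ _)

/-- The active cells cover the state-action space. -/
theorem exists_active (hE : E.Standing) (t : ℕ) (z : Cube dS × Cube dA) :
    ∃ ζ, E.Active ω t ζ ∧ z ∈ ζ.toSet := by
  cases t with
  | zero => exact ⟨cellAt 0 z, Or.inl ⟨rfl, rfl⟩, mem_cellAt 0 z⟩
  | succ t =>
    have hex : ∃ ℓ, (E.visits ω (t + 1) (cellAt ℓ z) : ℝ) < E.threshold (ℓ + 1) := by
      obtain ⟨ℓ, hℓ⟩ := exists_lt_threshold hE ((t + 1 : ℕ) : ℝ)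
      refine ⟨ℓ, lt_of_le_of_lt ?_ (hℓ.trans_le (threshold_mono hE (Nat.le_succ ℓ)))⟩
      exact_mod_cast visits_le _ _
    classical
    -- Take the coarsest cell around `z` below its upper threshold: its parent has passed that
    -- threshold, and so the cell has been activated.
    obtain ⟨ℓ, hℓ, hmin⟩ : ∃ ℓ, (E.visits ω (t + 1) (cellAt ℓ z) : ℝ) < E.threshold (ℓ + 1) ∧
        ∀ j < ℓ, ¬ (E.visits ω (t + 1) (cellAt j z) : ℝ) < E.threshold (j + 1) :=
      ⟨Nat.find hex, Nat.find_spec hex, fun j hj => Nat.find_min hex hj⟩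
    refine ⟨cellAt ℓ z, Or.inr ⟨?_, by rw [Nmax_eq]; exact hℓ⟩, mem_cellAt ℓ z⟩
    cases ℓ with
    | zero =>
      rw [Nmin, if_pos (show (cellAt 0 z).level = 0 from rfl)]
      exact_mod_cast one_le_visits_root t z
    | succ ℓ =>
      rw [Nmin_eq _ (Nat.succ_ne_zero ℓ)]
      exact (visits_child _ ℓ z).2 (not_lt.1 (hmin ℓ (Nat.lt_succ_self ℓ)))

theorem activeCell_spec (hE : E.Standing) (t : ℕ) (z : Cube dS × Cube dA) :
    E.Active ω t (E.activeCell ω t z) ∧ z ∈ (E.activeCell ω t z).toSet :=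
  Classical.epsilon_spec (p := fun ζ => E.Active ω t ζ ∧ z ∈ ζ.toSet) (exists_active hE t z)

theorem activeCell_eq (hE : E.Standing) {t : ℕ} {z : Cube dS × Cube dA} {ζ : Cell dS dA}
    (h : E.Active ω t ζ) (hz : z ∈ ζ.toSet) : E.activeCell ω t z = ζ :=
  active_unique hE (activeCell_spec hE t z).1 h (activeCell_spec hE t z).2 hz

theorem bddAbove_level (hE : E.Standing) (t : ℕ) :
    BddAbove {ℓ | ∃ ζ : Cell dS dA, E.Active ω t ζ ∧ ζ.level = ℓ} := by
  obtain ⟨L, hL⟩ := exists_lt_threshold hE (t : ℝ)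
  refine ⟨L, ?_⟩
  rintro _ ⟨ζ, hζ, rfl⟩
  by_contra! hlt
  have h1 := threshold_le_of_active hζ (by omega)
  have h2 : (E.visits ω t ζ : ℝ) ≤ t := by exact_mod_cast visits_le _ _
  exact absurd (h1.trans h2) (not_le.2 (hL.trans_le (threshold_mono hE hlt.le)))

theorem level_le_maxLevel (hE : E.Standing) {t : ℕ} {ζ : Cell dS dA} (h : E.Active ω t ζ) :
    ζ.level ≤ E.maxLevel ω t :=
  le_csSup (bddAbove_level hE t) ⟨ζ, h, rfl⟩

theorem finite_active (hE : E.Standing) (t : ℕ) : {ζ : Cell dS dA | E.Active ω t ζ}.Finite := by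
  let f : (Σ ℓ : Fin (E.maxLevel ω t + 1), (Fin dS → Fin (2 ^ (ℓ : ℕ))) ×
      (Fin dA → Fin (2 ^ (ℓ : ℕ)))) → Cell dS dA := fun x => ⟨x.1, x.2.1, x.2.2⟩
  refine (Set.finite_range f).subset fun ζ hζ => ?_
  exact ⟨⟨⟨ζ.level, Nat.lt_succ_of_le (level_le_maxLevel hE hζ)⟩, ζ.stIdx, ζ.acIdx⟩, rfl⟩

/-- Two states in the same cell of the finest active level are in the same active cells. -/
theorem activeCell_congr (hE : E.Standing) {t : ℕ} {s s' : Cube dS} (a : Cube dA)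
    (h : boxIdx (E.maxLevel ω t) s = boxIdx (E.maxLevel ω t) s') :
    E.activeCell ω t (s, a) = E.activeCell ω t (s', a) := by
  obtain ⟨h1, h2⟩ := activeCell_spec (ω := ω) hE t (s', a)
  refine activeCell_eq hE h1 ?_
  rw [mem_toSet_iff] at h2 ⊢
  refine h2.trans ?_
  rw [cellAt_eq_iff]
  exact ⟨boxIdx_eq_of_le (level_le_maxLevel hE h1) h.symm, rfl⟩

theorem boxIdx_pt (t : ℕ) (ξ : E.DState ω t) : boxIdx (E.maxLevel ω t) (E.pt ω t ξ) = ξ :=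
  (mem_box_iff _ _ _).1 (E.rep.qS_mem _ _)

theorem activeCell_pt (hE : E.Standing) (t : ℕ) (s : Cube dS) (a : Cube dA) :
    E.activeCell ω t (E.pt ω t (boxIdx (E.maxLevel ω t) s), a) = E.activeCell ω t (s, a) :=
  activeCell_congr hE a (boxIdx_pt t _)

theorem mem_dActs {t : ℕ} {ξ : E.DState ω t} {a : Cube dA}
    (h : a ∈ E.dActs ω t ξ) : ∃ ζ, E.Active ω t ζ ∧ (E.pt ω t ξ, a) ∈ ζ.toSet := by
  obtain ⟨ζ, hζ, ⟨b, hb⟩, rfl⟩ := h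
  exact ⟨ζ, hζ, hb.1, E.rep.qA_mem _ _⟩

theorem finite_dActs (hE : E.Standing) (t : ℕ) (ξ : E.DState ω t) : (E.dActs ω t ξ).Finite := by
  refine ((finite_active (ω := ω) hE t).image fun ζ => E.rep.qA ζ.level ζ.acIdx).subset ?_
  rintro a ⟨ζ, hζ, -, rfl⟩
  exact ⟨ζ, hζ, rfl⟩

/-- Each active cell that contains a state-action pair provides an available action. -/
theorem exists_dActs_of_active (hE : E.Standing) {t : ℕ} {ζ : Cell dS dA}
    {z : Cube dS × Cube dA} (hζ : E.Active ω t ζ) (hz : z ∈ ζ.toSet) :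
    ∃ a ∈ E.dActs ω t (boxIdx (E.maxLevel ω t) z.1),
      (E.pt ω t (boxIdx (E.maxLevel ω t) z.1), a) ∈ ζ.toSet := by
  have hbox : E.pt ω t (boxIdx (E.maxLevel ω t) z.1) ∈ box ζ.level ζ.stIdx := by
    rw [mem_box_iff, ← (mem_box_iff _ _ _).1 hz.1]
    exact boxIdx_eq_of_le (level_le_maxLevel hE hζ) (boxIdx_pt t _)
  exact ⟨E.rep.qA ζ.level ζ.acIdx, ⟨ζ, hζ, ⟨z.2, hbox, hz.2⟩, rfl⟩, hbox, E.rep.qA_mem _ _⟩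

/-! ### The estimated kernel -/

theorem sum_transitions_le (t : ℕ) (ζ : Cell dS dA) :
    ∑ v, E.transitions ω t ζ (box ζ.level v) ≤ E.visits ω t ζ := by
  classical
  have hv : E.visits ω t ζ = ∑ i ∈ Finset.range t, if E.CountsVisit ω i ζ then 1 else 0 := by
    induction t with
    | zero => rfl
    | succ t ih => rw [Finset.sum_range_succ, ← ih, visits_succ]
  rw [hv]
  simp only [transitions]
  rw [Finset.sum_comm]
  refine Finset.sum_le_sum fun i _ => ?_
  by_cases hc : E.CountsVisit ω i ζ
  · rw [if_pos hc]
    calc _ ≤ ∑ v : Fin dS → Fin (2 ^ ζ.level), if boxIdx ζ.level (ω.state (i + 1)) = v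
          then 1 else 0 := by
          refine Finset.sum_le_sum fun v _ => ?_
          by_cases h1 : boxIdx ζ.level (ω.state (i + 1)) = v
          · rw [if_pos h1]; split_ifs <;> omega
          · rw [if_neg (fun h => h1 ((mem_box_iff _ _ _).1 h.2))]; exact Nat.zero_le _
      _ ≤ 1 := by simp
  · rw [if_neg hc]
    refine le_of_eq (Finset.sum_eq_zero fun v _ => if_neg fun h => hc h.1)

theorem pHatD_nonneg (t : ℕ) (ζ : Cell dS dA) (v : Fin dS → Fin (2 ^ ζ.level)) :
    0 ≤ E.pHatD ω t ζ v := by unfold pHatD; positivity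

theorem wpHat_nonneg (t : ℕ) (ζ : Cell dS dA) (ξ : E.DState ω t) : 0 ≤ E.wpHat ω t ζ ξ :=
  Finset.sum_nonneg fun v _ => mul_nonneg (by positivity) (pHatD_nonneg t ζ v)

/-- Equality fails for an unvisited cell, whose estimate vanishes. The inequality is enough to make
a confidence radius of `2` vacuous. -/
theorem sum_wpHat_le_one (t : ℕ) (ζ : Cell dS dA) : ∑ ξ, E.wpHat ω t ζ ξ ≤ 1 := by
  simp only [wpHat, pHat]
  rw [Finset.sum_comm]
  have h1 : ∀ v : Fin dS → Fin (2 ^ ζ.level), ∑ ξ : E.DState ω t,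
      volume.real (box (E.maxLevel ω t) ξ ∩ box ζ.level v) / volume.real (box (n := dS) ζ.level v) *
        E.pHatD ω t ζ v ≤ E.pHatD ω t ζ v := by
    intro v
    rw [← Finset.sum_mul, ← Finset.sum_div]
    refine mul_le_of_le_one_left (pHatD_nonneg t ζ v) (div_le_one_of_le₀ ?_ measureReal_nonneg)
    rw [← measureReal_iUnion_fintype]
    · exact measureReal_mono (Set.iUnion_subset fun ξ => Set.inter_subset_right)
    · intro ξ ξ' h
      exact (pairwise_disjoint_box _ h).mono Set.inter_subset_left Set.inter_subset_left
    · exact fun ξ => (measurableSet_box _ _).inter (measurableSet_box _ _)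
  refine (Finset.sum_le_sum fun v _ => h1 v).trans ?_
  simp only [pHatD]
  rw [← Finset.sum_div]
  refine div_le_one_of_le₀ (le_trans ?_ (le_max_right _ _)) (by positivity)
  exact_mod_cast sum_transitions_le t ζ

theorem wp_nonneg (t : ℕ) (z : Cube dS × Cube dA) (ξ : E.DState ω t) : 0 ≤ E.wp ω t z ξ :=
  measureReal_nonneg

/-- The integral of a function of the discrete state. -/
theorem integral_comp_boxIdx {n : ℕ} (ℓ : ℕ) (μ : Measure (Cube n)) [IsFiniteMeasure μ]
    (g : (Fin n → Fin (2 ^ ℓ)) → ℝ) :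
    ∫ s, g (boxIdx ℓ s) ∂μ = ∑ v, μ.real (box ℓ v) * g v := by
  have h1 : ∫ s, g (boxIdx ℓ s) ∂μ = ∫ v, g v ∂(μ.map (boxIdx ℓ)) :=
    (integral_map (measurable_boxIdx ℓ).aemeasurable
      (measurable_of_countable g).aestronglyMeasurable).symm
  rw [h1, integral_fintype (Integrable.of_finite)]
  refine Finset.sum_congr rfl fun v _ => ?_
  rw [map_measureReal_apply (measurable_boxIdx ℓ) (measurableSet_singleton v), smul_eq_mul]
  congr 2
  ext x
  simp [mem_box_iff]

theorem sum_wp (t : ℕ) (z : Cube dS × Cube dA) : ∑ ξ, E.wp ω t z ξ = 1 := by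
  have := integral_comp_boxIdx (E.maxLevel ω t) (E.M.p z) fun _ => 1
  simpa [wp] using this.symm

end Setting

/-! ### Span-constrained optimisation -/

theorem sub_le_span {S : Type} [Finite S] (v : S → ℝ) (s s' : S) : v s - v s' ≤ span v :=
  sub_le_sub (le_ciSup (Set.finite_range v).bddAbove s) (ciInf_le (Set.finite_range v).bddBelow s')

theorem span_nonneg {S : Type} [Finite S] [Nonempty S] (v : S → ℝ) : 0 ≤ span v := by
  obtain ⟨s⟩ := ‹Nonempty S›
  simpa using sub_le_span v s s

theorem span_le {S : Type} [Finite S] [Nonempty S] {v : S → ℝ} {c : ℝ}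
    (h : ∀ s s', v s - v s' ≤ c) : span v ≤ c := by
  obtain ⟨s, hs⟩ := exists_eq_ciSup_of_finite (f := v)
  obtain ⟨s', hs'⟩ := exists_eq_ciInf_of_finite (f := v)
  rw [span, ← hs, ← hs']
  exact h s s'

namespace ExtMDP

variable {S A : Type}

/-- The kernels of `E` are those whose rows belong to given nonempty, compact and convex sets. -/
structure IsRectangular (E : ExtMDP S A) (P : S → A → Set (S → ℝ)) : Prop where
  mem_kernels : ∀ θ, θ ∈ E.kernels ↔ ∀ s, ∀ a ∈ E.acts s, θ s a ∈ P s a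
  finite_acts : ∀ s, (E.acts s).Finite
  nonempty_acts : ∀ s, (E.acts s).Nonempty
  isCompact : ∀ s, ∀ a ∈ E.acts s, IsCompact (P s a)
  convex : ∀ s, ∀ a ∈ E.acts s, Convex ℝ (P s a)
  nonempty : ∀ s, ∀ a ∈ E.acts s, (P s a).Nonempty

variable {E : ExtMDP S A} {P : S → A → Set (S → ℝ)}

/-- Rows are constrained independently, so one can be prescribed and the others filled in from the
nonempty row sets. -/
theorem IsRectangular.exists_kernel (H : E.IsRectangular P) {s : S} {a : A} {q : S → ℝ}
    (hq : q ∈ P s a) : ∃ θ ∈ E.kernels, θ s a = q := by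
  classical
  have hex : ∀ s' a', ∃ p : S → ℝ, (s' = s ∧ a' = a → p = q) ∧ (a' ∈ E.acts s' → p ∈ P s' a') := by
    intro s' a'
    by_cases h : s' = s ∧ a' = a
    · obtain ⟨rfl, rfl⟩ := h
      exact ⟨q, fun _ => rfl, fun _ => hq⟩
    · by_cases ha : a' ∈ E.acts s'
      · obtain ⟨p, hp⟩ := H.nonempty s' a' ha
        exact ⟨p, fun h' => absurd h' h, fun _ => hp⟩
      · exact ⟨q, fun h' => absurd h' h, fun h' => absurd h' ha⟩
  choose θ h1 h2 using hex
  exact ⟨θ, (H.mem_kernels θ).2 h2, h1 s a ⟨rfl, rfl⟩⟩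

variable [Fintype S]

theorem IsRectangular.isCompact_values (H : E.IsRectangular P) (v : S → ℝ) (s : S) :
    IsCompact {x | ∃ a ∈ E.acts s, ∃ θ ∈ E.kernels, x = E.value v θ s a} := by
  have heq : {x | ∃ a ∈ E.acts s, ∃ θ ∈ E.kernels, x = E.value v θ s a} =
      ⋃ a ∈ E.acts s, (fun q : S → ℝ => E.rew s a + ∑ s', q s' * v s') '' P s a := by
    ext x
    simp only [Set.mem_iUnion, Set.mem_image]
    constructor
    · rintro ⟨a, ha, θ, hθ, rfl⟩
      exact ⟨a, ha, θ s a, (H.mem_kernels θ).1 hθ s a ha, rfl⟩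
    · rintro ⟨a, ha, q, hq, rfl⟩
      obtain ⟨θ, hθ, rfl⟩ := H.exists_kernel hq
      exact ⟨a, ha, θ, hθ, rfl⟩
  rw [heq]
  refine (H.finite_acts s).isCompact_biUnion fun a ha => (H.isCompact s a ha).image ?_
  fun_prop

theorem IsRectangular.value_le_bellman (H : E.IsRectangular P) (v : S → ℝ) {s : S} {a : A}
    (ha : a ∈ E.acts s) {θ : S → A → S → ℝ} (hθ : θ ∈ E.kernels) :
    E.value v θ s a ≤ E.bellman v s :=
  le_csSup (H.isCompact_values v s).bddAbove ⟨a, ha, θ, hθ, rfl⟩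

theorem IsRectangular.exists_bellman_eq (H : E.IsRectangular P) (v : S → ℝ) (s : S) :
    ∃ a ∈ E.acts s, ∃ θ ∈ E.kernels, E.bellman v s = E.value v θ s a := by
  refine (H.isCompact_values v s).sSup_mem ?_
  obtain ⟨a, ha⟩ := H.nonempty_acts s
  obtain ⟨q, hq⟩ := H.nonempty s a ha
  obtain ⟨θ, hθ, -⟩ := H.exists_kernel hq
  exact ⟨_, a, ha, θ, hθ, rfl⟩

/-- At every state, the truncated operator is at most the value of the greedy action under some
kernel of the family. -/
theorem IsRectangular.truncBellman_le_of_isGreedy (H : E.IsRectangular P) {c : ℝ} {v : S → ℝ}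
    {φ : S → A} (hφ : E.IsGreedy c v φ) (s : S) :
    ∃ θ ∈ E.kernels, E.truncBellman c v s ≤ E.value v θ s (φ s) := by
  classical
  obtain ⟨hacts, hfeas, hinf⟩ := hφ s
  by_cases hF : E.Feasible c v s
  · obtain ⟨θ, hθ, h⟩ := hfeas hF
    exact ⟨θ, hθ, h.le⟩
  obtain ⟨θ, hθ, hmin⟩ := hinf hF
  refine ⟨θ, hθ, ?_⟩
  by_contra! hlt
  refine hF ?_
  obtain ⟨a₂, ha₂, θ₂, hθ₂, hb⟩ := H.exists_bellman_eq v s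
  set x₀ := E.value v θ s (φ s) with hx₀
  set x₁ := E.value v θ₂ s a₂ with hx₁
  have hle : E.truncBellman c v s ≤ x₁ := by rw [← hb]; exact min_le_left _ _
  have hd : 0 < x₁ - x₀ := by linarith
  -- If the truncated value exceeded the minimal value `x₀`, it would lie between `x₀` and the
  -- maximal value `x₁`; attaining it by interpolation with weight `l` contradicts infeasibility.
  set l := (E.truncBellman c v s - x₀) / (x₁ - x₀) with hl
  have hl0 : 0 ≤ l := div_nonneg (by linarith) hd.le
  have hl1 : l ≤ 1 := (div_le_one hd).2 (by linarith)
  have heq : E.truncBellman c v s = (1 - l) * x₀ + l * x₁ := by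
    have : l * (x₁ - x₀) = E.truncBellman c v s - x₀ := div_mul_cancel₀ _ hd.ne'
    linarith
  -- If both extremes use the same action, the kernels are interpolated, by convexity of the rows.
  -- Otherwise the actions are randomised, under one kernel that takes its rows for `a₂` from `θ₂`
  -- and the others from `θ`.
  by_cases ha : a₂ = φ s
  · subst ha
    refine ⟨{φ s}, fun _ => 1, by simpa using hacts, by simp,
      fun s a => (1 - l) • θ s a + l • θ₂ s a, ?_, ?_⟩
    · refine (H.mem_kernels _).2 fun s a ha => ?_
      exact H.convex s a ha ((H.mem_kernels θ).1 hθ s a ha) ((H.mem_kernels θ₂).1 hθ₂ s a ha)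
        (by linarith) hl0 (by ring)
    · rw [heq, hx₀, hx₁]
      simp only [value, Finset.sum_singleton, one_mul, Pi.add_apply, Pi.smul_apply, smul_eq_mul,
        add_mul, Finset.sum_add_distrib, mul_assoc, ← Finset.mul_sum]
      ring
  · refine ⟨{φ s, a₂}, fun a => if a = a₂ then l else 1 - l, ?_, ?_,
      fun s' a' => if a' = a₂ then θ₂ s' a' else θ s' a', ?_, ?_⟩
    · intro a hm
      rw [Finset.mem_insert, Finset.mem_singleton] at hm
      rcases hm with rfl | rfl
      · exact ⟨hacts, by beta_reduce; rw [if_neg (Ne.symm ha)]; linarith⟩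
      · exact ⟨ha₂, by beta_reduce; rw [if_pos rfl]; exact hl0⟩
    · rw [Finset.sum_pair (Ne.symm ha), if_neg (Ne.symm ha), if_pos rfl]; ring
    · refine (H.mem_kernels _).2 fun s' a' ha' => ?_
      by_cases h : a' = a₂
      · rw [if_pos h]; exact (H.mem_kernels θ₂).1 hθ₂ s' a' ha'
      · rw [if_neg h]; exact (H.mem_kernels θ).1 hθ s' a' ha'
    · rw [Finset.sum_pair (Ne.symm ha)]
      beta_reduce
      rw [if_neg (Ne.symm ha), if_pos rfl, heq, hx₀, hx₁]
      simp only [value, if_neg (Ne.symm ha), if_pos]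

theorem le_truncBellman {c : ℝ} (hc : 0 ≤ c) (v : S → ℝ) (s : S) :
    (⨅ s', E.bellman v s') ≤ E.truncBellman c v s :=
  le_min (ciInf_le (Set.finite_range _).bddBelow s) (by linarith)

theorem iter_sub_le {c : ℝ} (hc : 0 ≤ c) (n : ℕ) (s s' : S) :
    E.iter c n s - E.iter c n s' ≤ c := by
  cases n with
  | zero => simpa [iter] using hc
  | succ n =>
    have h1 : E.truncBellman c (E.iter c n) s ≤ (⨅ s', E.bellman (E.iter c n) s') + c :=
      min_le_right _ _
    have h2 := le_truncBellman (E := E) hc (E.iter c n) s'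
    simp only [iter]
    linarith

variable [Nonempty S]

/-- The second summand of the stopping criterion is nonnegative and can be dropped; the normalising
constant of the iterates cancels in the difference. -/
theorem Stops.sub_le {c γ ε : ℝ} {n : ℕ} (h : E.Stops c γ ε n) (hγ0 : 0 ≤ γ) (hγ1 : γ ≤ 1)
    (s s' : S) : (E.truncBellman c (E.iter c n) s - E.iter c n s) -
      (E.truncBellman c (E.iter c n) s' - E.iter c n s') ≤ ε := by
  have h1 := sub_le_span (fun s => E.iter c (n + 1) s - E.iter c n s) s s'
  have h2 : 0 ≤ 2 * γ ^ n / (1 - γ) * span (E.iter c 1) :=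
    mul_nonneg (div_nonneg (by positivity) (by linarith)) (span_nonneg _)
  have h3 : span (fun s => E.iter c (n + 1) s - E.iter c n s)
    + 2 * γ ^ n / (1 - γ) * span (E.iter c 1) ≤ ε := h
  have h4 : ∀ s, E.iter c (n + 1) s =
      E.truncBellman c (E.iter c n) s - ⨅ s', E.truncBellman c (E.iter c n) s' := fun s => rfl
  rw [h4, h4] at h1
  linarith

end ExtMDP

namespace Setting

variable {dS dA : ℕ} {E : Setting dS dA} {ω : SamplePath dS dA} {t : ℕ}

/-! ### Confidence radii -/

variable (E) in
/-- A lower bound of the diameters of the active cells before the horizon. -/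
noncomputable def minDiam : ℝ := (E.budget / E.T) ^ (1 / ((dS : ℝ) + 2))

theorem root_pow (n : ℕ) {x : ℝ} (hx : 0 ≤ x) : (x ^ (n + 2)) ^ (1 / ((n : ℝ) + 2)) = x := by
  have := Real.pow_rpow_inv_natCast hx (n := n + 2) (by omega)
  push_cast at this
  rwa [one_div]

theorem pow_root (n : ℕ) {x : ℝ} (hx : 0 ≤ x) : (x ^ (1 / ((n : ℝ) + 2))) ^ (n + 2) = x := by
  have := Real.rpow_inv_natCast_pow hx (n := n + 2) (by omega)
  push_cast at this
  rwa [one_div]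

theorem T_pos (hE : E.Standing) : (0 : ℝ) < E.T := by
  have := hE.hT
  exact_mod_cast (by omega : 0 < E.T)

theorem minDiam_pos (hE : E.Standing) : 0 < E.minDiam :=
  Real.rpow_pos_of_pos (div_pos (budget_pos hE) (T_pos hE)) _

theorem minDiam_pow (hE : E.Standing) : E.minDiam ^ (dS + 2) = E.budget / E.T :=
  pow_root dS (div_pos (budget_pos hE) (T_pos hE)).le

theorem Ceta_ge (hE : E.Standing) : 3 ≤ E.Ceta := by
  have h1 := hE.hα.2
  have h2 := hE.hLp
  have h3 := hE.hCv
  rw [Ceta]; linarith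

theorem eta_le_two (ζ : Cell dS dA) : E.eta ω t ζ ≤ 2 := by
  rw [eta]; split_ifs
  · exact le_rfl
  · exact min_le_left _ _

theorem budget_div_eq {ζ : Cell dS dA} (hE : E.Standing) :
    E.budget / E.threshold ζ.level = E.cellDiam ζ ^ (dS + 2) := by
  have := (budget_pos hE).ne'
  rw [threshold, cellDiam_eq, ← pow_mul, one_div, inv_pow]
  field_simp

/-- Below the root, the activation count makes the statistical term at most `(4 - α)` times the
diameter. At the root, the diameter is `1` and the cap `2` is less than `Ceta`. -/
theorem eta_le (hE : E.Standing) {ζ : Cell dS dA} (h : E.Active ω t ζ) :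
    E.eta ω t ζ ≤ E.Ceta * E.cellDiam ζ := by
  by_cases hl : ζ.level = 0
  · have h1 : E.cellDiam ζ = 1 := by rw [cellDiam_eq, hl, pow_zero]
    rw [h1, mul_one]
    linarith [eta_le_two (E := E) (ω := ω) (t := t) ζ, Ceta_ge hE]
  · have h1 := threshold_le_of_active h hl
    have h2 := threshold_pos hE ζ.level
    have h0 : E.visits ω t ζ ≠ 0 := by
      intro h0
      rw [h0] at h1
      simp at h1
      linarith
    rw [eta, if_neg h0]
    refine (min_le_right _ _).trans ?_
    have h3 : (E.c₁ * E.logTδ / (E.visits ω t ζ : ℝ)) ^ (1 / ((dS : ℝ) + 2)) ≤ E.cellDiam ζ := by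
      rw [← root_pow dS (cellDiam_pos (E := E) ζ).le, ← budget_div_eq hE]
      refine Real.rpow_le_rpow (div_nonneg (budget_pos hE).le (by positivity)) ?_ (by positivity)
      exact div_le_div_of_nonneg_left (budget_pos hE).le h2 h1
    have h4 : 0 ≤ 4 - E.α := by linarith [hE.hα.2]
    rw [Ceta]
    nlinarith [mul_le_mul_of_nonneg_left h3 h4]

theorem min_minDiam_le_cellDiam (hE : E.Standing) (ht : t < E.T)
    {ζ : Cell dS dA} (h : E.Active ω t ζ) : min 1 E.minDiam ≤ E.cellDiam ζ := by
  by_cases hl : ζ.level = 0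
  · rw [cellDiam_eq, hl, pow_zero]
    exact min_le_left _ _
  · refine (min_le_right _ _).trans ?_
    have h1 := threshold_le_of_active h hl
    have h2 := threshold_pos hE ζ.level
    have h3 : (E.visits ω t ζ : ℝ) ≤ E.T := by exact_mod_cast (visits_le t ζ).trans ht.le
    rw [← root_pow dS (cellDiam_pos (E := E) ζ).le, ← budget_div_eq hE]
    refine Real.rpow_le_rpow (div_pos (budget_pos hE) (T_pos hE)).le ?_ (by positivity)
    exact div_le_div_of_nonneg_left (budget_pos hE).le h2 (h1.trans h3)

/-- Fewer than `T` visits bound the statistical term below by `(4 - α) * minDiam`, and the diameter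
is at least `minDiam`; the coefficients add up to `Ceta`. The value `2` is kept apart because the
confidence constraint is then vacuous. -/
theorem eta_eq_two_or_le (hE : E.Standing) (hx : E.minDiam ≤ 1) (ht : t < E.T)
    {ζ : Cell dS dA} (h : E.Active ω t ζ) :
    E.eta ω t ζ = 2 ∨ E.Ceta * E.minDiam ≤ E.eta ω t ζ := by
  by_cases h0 : E.visits ω t ζ = 0
  · exact Or.inl (by rw [eta, if_pos h0])
  have h3 : (E.visits ω t ζ : ℝ) ≤ E.T := by exact_mod_cast (visits_le t ζ).trans ht.le
  have h4 : (0 : ℝ) < E.visits ω t ζ := by exact_mod_cast Nat.pos_of_ne_zero h0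
  have h5 : E.minDiam ≤ (E.c₁ * E.logTδ / (E.visits ω t ζ : ℝ)) ^ (1 / ((dS : ℝ) + 2)) :=
    Real.rpow_le_rpow (div_pos (budget_pos hE) (T_pos hE)).le
      (div_le_div_of_nonneg_left (budget_pos hE).le h4 h3) (by positivity)
  have h6 := min_minDiam_le_cellDiam hE ht h
  rw [min_eq_right hx] at h6
  have h7 : 0 ≤ 4 - E.α := by linarith [hE.hα.2]
  have h8 : 0 ≤ 3 * E.Lp + E.Cv := by linarith [hE.hLp, hE.hCv]
  have h9 := add_le_add (mul_le_mul_of_nonneg_left h5 h7) (mul_le_mul_of_nonneg_left h6 h8)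
  rw [eta, if_neg h0]
  rcases le_total 2 ((4 - E.α) * (E.c₁ * E.logTδ / (E.visits ω t ζ : ℝ)) ^ (1 / ((dS : ℝ) + 2))
      + (3 * E.Lp + E.Cv) * E.cellDiam ζ) with h10 | h10
  · exact Or.inl (min_eq_left h10)
  · right
    rw [min_eq_right h10, Ceta]
    linarith

/-! ### The extended MDP -/

instance : Nonempty (E.DState ω t) := ⟨boxIdx _ fun _ => 0⟩

variable (E ω t) in
/-- The admissible rows of the kernels of the extended MDP. -/
def rows (ξ : E.DState ω t) (a : Cube dA) : Set (E.DState ω t → ℝ) :=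
  {q | (∀ ξ', 0 ≤ q ξ') ∧ ∑ ξ', q ξ' = 1 ∧
    (∀ ζ, E.Active ω t ζ → (E.pt ω t ξ, a) ∈ ζ.toSet →
      ∑ ξ', |q ξ' - E.wpHat ω t ζ ξ'| ≤ E.eta ω t ζ) ∧
    ∀ ξ', (1 - E.α) / ((Fintype.card (E.DState ω t) : ℝ) * E.T) ≤ q ξ'}

theorem isCompact_rows (ξ : E.DState ω t) (a : Cube dA) : IsCompact (E.rows ω t ξ a) := by
  refine (isCompact_Icc (a := (0 : E.DState ω t → ℝ)) (b := 1)).of_isClosed_subset ?_ ?_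
  · have heq : E.rows ω t ξ a = (⋂ ξ', {q | 0 ≤ q ξ'}) ∩ ({q | ∑ ξ', q ξ' = 1} ∩
        ((⋂ ζ, ⋂ (_ : E.Active ω t ζ), ⋂ (_ : (E.pt ω t ξ, a) ∈ ζ.toSet),
          {q | ∑ ξ', |q ξ' - E.wpHat ω t ζ ξ'| ≤ E.eta ω t ζ}) ∩
        ⋂ ξ', {q | (1 - E.α) / ((Fintype.card (E.DState ω t) : ℝ) * E.T) ≤ q ξ'})) := by
      ext q
      simp only [rows, Set.mem_ofPred_eq, Set.mem_inter_iff, Set.mem_iInter]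
    rw [heq]
    refine (isClosed_iInter fun ξ' => isClosed_le (by fun_prop) (by fun_prop)).inter
      (IsClosed.inter (isClosed_eq (by fun_prop) (by fun_prop))
        (IsClosed.inter (isClosed_iInter fun ζ => isClosed_iInter fun _ => isClosed_iInter fun _ =>
          isClosed_le (by fun_prop) (by fun_prop))
          (isClosed_iInter fun ξ' => isClosed_le (by fun_prop) (by fun_prop))))
  · intro q hq
    refine ⟨hq.1, fun ξ' => ?_⟩
    rw [Pi.one_apply, ← hq.2.1]
    exact Finset.single_le_sum (fun ξ' _ => hq.1 ξ') (Finset.mem_univ ξ')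

theorem convex_rows (ξ : E.DState ω t) (a : Cube dA) : Convex ℝ (E.rows ω t ξ a) := by
  intro q hq q' hq' b b' hb hb' hbb
  refine ⟨fun ξ' => ?_, ?_, fun ζ hζ hm => ?_, fun ξ' => ?_⟩
  · exact add_nonneg (mul_nonneg hb (hq.1 ξ')) (mul_nonneg hb' (hq'.1 ξ'))
  · simp only [Pi.add_apply, Pi.smul_apply, smul_eq_mul, Finset.sum_add_distrib, ← Finset.mul_sum,
      hq.2.1, hq'.2.1, mul_one, hbb]
  · calc ∑ ξ', |(b • q + b' • q') ξ' - E.wpHat ω t ζ ξ'|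
        ≤ ∑ ξ', (b * |q ξ' - E.wpHat ω t ζ ξ'| + b' * |q' ξ' - E.wpHat ω t ζ ξ'|) := by
          refine Finset.sum_le_sum fun ξ' _ => ?_
          rw [← abs_of_nonneg hb, ← abs_of_nonneg hb', ← abs_mul, ← abs_mul, abs_of_nonneg hb,
            abs_of_nonneg hb']
          refine le_trans (le_of_eq ?_) (abs_add_le _ _)
          simp only [Pi.add_apply, Pi.smul_apply, smul_eq_mul]
          congr 1
          linear_combination (E.wpHat ω t ζ ξ') * hbb
      _ ≤ b * E.eta ω t ζ + b' * E.eta ω t ζ := by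
          rw [Finset.sum_add_distrib, ← Finset.mul_sum, ← Finset.mul_sum]
          exact add_le_add (mul_le_mul_of_nonneg_left (hq.2.2.1 ζ hζ hm) hb)
            (mul_le_mul_of_nonneg_left (hq'.2.2.1 ζ hζ hm) hb')
      _ = E.eta ω t ζ := by rw [← add_mul, hbb, one_mul]
  · have h1 := mul_le_mul_of_nonneg_left (hq.2.2.2 ξ') hb
    have h2 := mul_le_mul_of_nonneg_left (hq'.2.2.2 ξ') hb'
    have h3 := add_le_add h1 h2
    rw [← add_mul, hbb, one_mul] at h3
    exact h3

/-- A mixture of the true kernel with a point mass and with the uniform distribution, with total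
weight `u + w` of the last two. -/
noncomputable def mixture (E : Setting dS dA) (ω : SamplePath dS dA) (t : ℕ)
    (z : Cube dS × Cube dA) (m : E.DState ω t) (u w : ℝ) (ξ : E.DState ω t) : ℝ :=
  (1 - u - w) * E.wp ω t z ξ + w * (if ξ = m then 1 else 0) + u / Fintype.card (E.DState ω t)

theorem sum_mixture_mul (z : Cube dS × Cube dA) (m : E.DState ω t) (u w : ℝ)
    (v : E.DState ω t → ℝ) : ∑ ξ, E.mixture ω t z m u w ξ * v ξ =
      (1 - u - w) * ∑ ξ, E.wp ω t z ξ * v ξ + w * v m +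
        u / Fintype.card (E.DState ω t) * ∑ ξ, v ξ := by
  simp only [mixture, add_mul, Finset.sum_add_distrib, Finset.mul_sum, mul_assoc]
  simp

theorem sum_mixture (z : Cube dS × Cube dA) (m : E.DState ω t) (u w : ℝ) :
    ∑ ξ, E.mixture ω t z m u w ξ = 1 := by
  have h := sum_mixture_mul (E := E) (ω := ω) (t := t) z m u w fun _ => 1
  have hc : (Fintype.card (E.DState ω t) : ℝ) ≠ 0 := by exact_mod_cast Fintype.card_ne_zero
  simp only [mul_one, sum_wp, Finset.sum_const, Finset.card_univ, nsmul_eq_mul] at h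
  rw [h, div_mul_cancel₀ _ hc]
  ring

/-- Mixing moves the true row by at most `2 * (u + w)`, while `G₁` leaves `(1 - α) / Ceta` of the
radius unused, that is at least `(1 - α) * minDiam`. The uniform part alone supplies the lower bound
on the entries. -/
theorem mixture_mem_rows (hE : E.Standing) (hG : ω ∈ E.G₁) (hx : E.minDiam ≤ 1) (ht : t < E.T)
    {ζ : Cell dS dA} (hζ : E.Active ω t ζ) {z : Cube dS × Cube dA} (hz : z ∈ ζ.toSet)
    {ξ : E.DState ω t} {a : Cube dA} (ha : (E.pt ω t ξ, a) ∈ ζ.toSet) (m : E.DState ω t) {w : ℝ}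
    (hw : 0 ≤ w) (hwx : (1 - E.α) / E.T + w ≤ (1 - E.α) * E.minDiam / 2) :
    E.mixture ω t z m ((1 - E.α) / E.T) w ∈ E.rows ω t ξ a := by
  set u := (1 - E.α) / E.T with hu
  have hA : 0 < 1 - E.α := by linarith [hE.hα.2]
  have hu0 : 0 < u := div_pos hA (T_pos hE)
  have hx0 := minDiam_pos hE
  have hmix : 0 ≤ 1 - u - w := by nlinarith [hE.hα.1]
  have hc : (0 : ℝ) < Fintype.card (E.DState ω t) := by exact_mod_cast Fintype.card_pos
  have hi : ∀ ξ', 0 ≤ w * (if ξ' = m then (1 : ℝ) else 0) := fun ξ' =>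
    mul_nonneg hw (by split_ifs <;> norm_num)
  have hlow : ∀ ξ', u / Fintype.card (E.DState ω t) ≤ E.mixture ω t z m u w ξ' := fun ξ' => by
    have h1 := mul_nonneg hmix (wp_nonneg (ω := ω) t z ξ')
    have h2 := hi ξ'
    rw [mixture]
    linarith
  have hnn : ∀ ξ', 0 ≤ E.mixture ω t z m u w ξ' := fun ξ' =>
    (div_pos hu0 hc).le.trans (hlow ξ')
  refine ⟨hnn, sum_mixture z m u w, fun ζ' hζ' hm => ?_, fun ξ' => ?_⟩
  · obtain rfl := active_unique hE hζ hζ' ha hm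
    rcases eta_eq_two_or_le hE hx ht hζ with h2 | hη
    · rw [h2]
      calc ∑ ξ', |E.mixture ω t z m u w ξ' - E.wpHat ω t ζ ξ'|
          ≤ ∑ ξ', (E.mixture ω t z m u w ξ' + E.wpHat ω t ζ ξ') :=
            Finset.sum_le_sum fun ξ' _ => by
              have h1 := hnn ξ'
              have h2 := wpHat_nonneg (E := E) (ω := ω) t ζ ξ'
              rw [abs_le]; constructor <;> linarith
        _ ≤ 2 := by
            rw [Finset.sum_add_distrib, sum_mixture]
            linarith [sum_wpHat_le_one (E := E) (ω := ω) t ζ]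
    · have hd : ∑ ξ', |E.mixture ω t z m u w ξ' - E.wp ω t z ξ'| ≤ 2 * (u + w) := by
        calc ∑ ξ', |E.mixture ω t z m u w ξ' - E.wp ω t z ξ'|
            ≤ ∑ ξ', (E.mixture ω t z m u w ξ' - (1 - u - w) * E.wp ω t z ξ' +
                (u + w) * E.wp ω t z ξ') := Finset.sum_le_sum fun ξ' _ => by
              have h1 := hi ξ'
              have h2 := wp_nonneg (E := E) (ω := ω) t z ξ'
              have h3 : 0 ≤ u / Fintype.card (E.DState ω t) := (div_pos hu0 hc).le
              have h4 : 0 ≤ (u + w) * E.wp ω t z ξ' := mul_nonneg (by linarith) h2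
              rw [mixture, abs_le]
              constructor <;> linarith
          _ = 2 * (u + w) := by
              rw [Finset.sum_add_distrib, Finset.sum_sub_distrib, ← Finset.mul_sum,
                ← Finset.mul_sum, sum_mixture, sum_wp]
              ring
      have hg := hG t ht ζ hζ z hz
      have hC : 0 < E.Ceta := by linarith [Ceta_ge hE]
      have h5 : (1 - E.α) * E.minDiam ≤ (1 - E.α) / E.Ceta * E.eta ω t ζ := by
        rw [div_mul_eq_mul_div, le_div_iff₀ hC]
        nlinarith
      calc ∑ ξ', |E.mixture ω t z m u w ξ' - E.wpHat ω t ζ ξ'|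
          ≤ ∑ ξ', (|E.mixture ω t z m u w ξ' - E.wp ω t z ξ'| +
              |E.wp ω t z ξ' - E.wpHat ω t ζ ξ'|) :=
            Finset.sum_le_sum fun ξ' _ => abs_sub_le _ _ _
        _ ≤ E.eta ω t ζ := by
            rw [Finset.sum_add_distrib]
            linarith
  · refine le_trans (le_of_eq ?_) (hlow ξ')
    rw [hu, div_div, mul_comm]

theorem isRectangular_extMDP (hE : E.Standing) (hG : ω ∈ E.G₁) (hx : E.minDiam ≤ 1)
    (hxT : 1 / E.T ≤ E.minDiam / 2) (ht : t < E.T) :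
    (E.extMDP ω t).IsRectangular (E.rows ω t) where
  mem_kernels θ := by
    constructor
    · rintro ⟨h1, h2⟩ ξ a ha
      obtain ⟨h3, h4, h5⟩ := h1 ξ a ha
      exact ⟨h3, h4, h5, h2 ξ a ha⟩
    · intro h
      exact ⟨fun ξ a ha => ⟨(h ξ a ha).1, (h ξ a ha).2.1, (h ξ a ha).2.2.1⟩,
        fun ξ a ha => (h ξ a ha).2.2.2⟩
  finite_acts ξ := finite_dActs hE t ξ
  nonempty_acts ξ := by
    obtain ⟨h1, h2⟩ := activeCell_spec (ω := ω) hE t (E.pt ω t ξ, fun _ => 0)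
    obtain ⟨a, ha, -⟩ := exists_dActs_of_active hE h1 h2
    refine ⟨a, ?_⟩
    change a ∈ E.dActs ω t ξ
    rwa [boxIdx_pt] at ha
  isCompact ξ a _ := isCompact_rows ξ a
  convex ξ a _ := convex_rows ξ a
  nonempty ξ a ha := by
    obtain ⟨ζ, hζ, hm⟩ := mem_dActs ha
    refine ⟨_, mixture_mem_rows hE hG hx ht hζ hm hm ξ le_rfl ?_⟩
    have hA : 0 < 1 - E.α := by linarith [hE.hα.2]
    rw [add_zero, div_eq_mul_one_div, mul_div_assoc]
    exact mul_le_mul_of_nonneg_left hxT hA.le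

theorem le_dRew (hE : E.Standing) {ζ : Cell dS dA} (hζ : E.Active ω t ζ)
    {z : Cube dS × Cube dA} (hz : z ∈ ζ.toSet) {ξ : E.DState ω t} {a : Cube dA}
    (ha : (E.pt ω t ξ, a) ∈ ζ.toSet) :
    E.M.r z ≤ E.dRew ω t ξ a ∧ E.dRew ω t ξ a ≤ E.M.r z + 2 * E.Lr * E.cellDiam ζ := by
  rw [dRew, activeCell_eq hE hζ ha]
  have h1 := abs_le.1 (hE.lip_r (E.rep.q ζ) z)
  have h2 := mul_le_mul_of_nonneg_left
    (E.met.isMetric.le_diam (E.rep.q_mem ζ) hz) hE.hLr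
  change E.Lr * E.met.ρ (E.rep.q ζ) z ≤ E.Lr * E.cellDiam ζ at h2
  constructor <;> linarith [h1.1, h1.2]

/-- Equal masses allow `v` to be centred at its midrange, which gives the factor `1 / 2`. -/
theorem sum_mul_sub_le {S : Type} [Fintype S] {p q v : S → ℝ} (hpq : ∑ s, p s = ∑ s, q s) :
    ∑ s, p s * v s - ∑ s, q s * v s ≤ span v / 2 * ∑ s, |p s - q s| := by
  set b := (⨅ s, v s) + span v / 2 with hb
  have h1 : ∑ s, p s * v s - ∑ s, q s * v s = ∑ s, (p s - q s) * (v s - b) := by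
    simp only [sub_mul, mul_sub, Finset.sum_sub_distrib, ← Finset.sum_mul, hpq]
    ring
  rw [h1, Finset.mul_sum]
  refine Finset.sum_le_sum fun s _ => ?_
  have h2 : |v s - b| ≤ span v / 2 := by
    have h3 := ciInf_le (Set.finite_range v).bddBelow s
    have h4 := le_ciSup (Set.finite_range v).bddAbove s
    rw [abs_le, hb, span]
    constructor <;> linarith
  calc (p s - q s) * (v s - b) ≤ |p s - q s| * |v s - b| := by
        rw [← abs_mul]; exact le_abs_self _
    _ ≤ |p s - q s| * (span v / 2) := mul_le_mul_of_nonneg_left h2 (abs_nonneg _)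
    _ = _ := mul_comm _ _

/-- The value of an action in the extended MDP exceeds the true value by at most a multiple of
the diameter of the active cell. -/
theorem value_le (hE : E.Standing) (hG : ω ∈ E.G₁) (ht : t < E.T)
    {ζ : Cell dS dA} (hζ : E.Active ω t ζ) {z : Cube dS × Cube dA} (hz : z ∈ ζ.toSet)
    {ξ : E.DState ω t} {a : Cube dA} (ha : (E.pt ω t ξ, a) ∈ ζ.toSet)
    {θ : E.DState ω t → Cube dA → E.DState ω t → ℝ} (hθ : θ ξ a ∈ E.rows ω t ξ a)
    (v : E.DState ω t → ℝ) :
    (E.extMDP ω t).value v θ ξ a ≤ E.M.r z + ∑ ξ', E.wp ω t z ξ' * v ξ' +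
      (2 * E.Lr + (E.Ceta - (1 - E.α) / 2) * span v) * E.cellDiam ζ := by
  have hC : 0 < E.Ceta := by linarith [Ceta_ge hE]
  have hA : 0 < 1 - E.α := by linarith [hE.hα.2]
  have h1 := (le_dRew hE hζ hz ha).2
  have h2 := sum_mul_sub_le (p := θ ξ a) (q := E.wp ω t z) (v := v)
    (by rw [hθ.2.1, sum_wp])
  have hg := hG t ht ζ hζ z hz
  have h3 := hθ.2.2.1 ζ hζ ha
  -- The confidence radius and the smaller radius of `G₁` add up to `(2 - (1 - α) / Ceta) * eta`.
  have h4 : ∑ ξ', |θ ξ a ξ' - E.wp ω t z ξ'| ≤ (2 * E.Ceta - (1 - E.α)) * E.cellDiam ζ := by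
    have h5 : ∑ ξ', |θ ξ a ξ' - E.wp ω t z ξ'| ≤ ∑ ξ', (|θ ξ a ξ' - E.wpHat ω t ζ ξ'| +
        |E.wp ω t z ξ' - E.wpHat ω t ζ ξ'|) := Finset.sum_le_sum fun ξ' _ => by
      rw [abs_sub_comm (E.wp ω t z ξ')]; exact abs_sub_le _ _ _
    rw [Finset.sum_add_distrib] at h5
    have h6 := eta_le hE hζ
    have h7 : (1 - E.α) / E.Ceta ≤ 1 := by
      rw [div_le_one hC]; linarith [Ceta_ge hE, hE.hα.1]
    have h8 := mul_le_mul_of_nonneg_left h6 (by linarith : 0 ≤ 2 - (1 - E.α) / E.Ceta)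
    have h9 : (2 - (1 - E.α) / E.Ceta) * (E.Ceta * E.cellDiam ζ) =
        (2 * E.Ceta - (1 - E.α)) * E.cellDiam ζ := by field_simp
    linarith
  have h10 := mul_le_mul_of_nonneg_left h4
    (by linarith [span_nonneg v] : 0 ≤ span v / 2)
  rw [ExtMDP.value]
  change E.dRew ω t ξ a + _ ≤ _
  linarith

end Setting

namespace Setting

variable {dS dA : ℕ} {E : Setting dS dA} {ω : SamplePath dS dA} {t : ℕ}

/-! ### Policies that are constant on the finest state cells -/

section Policy

variable {φ : Cube dS → Cube dA} {φd : E.DState ω t → Cube dA}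
  (hφ : ∀ ξ, ∀ s ∈ box (E.maxLevel ω t) ξ, φ s = φd ξ)
include hφ

theorem policy_eq (s : Cube dS) : φ s = φd (boxIdx (E.maxLevel ω t) s) :=
  hφ _ s (mem_box_boxIdx _ s)

theorem measurable_policy : Measurable φ := by
  have : φ = fun s => φd (boxIdx (E.maxLevel ω t) s) := funext (policy_eq hφ)
  rw [this]
  exact measurable_comp_boxIdx _ φd

theorem activeCell_policy (hE : E.Standing) (s : Cube dS) :
    E.activeCell ω t (s, φ s) = E.activeCell ω t
      (E.pt ω t (boxIdx (E.maxLevel ω t) s), φd (boxIdx (E.maxLevel ω t) s)) := by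
  rw [activeCell_pt hE, policy_eq hφ]

theorem measurable_cellDiam_policy (hE : E.Standing) :
    Measurable fun s => E.cellDiam (E.activeCell ω t (s, φ s)) := by
  simp_rw [activeCell_policy hφ hE]
  exact measurable_comp_boxIdx _ fun ξ => E.cellDiam (E.activeCell ω t (E.pt ω t ξ, φd ξ))

theorem integrable_cellDiam_policy (hE : E.Standing) (μ : Measure (Cube dS)) [IsFiniteMeasure μ] :
    Integrable (fun s => E.cellDiam (E.activeCell ω t (s, φ s))) μ :=
  integrable_of_mem_Icc (measurable_cellDiam_policy hφ hE)
    fun _ => ⟨(cellDiam_pos _).le, cellDiam_le_one _⟩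

/-- The growth of the iterates of `ScOpt` is bounded by the reward of the greedy policy under its
stationary measure, up to a multiple of the diameter of the policy. -/
theorem le_integral_reward (hE : E.Standing) (hG : ω ∈ E.G₁) (ht : t < E.T)
    (hR : (E.extMDP ω t).IsRectangular (E.rows ω t)) {c : ℝ} {v : E.DState ω t → ℝ}
    (hgr : (E.extMDP ω t).IsGreedy c v φd) {lo : ℝ}
    (hlo : ∀ ξ, lo ≤ (E.extMDP ω t).truncBellman c v ξ - v ξ) :
    lo ≤ ∫ s, E.M.r (s, φ s) ∂(E.M.statMeasure φ) +
      (2 * E.Lr + (E.Ceta - (1 - E.α) / 2) * span v) * E.policyDiam ω t φ := by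
  have hm := measurable_policy hφ
  obtain ⟨hp, hinv⟩ := MDP.statMeasure_spec hE.hα hE.ergodic hm
  set μ := E.M.statMeasure φ with hμ
  set V : Cube dS → ℝ := fun s => v (boxIdx (E.maxLevel ω t) s) with hV
  have hVm : Measurable V := measurable_comp_boxIdx _ v
  have hVb : ∀ s, V s ∈ Set.Icc (⨅ ξ, v ξ) (⨆ ξ, v ξ) := fun s =>
    ⟨ciInf_le (Set.finite_range v).bddBelow _, le_ciSup (Set.finite_range v).bddAbove _⟩
  set b := 2 * E.Lr + (E.Ceta - (1 - E.α) / 2) * span v with hb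
  -- The bracket has mean zero under the invariant measure, so only reward and diameter survive
  -- integration.
  have hpt : ∀ s, lo ≤ E.M.r (s, φ s) + (∫ s', V s' ∂(E.M.p (s, φ s)) - V s) +
      b * E.cellDiam (E.activeCell ω t (s, φ s)) := by
    intro s
    set ξ := boxIdx (E.maxLevel ω t) s with hξ
    obtain ⟨θ, hθ, hle⟩ := hR.truncBellman_le_of_isGreedy hgr ξ
    have hcell := activeCell_policy hφ hE s
    obtain ⟨hζ, hz⟩ := activeCell_spec (ω := ω) hE t (s, φ s)
    have ha : (E.pt ω t ξ, φd ξ) ∈ (E.activeCell ω t (s, φ s)).toSet := by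
      rw [hcell]; exact (activeCell_spec hE t _).2
    have h1 := value_le hE hG ht hζ hz ha
      ((hR.mem_kernels θ).1 hθ ξ (φd ξ) (hgr ξ).1) v
    have h2 := integral_comp_boxIdx (E.maxLevel ω t) (E.M.p (s, φ s)) v
    have h3 := hlo ξ
    have h4 : V s = v ξ := rfl
    rw [← hb] at h1
    rw [h4]
    change ∫ s', V s' ∂(E.M.p (s, φ s)) = ∑ ξ', E.wp ω t (s, φ s) ξ' * v ξ' at h2
    rw [h2]
    linarith
  have hir : Integrable (fun s => E.M.r (s, φ s)) μ :=
    integrable_of_mem_Icc (E.M.measurable_r.comp (measurable_id.prodMk hm)) fun s => E.M.r_mem _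
  have hiV : Integrable V μ := integrable_of_mem_Icc hVm hVb
  have hiPV : Integrable (fun s => ∫ s', V s' ∂(E.M.p (s, φ s))) μ :=
    integrable_of_mem_Icc ((MDP.measurable_integral_p hVm).comp (measurable_id.prodMk hm))
      fun s => MDP.integral_p_mem hVm hVb _
  have hid : Integrable (fun s => b * E.cellDiam (E.activeCell ω t (s, φ s))) μ :=
    (integrable_cellDiam_policy hφ hE μ).const_mul b
  have h5 := integral_mono (μ := μ) (integrable_const lo) ((hir.add (hiPV.sub hiV)).add hid) hpt
  have h6 : ∫ s, V s ∂μ = ∫ s, ∫ s', V s' ∂(E.M.p (s, φ s)) ∂μ := by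
    conv_lhs => rw [← hinv]
    exact MDP.integral_step hm μ hVm hVb
  have h7 : ∫ s, ((fun s => E.M.r (s, φ s)) + ((fun s => ∫ s', V s' ∂(E.M.p (s, φ s))) - V) +
      fun s => b * E.cellDiam (E.activeCell ω t (s, φ s))) s ∂μ =
      ∫ s, E.M.r (s, φ s) ∂μ + b * E.policyDiam ω t φ := by
    rw [integral_add' (hir.add (hiPV.sub hiV)) hid, integral_add' hir (hiPV.sub hiV),
      integral_sub' hiPV hiV, ← h6, sub_self, add_zero, integral_const_mul]
    rfl
  rw [h7] at h5
  simpa using h5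

end Policy

/-! ### Optimism -/

/-- The factor `1 - 1 / T` in the denominator of the span bound leaves a margin over the span of `h`
that exceeds the accuracy `1 / T`; this keeps truncation inactive where optimism is tested. -/
theorem one_div_add_lt_spanBound (hE : E.Standing) :
    1 / (1 - E.α) + 1 / E.T < E.spanBound := by
  have hA : 0 < 1 - E.α := by linarith [hE.hα.2]
  have hA1 : 1 - E.α < 1 := by linarith [hE.hα.1]
  have hT : (2 : ℝ) ≤ E.T := by exact_mod_cast hE.hT
  have hT0 : (0 : ℝ) < E.T := by linarith
  have h1 : 0 < 1 - 1 / (E.T : ℝ) := by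
    rw [sub_pos, div_lt_one hT0]; linarith
  rw [spanBound, lt_div_iff₀ (mul_pos hA h1)]
  have h2 : (1 / (1 - E.α) + 1 / (E.T : ℝ)) * ((1 - E.α) * (1 - 1 / E.T)) =
      (1 + (1 - E.α) / E.T) * (1 - 1 / E.T) := by field_simp
  rw [h2]
  have h3 : 0 < 1 / (E.T : ℝ) := by positivity
  have h4 : (1 - E.α) / E.T < 1 / E.T := (div_lt_div_iff_of_pos_right hT0).2 hA1
  nlinarith [hE.hLr]

theorem spanBound_nonneg (hE : E.Standing) : 0 ≤ E.spanBound := by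
  have hA : 0 < 1 - E.α := by linarith [hE.hα.2]
  have := one_div_add_lt_spanBound hE
  have := T_pos hE
  have h1 : 0 < 1 / (1 - E.α) := by positivity
  have h2 : 0 < 1 / (E.T : ℝ) := by positivity
  linarith

/-- The growth of the iterates of `ScOpt` is at least the optimal average reward, up to an error
that decreases with the span of the iterate. -/
theorem optAvgReward_le (hE : E.Standing) (hG : ω ∈ E.G₁) (hx : E.minDiam ≤ 1) (ht : t < E.T)
    (hR : (E.extMDP ω t).IsRectangular (E.rows ω t)) (s₀ : Cube dS) {v : E.DState ω t → ℝ}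
    {lo hi : ℝ} (hlo : ∀ ξ, lo ≤ (E.extMDP ω t).truncBellman E.spanBound v ξ - v ξ)
    (hhi : ∀ ξ, (E.extMDP ω t).truncBellman E.spanBound v ξ - v ξ ≤ hi) (hlh : hi - lo ≤ 1 / E.T)
    {κ : ℝ} (hκ0 : 0 ≤ κ) (hκ : κ ≤ E.minDiam / 2 - 1 / E.T) :
    E.M.optAvgReward s₀ + κ * ((1 - E.α) * span v - 1) - 1 / E.T ≤ hi := by
  have hA : 0 < 1 - E.α := by linarith [hE.hα.2]
  have hT := T_pos hE
  obtain H := MDP.solvesAROE_relValue hE.lip_r hE.lip_p hE.hα hE.ergodic s₀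
  set J := E.M.optAvgReward s₀
  set h := E.M.relValue s₀
  have hspan := H.sub_le hE.hα hE.ergodic
  obtain ⟨C, hC⟩ := H.bounded
  set ℓ := E.maxLevel ω t with hℓ
  set X := E.extMDP ω t with hX
  have hbdd : ∀ ξ : E.DState ω t, BddAbove (h '' box ℓ ξ) := fun ξ =>
    ⟨C, by rintro _ ⟨s, -, rfl⟩; exact (abs_le.1 (hC s)).2⟩
  have hne : ∀ ξ : E.DState ω t, (h '' box ℓ ξ).Nonempty := fun ξ =>
    ⟨_, E.pt ω t ξ, E.rep.qS_mem _ _, rfl⟩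
  -- The supremum over the cell dominates `h`, so discretising can only raise its integral, and the
  -- bound on the span is kept.
  set hd : E.DState ω t → ℝ := fun ξ => sSup (h '' box ℓ ξ) with hhd
  have hle : ∀ s, h s ≤ hd (boxIdx ℓ s) := fun s =>
    le_csSup (hbdd _) ⟨s, mem_box_boxIdx ℓ s, rfl⟩
  have hdspan : ∀ ξ ξ', hd ξ - hd ξ' ≤ 1 / (1 - E.α) := by
    intro ξ ξ'
    rw [sub_le_iff_le_add]
    refine csSup_le (hne ξ) ?_
    rintro _ ⟨s, -, rfl⟩
    have h1 := hspan s (E.pt ω t ξ')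
    have h2 := hle (E.pt ω t ξ')
    rw [boxIdx_pt] at h2
    linarith
  obtain ⟨ξ₀, hξ₀⟩ := Finite.exists_max fun ξ => hd ξ - v ξ
  obtain ⟨ξ₁, hξ₁⟩ := Finite.exists_min v
  obtain ⟨m, hm⟩ := Finite.exists_max v
  have hσ : span v = v m - v ξ₁ := by
    refine le_antisymm (span_le fun ξ ξ' => ?_) (sub_le_span v m ξ₁)
    linarith [hm ξ, hξ₁ ξ']
  have htrunc : X.bellman v ξ₀ ≤ hi + v ξ₀ := by
    have h1 := hhi ξ₀
    rcases min_choice (X.bellman v ξ₀) ((⨅ s', X.bellman v s') + E.spanBound) with h2 | h2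
    · rw [ExtMDP.truncBellman, h2] at h1
      linarith
    -- Active truncation would give `spanBound ≤ hi - lo + v ξ₀ - v ξ₁`, while the choice of `ξ₀`
    -- bounds `v ξ₀ - v ξ₁` by `hd ξ₀ - hd ξ₁ ≤ 1 / (1 - α)`.
    · exfalso
      rw [ExtMDP.truncBellman, h2] at h1
      obtain ⟨ξ₂, hξ₂⟩ := exists_eq_ciInf_of_finite (f := X.bellman v)
      have h3 := hlo ξ₂
      have h4 : X.truncBellman E.spanBound v ξ₂ ≤ X.bellman v ξ₂ := min_le_left _ _
      have h5 := hξ₁ ξ₂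
      have h6 := hξ₀ ξ₁
      have h7 := hdspan ξ₀ ξ₁
      have h8 := one_div_add_lt_spanBound hE
      rw [hX] at h4
      linarith
  set u := (1 - E.α) / E.T with hu
  -- The weight of the point mass at the maximiser `m` of `v`, the source of the bonus.
  set w := (1 - E.α) * κ with hw
  have hw0 : 0 ≤ w := mul_nonneg hA.le hκ0
  have huw : u + w = (1 - E.α) * (1 / E.T + κ) := by rw [hu, hw]; ring
  have hwx : u + w ≤ (1 - E.α) * E.minDiam / 2 := by
    rw [huw, mul_div_assoc]
    exact mul_le_mul_of_nonneg_left (by linarith) hA.le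
  have huw1 : u + w ≤ 1 := by
    have := minDiam_pos hE
    nlinarith [hE.hα.1]
  have hu0 : 0 ≤ u := (div_pos hA hT).le
  refine le_of_forall_pos_le_add fun ε hε => ?_
  obtain ⟨_, ⟨s, hs, rfl⟩, hsε⟩ := exists_lt_of_lt_csSup (hne ξ₀)
    (show hd ξ₀ - ε < sSup (h '' box ℓ ξ₀) from sub_lt_self _ hε)
  have hsξ : boxIdx ℓ s = ξ₀ := (mem_box_iff _ _ _).1 hs
  obtain ⟨a, ha⟩ := (H.eqn s).1
  simp only at ha
  obtain ⟨hζ, hz⟩ := activeCell_spec (ω := ω) hE t (s, a)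
  set ζ := E.activeCell ω t (s, a) with hζd
  obtain ⟨b, hb, hbζ⟩ := exists_dActs_of_active hE hζ hz
  change b ∈ E.dActs ω t (boxIdx ℓ s) at hb
  change (E.pt ω t (boxIdx ℓ s), b) ∈ ζ.toSet at hbζ
  rw [hsξ] at hb hbζ
  have hq := mixture_mem_rows hE hG hx ht hζ hz hbζ m hw0 hwx
  obtain ⟨θ, hθ, hθq⟩ := hR.exists_kernel hq
  have h1 : X.value v θ ξ₀ b ≤ X.bellman v ξ₀ := hR.value_le_bellman v hb hθ
  have h2 := (le_dRew hE hζ hz hbζ).1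
  have h3 : X.value v θ ξ₀ b = E.dRew ω t ξ₀ b +
      ∑ ξ, E.mixture ω t (s, a) m u w ξ * v ξ := by
    rw [ExtMDP.value, hθq]; rfl
  rw [sum_mixture_mul] at h3
  have hP : ∀ g : E.DState ω t → ℝ, ∑ ξ, E.wp ω t (s, a) ξ * g ξ =
      ∫ s', g (boxIdx ℓ s') ∂(E.M.p (s, a)) := fun g => (integral_comp_boxIdx ℓ _ g).symm
  have h4 : ∫ s', h s' ∂(E.M.p (s, a)) ≤ ∑ ξ, E.wp ω t (s, a) ξ * hd ξ := by
    rw [hP]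
    refine integral_mono (integrable_of_mem_Icc H.measurable fun s => abs_le.1 (hC s)) ?_ hle
    exact integrable_of_mem_Icc (measurable_comp_boxIdx ℓ hd) fun s =>
      ⟨ciInf_le (Set.finite_range hd).bddBelow _, le_ciSup (Set.finite_range hd).bddAbove _⟩
  set P : (E.DState ω t → ℝ) → ℝ := fun g => ∑ ξ, E.wp ω t (s, a) ξ * g ξ with hPd
  have hPc : ∀ c : ℝ, P (fun _ => c) = c := fun c => by
    rw [hPd]; simp only [← Finset.sum_mul, sum_wp, one_mul]
  have hPmono : ∀ g g' : E.DState ω t → ℝ, (∀ ξ, g ξ ≤ g' ξ) → P g ≤ P g' := fun g g' hg =>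
    Finset.sum_le_sum fun ξ _ => mul_le_mul_of_nonneg_left (hg ξ) (wp_nonneg t _ ξ)
  have hPsub : ∀ g g' : E.DState ω t → ℝ, P (fun ξ => g ξ - g' ξ) = P g - P g' := fun g g' => by
    rw [hPd]; simp only [mul_sub, Finset.sum_sub_distrib]
  have h5 : P hd - P v ≤ hd ξ₀ - v ξ₀ := by
    rw [← hPsub, ← hPc (hd ξ₀ - v ξ₀)]
    exact hPmono _ _ hξ₀
  have h6 : P hd ≤ hd ξ₁ + 1 / (1 - E.α) := by
    rw [← hPc (hd ξ₁ + 1 / (1 - E.α))]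
    exact hPmono _ _ fun ξ => by linarith [hdspan ξ ξ₁]
  have h7 := hξ₀ ξ₁
  have hc : (0 : ℝ) < Fintype.card (E.DState ω t) := by exact_mod_cast Fintype.card_pos
  have h8 : u * v ξ₁ ≤ u / Fintype.card (E.DState ω t) * ∑ ξ, v ξ := by
    have : (Fintype.card (E.DState ω t) : ℝ) * v ξ₁ ≤ ∑ ξ, v ξ := by
      rw [← nsmul_eq_mul, ← Finset.card_univ]
      exact Finset.card_nsmul_le_sum _ _ _ fun ξ _ => hξ₁ ξ
    calc u * v ξ₁ = u / Fintype.card (E.DState ω t) * (Fintype.card (E.DState ω t) * v ξ₁) := by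
          field_simp
      _ ≤ _ := mul_le_mul_of_nonneg_left this (div_nonneg hu0 hc.le)
  have h9 : (u + w) * (1 / (1 - E.α)) = 1 / E.T + κ := by rw [huw]; field_simp
  have h10 : w * span v = κ * ((1 - E.α) * span v) := by rw [hw]; ring
  have h11 : (1 - u - w) * P v + w * v m + u * v ξ₁ =
      P v - (u + w) * (P v - v ξ₁) + w * span v := by rw [hσ]; ring
  change _ = E.dRew ω t ξ₀ b + ((1 - u - w) * P v + w * v m +
    u / Fintype.card (E.DState ω t) * ∑ ξ, v ξ) at h3
  change _ ≤ P hd at h4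
  -- Mixing loses up to `(u + w) * (P v - v ξ₁)`. If `P v - v ξ₁` exceeds `1 / (1 - α)`, the excess
  -- is repaid by the slack in the maximality of `ξ₀`, since `u + w ≤ 1`.
  have h12 : (u + w) * (P v - v ξ₁) - (hd ξ₀ - v ξ₀ - P hd + P v) ≤
      (u + w) * (1 / (1 - E.α)) := by
    rcases le_total (P v - v ξ₁) (1 / (1 - E.α)) with hcase | hcase
    · have := mul_le_mul_of_nonneg_left hcase (by linarith : 0 ≤ u + w)
      linarith
    · nlinarith
  linarith

end Setting

/-! ### Averaging -/

/-- If `g` is nonnegative with mean at most `C` times the mean `D` of the dyadic function `f`, there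
is a point at which `g ≤ 3 C f`, `f ≥ D / 3`, and whose dyadic cube of side `f` has measure at least
`(D / 3) ^ (n + 1)`. -/
theorem exists_of_integral_le {n : ℕ} (μ : Measure (Cube n)) [IsProbabilityMeasure μ]
    {f g : Cube n → ℝ} (hf : Integrable f μ) (hg : Integrable g μ) (hg0 : ∀ s, 0 ≤ g s)
    (lev : Cube n → ℕ) (hlev : ∀ s, f s = (1 / 2 : ℝ) ^ lev s) {C : ℝ} (hC : 0 < C)
    (hgf : ∫ s, g s ∂μ ≤ C * ∫ s, f s ∂μ) :
    ∃ s, 1 / (3 * C) * max (g s) (C * ∫ s, f s ∂μ) ≤ f s ∧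
      ((∫ s, f s ∂μ) / 3) ^ (n + 1) ≤ μ.real (box (lev s) (boxIdx (lev s) s)) := by
  classical
  by_contra! hbad
  have hf0 : ∀ s, 0 < f s := fun s => by rw [hlev]; positivity
  have hf1 : ∀ s, f s ≤ 1 := fun s => by
    rw [hlev]; exact pow_le_one₀ (by norm_num) (by norm_num)
  have pos : ∀ k : Cube n → ℝ, Integrable k μ → (∀ s, 0 < k s) → 0 < ∫ s, k s ∂μ := by
    intro k hk hk0
    rw [integral_pos_iff_support_of_nonneg (fun s => (hk0 s).le) hk]
    have : Function.support k = Set.univ := Set.eq_univ_of_forall fun s => (hk0 s).ne'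
    rw [this, measure_univ]
    exact one_pos
  set D := ∫ s, f s ∂μ with hD
  have hD0 : 0 < D := pos f hf hf0
  have hD1 : D ≤ 1 := by simpa using integral_mono hf (integrable_const 1) hf1
  obtain ⟨L, hL1, hL2⟩ := exists_nat_pow_near (x := 3 / D) (y := 2)
    (by rw [le_div_iff₀ hD0]; linarith) one_lt_two
  let V : Finset (Fin n → Fin (2 ^ L)) := Finset.univ.filter fun v =>
    μ.real (box L v) ≤ (D / 3) ^ (n + 1)
  let U : Set (Cube n) := ⋃ v ∈ V, box L v
  have hUm : MeasurableSet U := Finset.measurableSet_biUnion V fun v _ => measurableSet_box L v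
  have hU : μ.real U ≤ D / 3 := by
    calc μ.real U ≤ ∑ v ∈ V, μ.real (box L v) := measureReal_biUnion_finset_le _ _
      _ ≤ ∑ v ∈ V, (D / 3) ^ (n + 1) :=
          Finset.sum_le_sum fun v hv => (Finset.mem_filter.1 hv).2
      _ = V.card * (D / 3) ^ (n + 1) := by rw [Finset.sum_const, nsmul_eq_mul]
      _ ≤ (3 / D) ^ n * (D / 3) ^ (n + 1) := by
          refine mul_le_mul_of_nonneg_right ?_ (by positivity)
          refine le_trans ?_ (pow_le_pow_left₀ (by positivity) hL1 n)
          have := Finset.card_le_univ V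
          rw [Fintype.card_pi_const, Fintype.card_fin] at this
          exact_mod_cast this
      _ = D / 3 := by
          have h1 : 3 / D * (D / 3) = 1 := by field_simp
          rw [pow_succ, ← mul_assoc, ← mul_pow, h1, one_pow, one_mul]
  -- Where the first conclusion holds, `f ≥ D / 3` makes the cube at least as large as a level-`L`
  -- cube; as it is light, the point lies in `U`, and `f ≤ 1` suffices. Elsewhere `f` is below one
  -- of the first two terms.
  have hpt : ∀ s, 0 < 1 / (3 * C) * g s + D / 3 + U.indicator 1 s - f s := by
    intro s
    have hi : 0 ≤ U.indicator (1 : Cube n → ℝ) s := Set.indicator_nonneg (fun _ _ => by simp) s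
    have hc : 0 < 1 / (3 * C) := by positivity
    have hgs := mul_nonneg hc.le (hg0 s)
    have hCD : 1 / (3 * C) * (C * D) = D / 3 := by field_simp
    by_cases hs : 1 / (3 * C) * max (g s) (C * D) ≤ f s
    · have h1 := hbad s hs
      have h2 : D / 3 ≤ f s := by
        rw [← hCD]
        exact (mul_le_mul_of_nonneg_left (le_max_right _ _) hc.le).trans hs
      have h3 : lev s ≤ L := by
        by_contra! hlt
        have h4 : f s ≤ (1 / 2 : ℝ) ^ (L + 1) := by
          rw [hlev]; exact pow_le_pow_of_le_one (by norm_num) (by norm_num) hlt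
        have h5 : (1 / 2 : ℝ) ^ (L + 1) < D / 3 := by
          rw [one_div, inv_pow, ← inv_div]
          exact inv_strictAnti₀ (by positivity) hL2
        linarith
      have h6 : s ∈ U := by
        refine Set.mem_biUnion (x := boxIdx L s) ?_ (mem_box_boxIdx L s)
        refine Finset.mem_coe.2 (Finset.mem_filter.2 ⟨Finset.mem_univ _, le_trans ?_ h1.le⟩)
        refine measureReal_mono fun s' hs' => ?_
        rw [mem_box_iff] at hs' ⊢
        exact boxIdx_eq_of_le h3 hs'
      rw [Set.indicator_of_mem h6, Pi.one_apply]
      linarith [hf1 s]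
    · rw [not_le] at hs
      rcases max_choice (g s) (C * D) with h | h
      · rw [h] at hs; linarith
      · rw [h, hCD] at hs; linarith
  have hi1 : Integrable (fun s => 1 / (3 * C) * g s) μ := hg.const_mul _
  have hi2 : Integrable (U.indicator (1 : Cube n → ℝ)) μ :=
    (integrable_const (1 : ℝ)).indicator hUm
  have h7 := pos _ (((hi1.add (integrable_const (D / 3))).add hi2).sub hf) hpt
  have h8 : ∫ s, (1 / (3 * C) * g s + D / 3 + U.indicator 1 s - f s) ∂μ =
      1 / (3 * C) * ∫ s, g s ∂μ + D / 3 + μ.real U - D := by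
    rw [integral_sub (f := fun s => 1 / (3 * C) * g s + D / 3 + U.indicator 1 s)
      ((hi1.add (integrable_const (D / 3))).add hi2) hf,
      integral_add (f := fun s => 1 / (3 * C) * g s + D / 3)
      (hi1.add (integrable_const (D / 3))) hi2, integral_add hi1 (integrable_const _),
      integral_const_mul, integral_indicator_one hUm]
    simp [hD]
  change 0 < ∫ s, (1 / (3 * C) * g s + D / 3 + U.indicator 1 s - f s) ∂μ at h7
  rw [h8] at h7
  have h9 : 1 / (3 * C) * ∫ s, g s ∂μ ≤ D / 3 := by
    calc 1 / (3 * C) * ∫ s, g s ∂μ ≤ 1 / (3 * C) * (C * D) :=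
          mul_le_mul_of_nonneg_left hgf (by positivity)
      _ = D / 3 := by field_simp
  linarith

/-- The inequality between the constants that turns optimism into a regret bound. -/
theorem regret_le_of_optimism {A K Lr τ x D s J R hi lo : ℝ} (hA0 : 0 < A) (hA1 : A ≤ 1)
    (hK : 3 ≤ K) (hLr : 0 ≤ Lr) (hτ0 : 0 < τ) (hτ : τ ≤ 1 / 2) (hτx : 36 * τ ≤ x) (hxD : x ≤ D)
    (hCD : (3 * Lr + (1 + max 1 Lr) * K / A) * D ≤ 1) (hs : s * (1 - τ) ≤ 1 + Lr)
    (hopt : ∀ κ, 0 ≤ κ → κ ≤ x / 2 - τ → J + κ * (s - 1) - τ ≤ hi) (hlh : hi - lo ≤ τ)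
    (hlo : lo ≤ R + (2 * Lr + (K + A / 2) * (s / A)) * D) :
    J - R ≤ (3 * Lr + (1 + max 1 Lr) * K / A) * D := by
  set M := max 1 Lr with hM
  have hM1 : 1 ≤ M := le_max_left _ _
  have hMLr : Lr ≤ M := le_max_right _ _
  set k := K / A with hk
  have hk3 : 3 ≤ k := by rw [hk, le_div_iff₀ hA0]; nlinarith
  have hMk : (1 + M) * K / A = (1 + M) * k := by rw [hk]; ring
  have hsk : (K + A / 2) * (s / A) = s * k + s / 2 := by rw [hk]; field_simp
  rw [hMk] at hCD ⊢
  rw [hsk] at hlo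
  have hx0 : 0 < x := by linarith
  have hD0 : 0 < D := by linarith
  have hM0 : 6 ≤ (1 + M) * k := by nlinarith
  have hD1 : D ≤ 1 := by nlinarith
  -- The two errors `τ`, less the bonus, have to fit into the unused part of the coefficient of `D`.
  suffices h : ∃ κ, 0 ≤ κ ∧ κ ≤ x / 2 - τ ∧
      2 * τ - κ * (s - 1) ≤ (Lr + (1 + M) * k - s * k - s / 2) * D by
    obtain ⟨κ, h0, h1, h2⟩ := h
    have := hopt κ h0 h1
    nlinarith
  -- For `s ≤ 3 / 2` the unused coefficient is at least `3 / 4` and `D ≥ 36 * τ`, so no bonus is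
  -- needed. For larger `s` the largest `κ` brings the errors down to `5 / 2 * τ - x / 4 ≤ -13 / 2 *
  -- τ`. The unused coefficient may then be negative, as `s` can exceed `1 + Lr` by `s * τ`, but
  -- multiplied by `D` it is at least `-8 / 3 * τ`.
  rcases le_total s (3 / 2) with hs1 | hs1
  · refine ⟨0, le_rfl, by linarith, ?_⟩
    have h1 : 3 / 4 ≤ Lr + (1 + M) * k - s * k - s / 2 := by nlinarith
    nlinarith
  · refine ⟨x / 2 - τ, by linarith, le_rfl, ?_⟩
    have h0 : 2 * τ - (x / 2 - τ) * (s - 1) ≤ 5 / 2 * τ - x / 4 := by nlinarith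
    have hs2 : s ≤ 2 * (1 + M) := by nlinarith
    have hsτ : s - s * τ - 1 ≤ Lr := by linarith
    rcases le_total s 2 with h2 | h2
    · have h3 : -(2 * τ) ≤ Lr + (1 + M) * k - s * k - s / 2 := by
        have h4 : 0 ≤ (1 + M - s) * (k - 3) := mul_nonneg (by linarith) (by linarith)
        have h5 : 0 ≤ τ * (2 - s) := mul_nonneg hτ0.le (by linarith)
        linarith
      have h6 := mul_le_mul_of_nonneg_right h3 hD0.le
      have h7 := mul_le_mul_of_nonneg_left hD1 hτ0.le
      linarith
    · have h3 : -(s * τ * (1 + k)) ≤ Lr + (1 + M) * k - s * k - s / 2 := by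
        have h4 : 0 ≤ (1 + M - s + s * τ) * k := mul_nonneg (by linarith) (by linarith)
        linarith
      have h4 : s * (1 + k) ≤ 8 / 3 * (3 * Lr + (1 + M) * k) := by
        have : s * (1 + k) ≤ 2 * (1 + M) * (4 / 3 * k) :=
          mul_le_mul hs2 (by linarith) (by linarith) (by linarith)
        linarith
      have h5 : s * τ * (1 + k) * D ≤ 8 / 3 * τ := by
        have h6 := mul_le_mul_of_nonneg_left h4 (mul_pos hτ0 hD0).le
        have h7 := mul_le_mul_of_nonneg_left hCD hτ0.le
        linarith
      have h8 := mul_le_mul_of_nonneg_right h3 hD0.le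
      linarith

/-! ### Regret of an episode's policy and the wide cell -/

namespace Setting

variable {dS dA : ℕ} {E : Setting dS dA} {ω : SamplePath dS dA} {t : ℕ}

theorem six_le_C₁ (hE : E.Standing) : 6 ≤ E.C₁ := by
  have hA : 0 < 1 - E.α := by linarith [hE.hα.2]
  have hM : 1 ≤ max 1 E.Lr := le_max_left _ _
  have h1 : 6 ≤ (1 + max 1 E.Lr) * (3 + 3 * E.Lp + E.Cv) / (1 - E.α) := by
    rw [le_div_iff₀ hA]
    nlinarith [hE.hα.1, hE.hLp, hE.hCv]
  rw [C₁]
  linarith [hE.hLr]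

/-- If the active cells may be small, the horizon is large compared with the minimal diameter. -/
theorem le_minDiam_of_le (hdS : 0 < dS) (hE : E.Standing) (hx : E.minDiam ≤ 1 / 6) :
    36 * (1 / (E.T : ℝ)) ≤ E.minDiam := by
  have hT := T_pos hE
  have hT2 : (2 : ℝ) ≤ E.T := by exact_mod_cast hE.hT
  have hx0 := minDiam_pos hE
  have hy := budget_pos hE
  have hpow := minDiam_pow hE
  -- Here `216 = 6 ^ 3`, and `dS ≥ 1` makes the exponent `dS + 2` at least `3`.
  have h1 : E.budget * 216 ≤ E.T := by
    have h2 : E.minDiam ^ (dS + 2) ≤ E.minDiam ^ 3 :=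
      pow_le_pow_of_le_one hx0.le (by linarith) (by omega)
    have h3 : E.minDiam ^ 3 ≤ (1 / 6) ^ 3 := pow_le_pow_left₀ hx0.le hx 3
    rw [hpow] at h2
    have h4 := h2.trans h3
    rw [div_le_iff₀ hT] at h4
    linarith
  have hlog : Real.log (4 * E.T) ≤ 4.5 * E.budget := by
    have h2 := hE.c₁_eq
    rw [mul_assoc (4.5 : ℝ)] at h2
    change _ = 4.5 * E.budget at h2
    rw [← h2]
    refine Real.log_le_log (by positivity) ?_
    have h3 : (1 : ℝ) ≤ (E.T / (E.c₁ * E.logTδ)) ^ (((dS : ℝ) + dA) / ((dS : ℝ) + 2)) := by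
      refine Real.one_le_rpow ?_ (by positivity)
      change 1 ≤ E.T / E.budget
      rw [le_div_iff₀ hy]
      linarith
    rw [le_div_iff₀ hE.hδ.1]
    nlinarith [hE.hδ.2, hE.hδ.1]
  -- Bootstrap: a budget below `1` gives `4 * T ≤ exp 5`, so `216 * budget ≤ T` forces the budget
  -- below `0.2`; then `4 * T ≤ exp 1`, which contradicts `T ≥ 2`.
  have hy1 : 1 ≤ E.budget := by
    by_contra! hlt
    have h5 : 4 * (E.T : ℝ) ≤ Real.exp (4.5 * E.budget) :=
      (Real.log_le_iff_le_exp (by positivity)).1 hlog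
    have h6 : Real.exp (4.5 * E.budget) ≤ Real.exp 1 ^ 5 := by
      rw [← Real.exp_nat_mul]
      exact Real.exp_le_exp.2 (by push_cast; linarith)
    have h7 := Real.exp_one_lt_d9
    have h8 : Real.exp 1 ^ 5 ≤ 149 :=
      (pow_le_pow_left₀ (Real.exp_pos 1).le (by linarith : Real.exp 1 ≤ 2.72) 5).trans
        (by norm_num)
    have h9 : E.budget < 0.2 := by norm_num1; linarith
    have h10 : Real.exp (4.5 * E.budget) ≤ Real.exp 1 := Real.exp_le_exp.2 (by linarith)
    linarith
  have h11 : E.minDiam ^ (dS + 1) ≤ 1 / 36 := by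
    calc E.minDiam ^ (dS + 1) ≤ E.minDiam ^ 2 :=
          pow_le_pow_of_le_one hx0.le (by linarith) (by omega)
      _ ≤ (1 / 6) ^ 2 := pow_le_pow_left₀ hx0.le hx 2
      _ = 1 / 36 := by norm_num
  have h12 : 1 / (E.T : ℝ) ≤ E.minDiam ^ (dS + 1) * E.minDiam := by
    rw [← pow_succ, hpow]
    exact div_le_div_of_nonneg_right hy1 hT.le
  nlinarith

/-- The regret of the policy of an episode is at most `C₁` times its diameter. -/
theorem optAvgReward_sub_le (hdS : 0 < dS) (hE : E.Standing) (hG : ω ∈ E.G₁) (ht : t < E.T)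
    {φ : Cube dS → Cube dA} (hφ : E.IsZoRLPolicy ω t φ) (s₀ : Cube dS) :
    E.M.optAvgReward s₀ - ∫ s, E.M.r (s, φ s) ∂(E.M.statMeasure φ) ≤
      E.C₁ * E.policyDiam ω t φ := by
  obtain ⟨φd, ⟨n, hst, -, hgr⟩, hφd⟩ := hφ
  have hm := measurable_policy hφd
  obtain ⟨hp, -⟩ := MDP.statMeasure_spec hE.hα hE.ergodic hm
  have hr := MDP.integral_reward_mem (M := E.M) hm (E.M.statMeasure φ)
  have hJ := MDP.optAvgReward_le_one (M := E.M) s₀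
  -- Rewards lie in `[0, 1]`, so the first case is trivial. In the second, `C₁ ≥ 6` gives `minDiam ≤
  -- D ≤ 1 / 6`.
  rcases le_total 1 (E.C₁ * E.policyDiam ω t φ) with h1 | hCD
  · linarith [hr.1]
  have hC := six_le_C₁ hE
  have hD : min 1 E.minDiam ≤ E.policyDiam ω t φ := by
    have := integral_mono (μ := E.M.statMeasure φ) (integrable_const (min 1 E.minDiam))
      (integrable_cellDiam_policy hφd hE (E.M.statMeasure φ))
      fun s => min_minDiam_le_cellDiam hE ht (activeCell_spec (ω := ω) hE t (s, φ s)).1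
    simp only [integral_const, probReal_univ, one_smul] at this
    exact this
  have hA0 : 0 < 1 - E.α := by linarith [hE.hα.2]
  have hA1 : 1 - E.α ≤ 1 := by linarith [hE.hα.1]
  have hx0 := minDiam_pos hE
  have hD0 : 0 < E.policyDiam ω t φ := lt_of_lt_of_le (lt_min one_pos hx0) hD
  have hD6 : E.policyDiam ω t φ ≤ 1 / 6 := by nlinarith
  have hx1 : E.minDiam ≤ 1 := by
    by_contra! hlt
    rw [min_eq_left hlt.le] at hD
    linarith
  rw [min_eq_right hx1] at hD
  have hτx := le_minDiam_of_le hdS hE (hD.trans hD6)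
  have hT2 : (2 : ℝ) ≤ E.T := by exact_mod_cast hE.hT
  have hT := T_pos hE
  have hτ0 : 0 < 1 / (E.T : ℝ) := by positivity
  have hτ : 1 / (E.T : ℝ) ≤ 1 / 2 := one_div_le_one_div_of_le two_pos hT2
  have hR := isRectangular_extMDP hE hG hx1 (by linarith) ht
  set v := (E.extMDP ω t).iter E.spanBound n with hv
  have hγ : 0 ≤ E.contr ω t ∧ E.contr ω t ≤ 1 := by
    have hc : (1 : ℝ) ≤ Fintype.card (E.DState ω t) := by exact_mod_cast Fintype.card_pos
    have h1 : 0 < (Fintype.card (E.DState ω t) : ℝ) * E.T := by positivity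
    have h2 : (1 - E.α) / ((Fintype.card (E.DState ω t) : ℝ) * E.T) ≤ 1 := by
      rw [div_le_one h1]; nlinarith
    have h3 := div_pos hA0 h1
    rw [contr]
    constructor <;> linarith
  have hosc := hst.sub_le hγ.1 hγ.2
  obtain ⟨ξm, hξm⟩ := Finite.exists_min fun ξ =>
    (E.extMDP ω t).truncBellman E.spanBound v ξ - v ξ
  obtain ⟨ξM, hξM⟩ := Finite.exists_max fun ξ =>
    (E.extMDP ω t).truncBellman E.spanBound v ξ - v ξ
  have hA := le_integral_reward hφd hE hG ht hR hgr hξm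
  have hspan : span v ≤ E.spanBound := span_le (ExtMDP.iter_sub_le (spanBound_nonneg hE) n)
  -- The span is measured in units of `1 / (1 - α)`, and `K = Ceta - (1 - α)`.
  refine regret_le_of_optimism (s := (1 - E.α) * span v) hA0 hA1
    (by linarith [hE.hLp, hE.hCv] : 3 ≤ 3 + 3 * E.Lp + E.Cv) hE.hLr hτ0 hτ hτx hD hCD ?_
    (fun κ hκ0 hκ => optAvgReward_le hE hG hx1 ht hR s₀ hξm hξM (hosc ξM ξm) hκ0 hκ)
    (hosc ξM ξm) ?_
  · have h1 : 0 < 1 - 1 / (E.T : ℝ) := by linarith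
    rw [spanBound, le_div_iff₀ (mul_pos hA0 h1)] at hspan
    linarith
  · refine hA.trans (le_of_eq ?_)
    rw [mul_div_cancel_left₀ _ hA0.ne', Ceta]
    ring

/-- The stationary law of the gap of the policy of an episode. -/
theorem integral_gap_le (hdS : 0 < dS) (hE : E.Standing) (hG : ω ∈ E.G₁) (ht : t < E.T)
    {φ : Cube dS → Cube dA} (hφ : E.IsZoRLPolicy ω t φ) (s₀ : Cube dS) :
    Integrable (fun s => E.M.gap s₀ s (φ s)) (E.M.statMeasure φ) ∧
      ∫ s, E.M.gap s₀ s (φ s) ∂(E.M.statMeasure φ) ≤ E.C₁ * E.policyDiam ω t φ := by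
  obtain ⟨φd, hout, hφd⟩ := id hφ
  have hm := measurable_policy hφd
  obtain ⟨hp, hinv⟩ := MDP.statMeasure_spec hE.hα hE.ergodic hm
  have H := MDP.solvesAROE_relValue hE.lip_r hE.lip_p hE.hα hE.ergodic s₀
  obtain ⟨C, hC⟩ := H.bounded
  have hab : ∀ s, E.M.relValue s₀ s ∈ Set.Icc (-C) C := fun s => abs_le.1 (hC s)
  have hi := integrable_of_mem_Icc (μ := E.M.statMeasure φ) H.measurable hab
  have hPm : Measurable fun s => ∫ s', E.M.relValue s₀ s' ∂(E.M.p (s, φ s)) :=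
    (MDP.measurable_integral_p H.measurable).comp (measurable_id.prodMk hm)
  have hPi := integrable_of_mem_Icc (μ := E.M.statMeasure φ) hPm
    fun s => MDP.integral_p_mem H.measurable hab _
  have hr : Integrable (fun s => E.M.r (s, φ s)) (E.M.statMeasure φ) :=
    integrable_of_mem_Icc (E.M.measurable_r.comp (measurable_id.prodMk hm)) fun s => E.M.r_mem _
  refine ⟨(((integrable_const _).add hi).sub hr).sub hPi, ?_⟩
  have h1 := MDP.integral_gap_eq (M := E.M) hm (J := E.M.optAvgReward s₀) H.measurable hC
    (E.M.statMeasure φ)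
  have h2 : ∫ s, E.M.relValue s₀ s ∂(E.M.statMeasure φ) =
      ∫ s, ∫ s', E.M.relValue s₀ s' ∂(E.M.p (s, φ s)) ∂(E.M.statMeasure φ) := by
    conv_lhs => rw [← hinv]
    exact MDP.integral_step hm _ H.measurable hab
  rw [integral_sub hi hPi, h2, sub_self, add_zero] at h1
  exact h1.trans_le (optAvgReward_sub_le hdS hE hG ht hφ s₀)

/-- A policy of `ScOpt` visits a wide cell often, at a point of small suboptimality gap. -/
theorem exists_wide_cell (hdS : 0 < dS) (hE : E.Standing) (hG : ω ∈ E.G₁) (ht : t < E.T)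
    {φ : Cube dS → Cube dA} (hφ : E.IsZoRLPolicy ω t φ) (s₀ : Cube dS) :
    ∃ (s : Cube dS) (ζ : Cell dS dA), E.Active ω t ζ ∧ (s, φ s) ∈ ζ.toSet ∧
      1 / (3 * E.C₁) * max (E.M.gap s₀ s (φ s)) (E.C₁ * E.policyDiam ω t φ) ≤ E.cellDiam ζ ∧
      (E.policyDiam ω t φ / 3) ^ (dS + 1) ≤ (E.M.statMeasure φ).real ζ.piS := by
  obtain ⟨φd, -, hφd⟩ := id hφ
  obtain ⟨hp, -⟩ := MDP.statMeasure_spec hE.hα hE.ergodic (measurable_policy hφd)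
  obtain ⟨hgi, hgle⟩ := integral_gap_le hdS hE hG ht hφ s₀
  have H := MDP.solvesAROE_relValue hE.lip_r hE.lip_p hE.hα hE.ergodic s₀
  obtain ⟨s, hs, hμ⟩ := exists_of_integral_le (E.M.statMeasure φ)
    (integrable_cellDiam_policy hφd hE (E.M.statMeasure φ)) hgi
    (fun s => H.gap_nonneg s _) (fun s => (E.activeCell ω t (s, φ s)).level)
    (fun s => cellDiam_eq _) (by linarith [six_le_C₁ hE]) hgle
  obtain ⟨hζ, hz⟩ := activeCell_spec (ω := ω) hE t (s, φ s)
  refine ⟨s, _, hζ, hz, hs, hμ.trans (le_of_eq ?_)⟩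
  congr 1
  ext s'
  rw [mem_piS_iff _ ⟨_, hz⟩, (mem_box_iff _ _ _).1 hz.1]

end Setting

end ZoRL

theorem mainTheorem3 {dS dA : ℕ} (hdS : 0 < dS) (hdA : 0 < dA) (E : ZoRL.Setting dS dA)
    (hE : E.Standing) (ω : ZoRL.SamplePath dS dA) (hrun : E.IsRun ω) (hG : ω ∈ E.G₁)
    (k : ℕ) (hk : ω.τ k < E.T) :
    ∃ (s : ZoRL.Cube dS) (ζ : ZoRL.Cell dS dA),
      E.Active ω (ω.τ k) ζ ∧ (s, ω.φ k s) ∈ ζ.toSet ∧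
      1 / (3 * E.C₁) *
          max (E.M.gap (ω.state 0) s (ω.φ k s)) (E.C₁ * E.policyDiam ω (ω.τ k) (ω.φ k))
        ≤ E.cellDiam ζ ∧
      (E.policyDiam ω (ω.τ k) (ω.φ k) / 3) ^ (dS + 1)
        ≤ (E.M.statMeasure (ω.φ k)).real ζ.piS :=
  ZoRL.Setting.exists_wide_cell hdS hE hG hk (hrun.policy k hk) (ω.state 0)
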